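/- Let $m\ge 1$ and let $F$ be an $m\times m$ matrix of rational functions of one complex variable such that: (analytic) $F$ is bounded and analytic on the open unit disc $\mathbb D$ (hence has no poles on $\overline{\mathbb D}$); (normal) $F(t)$ is a normal matrix for almost every $t\in\mathbb T=\partial\mathbb D$; (non-degenerate) for every $c\in\mathbb C$, $\det(F(t)-cI)$ is not identically zero on $\mathbb D$. Put $\gamma(F)=\bigcup_{s\in[0,2\pi]}\sigma\big(F(e^{is})\big)$ and let $\lambda\in\mathbb C\setminus\gamma(F)$. Then the following three quantities are equal to one and the same non-negative integer. (i) The winding number $$\operatorname{wind}_F(\lambda)=\frac1{2\pi}\sum_{j=1}^m\Delta_{[0,2\pi]}\arg\big(\zeta_j(\cdot)-\lambda\big),$$ where $\zeta_1,\dots,\zeta_m$ are continuous functions on $[0,2\pi]$ such that $\zeta_1(\theta),\dots,\zeta_m(\theta)$ are the eigenvalues of $F(e^{i\theta})$, counted with multiplicity, for each $\theta$. (Such branches exist, and the value does not depend on their choice.) (ii) $\dim\big(H^2_m\ominus(M_F-\lambda)H^2_m\big)$, where $H^2_m$ is the Hilbert space of functions $f(t)=\sum_{n\ge0}a_nt^n$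 on $\mathbb D$ with $a_n\in\mathbb C^m$ and $\|f\|^2=\sum_n\|a_n\|^2<\infty$, and $(M_Ff)(t)=F(t)f(t)$. (iii) The number $\operatorname{ind}_\lambda\big(z,\Delta^+_{(3)}(F)\big)$ of points of the $+$ half of $\Delta_{(3)}(F)$ at which $z=\lambda$, counted with multiplicity. Here $\Delta_{(3)}(F)\subset\mathbb C^3$ is the algebraic curve that is the closure of the set of all $(z,w,t)$ such that $t\ne0$, neither $t$ nor $\bar t^{-1}$ is a pole of $F$, and there is $\phi\in\mathbb C^m$, $\phi\neq0$, with $F(t)\phi=z\phi$ and $F(\bar t^{-1})^*\phi=w\phi$. Let $\Delta_j$ be its irreducible pieces, $\widehat\Delta_j$ their desingularizations (compact Riemann surfaces, including the ideal points), and $\alpha_j$ the multiplicity of $\Delta_j$, i.e. the value of $\dim\operatorname{Ker}(F(t)-zI)$ at all but finitely many points $(z,w,t)$ of $\Delta_j$. The set $|t|=1$ divides $\widehat\Delta_j$ into the halves $\{|t|<1\}$ and $\{|t|>1\}$; $\widehat\Delta_j^+$ denotes the half on which $z$ has no poles. Then $$\operatorname{ind}_\lambda\big(z,\Delta^+_{(3)}(F)\big)=\sum_j\alpha_j\sum_{\delta\in\widehat\Delta_j^+,\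 z(\delta)=\lambda}\operatorname{ord}_\delta(z-\lambda).$$ -/

import Mathlib

noncomputable section

namespace NormalSymbol

/-! ### Rational matrix functions -/

/-- An `m × m` matrix whose entries are rational functions of one complex variable. -/
abbrev RatMatrix (m : ℕ) : Type := Matrix (Fin m) (Fin m) (RatFunc ℂ)

variable {m : ℕ}

/-- `t` is a (finite) pole of `F`: the reduced denominator of some entry vanishes at `t`. -/
def IsPole (F : RatMatrix m) (t : ℂ) : Prop :=
  ∃ i k, (F i k).denom.IsRoot t

/-- The value `F(t)`; meaningful when `t` is not a pole of `F`. -/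
def value (F : RatMatrix m) (t : ℂ) : Matrix (Fin m) (Fin m) ℂ :=
  Matrix.of fun i k => (F i k).eval (RingHom.id ℂ) t

/-- The point `exp (i θ)` of the unit circle. -/
def circlePt (θ : ℝ) : ℂ := Complex.exp (θ * Complex.I)

/-- `F` is bounded and analytic on the open unit disc. -/
def IsAnalytic (F : RatMatrix m) : Prop :=
  (∀ t : ℂ, ‖t‖ < 1 → ¬ IsPole F t) ∧
    ∃ C : ℝ, ∀ t : ℂ, ‖t‖ < 1 → ∀ i k, ‖value F t i k‖ ≤ C

/-- `F(t)` is defined and is a normal matrix for almost every `t` in the unit circle. -/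
def IsNormal (F : RatMatrix m) : Prop :=
  ∀ᵐ θ : ℝ, ¬ IsPole F (circlePt θ) ∧ IsStarNormal (value F (circlePt θ))

/-- For no constant `c` does `det (F(t) - c I)` vanish identically on the open unit disc. -/
def IsNondegenerate (F : RatMatrix m) : Prop :=
  ∀ c : ℂ, ∃ t : ℂ, ‖t‖ < 1 ∧ ¬ IsPole F t ∧
    (value F t - c • (1 : Matrix (Fin m) (Fin m) ℂ)).det ≠ 0

/-- The class of nondegenerate analytic rational normal `m × m` matrix functions. -/
structure NDARN (F : RatMatrix m) : Prop where
  nondegenerate : IsNondegenerate F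
  analytic : IsAnalytic F
  normal : IsNormal F

/-- `γ(F)`: the union of the spectra of `F(exp (i s))`, `0 ≤ s ≤ 2π`. -/
def gammaSet (F : RatMatrix m) : Set ℂ :=
  ⋃ s ∈ Set.Icc (0 : ℝ) (2 * Real.pi), spectrum ℂ (value F (circlePt s))

/-! ### The winding number -/

/-- `ζ₁, …, ζₘ` are continuous branches on `[0, 2π]` of the eigenvalues of `F(exp (i θ))`,
counted with algebraic multiplicity. -/
structure IsEigenvalueBranches (F : RatMatrix m) (ζ : Fin m → ℝ → ℂ) : Prop where
  continuousOn : ∀ j, ContinuousOn (ζ j) (Set.Icc 0 (2 * Real.pi))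
  eigenvalues : ∀ θ ∈ Set.Icc (0 : ℝ) (2 * Real.pi),
    (value F (circlePt θ)).charpoly.roots =
      (Finset.univ : Finset (Fin m)).val.map fun j => ζ j θ

/-- `a` is a continuous argument on `[0, 2π]` of the nowhere vanishing path `f`. -/
structure IsContinuousArg (f : ℝ → ℂ) (a : ℝ → ℝ) : Prop where
  continuousOn : ContinuousOn a (Set.Icc 0 (2 * Real.pi))
  ne_zero : ∀ θ ∈ Set.Icc (0 : ℝ) (2 * Real.pi), f θ ≠ 0
  arg_eq : ∀ θ ∈ Set.Icc (0 : ℝ) (2 * Real.pi),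
    f θ = (‖f θ‖ : ℂ) * Complex.exp (a θ * Complex.I)

/-- `x` is obtained, for some choice of continuous branches `ζⱼ` of the eigenvalues, as
`1 / (2π)` times the sum of the increments over `[0, 2π]` of the arguments of `ζⱼ - z₀`. -/
def IsWindingNumber (F : RatMatrix m) (z₀ : ℂ) (x : ℝ) : Prop :=
  ∃ (ζ : Fin m → ℝ → ℂ) (a : Fin m → ℝ → ℝ),
    IsEigenvalueBranches F ζ ∧ (∀ j, IsContinuousArg (fun θ => ζ j θ - z₀) (a j)) ∧
      x = 1 / (2 * Real.pi) * ∑ j, (a j (2 * Real.pi) - a j 0)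

/-! ### The vector Hardy space and multiplication by `F - λ` -/

/-- The Hardy space `H²ₘ`, an element being given by its square summable sequence of Taylor
coefficients in `ℂᵐ` (with the Euclidean norm). -/
abbrev Hardy (m : ℕ) : Type := lp (fun _ : ℕ => EuclideanSpace ℂ (Fin m)) 2

/-- The value `f(t) = ∑ aₙ tⁿ` of `f ∈ H²ₘ` at a point `t` of the open unit disc. -/
def Hardy.at (f : Hardy m) (t : ℂ) : EuclideanSpace ℂ (Fin m) :=
  ∑' n : ℕ, t ^ n • f n

lemma Hardy.summable (f : Hardy m) {t : ℂ} (ht : ‖t‖ < 1) :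
    Summable fun n : ℕ => t ^ n • f n := by
  refine Summable.of_norm_bounded (g := fun n : ℕ => ‖t‖ ^ n * ‖f‖)
    ((summable_geometric_of_lt_one (norm_nonneg t) ht).mul_right ‖f‖) fun n => ?_
  rw [norm_smul, norm_pow]
  exact mul_le_mul_of_nonneg_left (lp.norm_apply_le_norm (by norm_num) f n) (by positivity)

/-- `(M_F - λ) H²ₘ`: the functions in `H²ₘ` of the form `t ↦ F(t) f(t) - λ f(t)`
with `f ∈ H²ₘ`. -/
def mulRange (F : RatMatrix m) (lam : ℂ) : Submodule ℂ (Hardy m) where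
  carrier := {g | ∃ f : Hardy m, ∀ t : ℂ, ‖t‖ < 1 →
    g.at t = Matrix.toEuclideanLin (value F t) (f.at t) - lam • f.at t}
  zero_mem' := ⟨0, fun t _ => by simp [Hardy.at]⟩
  add_mem' := by
    rintro g₁ g₂ ⟨f₁, h₁⟩ ⟨f₂, h₂⟩
    have key : ∀ (u v : Hardy m) (t : ℂ), ‖t‖ < 1 → (u + v).at t = u.at t + v.at t := by
      intro u v t ht
      simp only [Hardy.at, lp.coeFn_add, Pi.add_apply, smul_add]
      exact (u.summable ht).tsum_add (v.summable ht)
    refine ⟨f₁ + f₂, fun t ht => ?_⟩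
    rw [key _ _ t ht, key _ _ t ht, h₁ t ht, h₂ t ht, map_add, smul_add]
    abel
  smul_mem' := by
    rintro c g ⟨f, h⟩
    have key : ∀ (u : Hardy m) (t : ℂ), (c • u).at t = c • u.at t := by
      intro u t
      simp only [Hardy.at, lp.coeFn_smul, Pi.smul_apply]
      rw [← tsum_const_smul'']
      exact tsum_congr fun n => smul_comm _ _ _
    refine ⟨c • f, fun t ht => ?_⟩
    rw [key, key, h t ht, map_smul, smul_sub, smul_comm]

/-! ### Desingularization of an algebraic curve in `ℂ³`

Coordinates of `ℂ³` are indexed by `Fin 3`: `0` is `z`, `1` is `w`, `2` is `t`. -/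

/-- The irreducible pieces of an algebraic set `Δ ⊆ ℂ³`, given by their prime ideals, the
minimal primes over the ideal of `Δ`. -/
def Piece (Δ : Set (Fin 3 → ℂ)) : Type :=
  {p : Ideal (MvPolynomial (Fin 3) ℂ) //
    p ∈ (MvPolynomial.vanishingIdeal ℂ Δ).minimalPrimes}

variable {Δ : Set (Fin 3 → ℂ)}

instance (j : Piece Δ) : j.1.IsPrime := Ideal.IsMinimalPrime.isPrime j.2

/-- The irreducible piece itself, as a subset of `ℂ³`. -/
def Piece.points (j : Piece Δ) : Set (Fin 3 → ℂ) := MvPolynomial.zeroLocus ℂ j.1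

/-- The field of rational functions on an irreducible piece. -/
abbrev Piece.FunctionField (j : Piece Δ) : Type :=
  FractionRing (MvPolynomial (Fin 3) ℂ ⧸ j.1)

/-- A coordinate function on an irreducible piece. -/
def Piece.coord (j : Piece Δ) (i : Fin 3) : j.FunctionField :=
  algebraMap (MvPolynomial (Fin 3) ℂ ⧸ j.1) j.FunctionField
    (Ideal.Quotient.mk j.1 (MvPolynomial.X i))

/-- The points of the desingularization of an irreducible curve (the compact Riemann surface
of the curve, ideal points included): the discrete valuation rings of its function field that
contain the constants. -/
structure Place (j : Piece Δ) where
  ring : ValuationSubring j.FunctionField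
  const_mem : ∀ c : ℂ, algebraMap ℂ j.FunctionField c ∈ ring
  dvr : IsDiscreteValuationRing ring

namespace Place

variable {j : Piece Δ}

/-- The meromorphic function `f` has no pole at the point `P`. -/
def Regular (P : Place j) (f : j.FunctionField) : Prop := f ∈ P.ring

/-- The meromorphic function `f` takes the finite value `c` at the point `P`, that is, `f - c`
lies in the maximal ideal of the valuation ring. -/
def HasValue (P : Place j) (f : j.FunctionField) (c : ℂ) : Prop :=
  P.ring.valuation (f - algebraMap ℂ j.FunctionField c) < 1

open Classical in
/-- The order of the zero of `f` at `P` (equal to `0` if `f` has a pole at `P`). -/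
def zeroOrder (P : Place j) (f : j.FunctionField) : ℕ∞ :=
  haveI := P.dvr
  if h : f ∈ P.ring then IsDiscreteValuationRing.addVal P.ring ⟨f, h⟩ else 0

/-- `|t| < 1` at `P`. -/
def IsInner (P : Place j) : Prop := ∃ c : ℂ, ‖c‖ < 1 ∧ P.HasValue (j.coord 2) c

/-- `|t| > 1` at `P` (where `|t| = ∞` is allowed). -/
def IsOuter (P : Place j) : Prop :=
  ¬ P.Regular (j.coord 2) ∨ ∃ c : ℂ, 1 < ‖c‖ ∧ P.HasValue (j.coord 2) c

/-- `P` lies in the `+` half of its piece. The real part `|t| = 1` divides (the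
desingularization of) a piece of an Ahlfors type curve into the halves `|t| < 1` and
`|t| > 1`; the `+` half is the one on which `z` has no poles. -/
def IsPlus (P : Place j) : Prop :=
  (P.IsInner ∧ ∀ Q : Place j, Q.IsInner → Q.Regular (j.coord 0)) ∨
    (P.IsOuter ∧ ∀ Q : Place j, Q.IsOuter → Q.Regular (j.coord 0))

end Place

/-! ### The curve of a rational matrix function -/

/-- The points `(z, w, t)` with `t ≠ 0`, `t` and `1 / conj t` not poles of `F`, such that
`F(t)` and `F(1 / conj t)ᴴ` have a common eigenvector with eigenvalues `z` and `w`. -/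
def curve0 (F : RatMatrix m) : Set (Fin 3 → ℂ) :=
  {x | x 2 ≠ 0 ∧ ¬ IsPole F (x 2) ∧ ¬ IsPole F (star (x 2))⁻¹ ∧
    ∃ φ : Fin m → ℂ, φ ≠ 0 ∧ (value F (x 2)).mulVec φ = x 0 • φ ∧
      (value F (star (x 2))⁻¹).conjTranspose.mulVec φ = x 1 • φ}

/-- The curve `Δ₍₃₎(F)`, the closure of `curve0 F` in `ℂ³`. -/
def curve3 (F : RatMatrix m) : Set (Fin 3 → ℂ) := closure (curve0 F)

/-- `ν(z, w, t) = dim Ker (F(t) - z I)`. -/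
def nu (F : RatMatrix m) (x : Fin 3 → ℂ) : ℕ :=
  Module.finrank ℂ (Module.End.eigenspace (Matrix.toLin' (value F (x 2))) (x 0))

/-- The multiplicity `α` of an irreducible piece of `Δ₍₃₎(F)`: the number to which `ν` is equal
on the piece, except at finitely many of its points. -/
def pieceMult (F : RatMatrix m) (j : Piece (curve3 F)) : ℕ :=
  sInf {n : ℕ | {x ∈ j.points | nu F x ≠ n}.Finite}

/-- The number of points of the `+` half of the desingularization of `Δ₍₃₎(F)` at which
`z = λ`, each counted with the order of the zero of `z - λ` times the multiplicity of the
irreducible piece that it lies on. -/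
def plusIndex (F : RatMatrix m) (lam : ℂ) : ℕ∞ :=
  ∑' P : Σ j : Piece (curve3 F), {P : Place j // P.IsPlus ∧ P.HasValue (j.coord 0) lam},
    (pieceMult F P.1 : ℕ∞) *
      P.2.1.zeroOrder (P.1.coord 0 - algebraMap ℂ P.1.FunctionField lam)

end NormalSymbol

end

noncomputable section

namespace NormalSymbol

open Polynomial

variable {m : ℕ}

/-! Write `d = den F`. Boundedness keeps the zeros of `d` out of the closed disc, and `λ ∉ γ(F)`
keeps the zeros of the polynomial `det (d (F - λ))`, which is `(shiftNum F lam).det`, off the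
circle. The common value is the number of zeros of this polynomial in the open disc, with
multiplicity (`discRoots`).

Winding number (`isWindingNumber_iff`): on the circle `∏ (ζⱼ - λ) = det (F - λ)`, arguments add, and
the argument principle for polynomials counts the zeros, `d` contributing none. Branches exist
because the spectrum varies continuously as a multiset and a continuous family of multisets over an
interval has a continuous enumeration (`MultisetContinuousOn.hasBranches`).

Index (`rank_mulRange_orthogonal`): multiplication by `d` is invertible on the Hardy space, so the
range is that of the polynomial matrix `d (F - λ)`. Each zero `a` of its determinant in the disc
splits off an invertible constant matrix times `diag (1, …, X - a, …, 1)`. The diagonal factor acts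
as an invertible operator times the shift of one coordinate, which has corank one. Coranks add for
left invertible factors, and what remains at the end is surjective.

Curve (`plusIndex_eq`): normality on the circle forces the reflected adjoint of `F` to be a
polynomial in `F` over `ℂ(t)`, so `w` is a rational function of `z` and `t`. Hence the pieces of the
curve correspond to the distinct irreducible factors `μ` of the characteristic polynomial of `d F`,
and the function field of a piece is `ℂ(t)[y]/(μ)` with `y = d z`. Normality also makes `d F`
diagonalizable at almost every `t`, so the multiplicity of a piece is the exponent of `μ`. By
nondegeneracy `z` is not constant on a piece; it has no pole over the closed disc, so it has one
outside, and the `+` half is `|t| < 1`. The norm of `λ d - y` down to `ℂ[t]` is `μ(λ d)`. Factoring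
the ideal of `λ d - y` into primes, each of which has a linear norm, equates the zeros of `z - λ`
over the disc with the zeros of `μ(λ d)` there. The product of the `μ(λ d)` with their exponents is
the determinant up to sign. -/

/-! ### Clearing denominators -/

/-- A common denominator of the entries of `F`. -/
def den (F : RatMatrix m) : ℂ[X] := ∏ i, ∏ k, (F i k).denom

/-- The polynomial matrix `den F • F`. -/
def num (F : RatMatrix m) : Matrix (Fin m) (Fin m) ℂ[X] :=
  Matrix.of fun i k => (F i k).num * (den F / (F i k).denom)

/-- The value at `t` of a polynomial matrix. -/
abbrev evalMat (t : ℂ) : Matrix (Fin m) (Fin m) ℂ[X] →+* Matrix (Fin m) (Fin m) ℂ :=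
  (evalRingHom t).mapMatrix

lemma evalMat_apply (t : ℂ) (P : Matrix (Fin m) (Fin m) ℂ[X]) (i k : Fin m) :
    evalMat t P i k = (P i k).eval t := rfl

lemma denom_dvd_den (F : RatMatrix m) (i k : Fin m) : (F i k).denom ∣ den F :=
  (Finset.dvd_prod_of_mem (fun k => (F i k).denom) (Finset.mem_univ k)).trans
    (Finset.dvd_prod_of_mem (fun i => ∏ k, (F i k).denom) (Finset.mem_univ i))

lemma den_ne_zero (F : RatMatrix m) : den F ≠ 0 :=
  Finset.prod_ne_zero_iff.2 fun _ _ => Finset.prod_ne_zero_iff.2 fun _ _ => RatFunc.denom_ne_zero _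

lemma num_mul_denom (F : RatMatrix m) (i k : Fin m) :
    num F i k * (F i k).denom = (F i k).num * den F := by
  have := EuclideanDomain.mul_div_cancel' (RatFunc.denom_ne_zero (F i k)) (denom_dvd_den F i k)
  rw [num, Matrix.of_apply, mul_assoc, mul_comm (den F / _), this]

lemma isPole_iff (F : RatMatrix m) (t : ℂ) : IsPole F t ↔ (den F).eval t = 0 := by
  simp [IsPole, den, eval_prod, Finset.prod_eq_zero_iff]

lemma evalMat_num (F : RatMatrix m) {t : ℂ} (ht : (den F).eval t ≠ 0) :
    evalMat t (num F) = (den F).eval t • value F t := by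
  ext i k
  have hd : (F i k).denom.eval t ≠ 0 := fun h => ht ((isPole_iff F t).1 ⟨i, k, h⟩)
  have := congrArg (eval t) (num_mul_denom F i k)
  simp only [eval_mul] at this
  rw [evalMat_apply, Matrix.smul_apply, value, Matrix.of_apply, RatFunc.eval, smul_eq_mul]
  change _ = _ * (eval t (F i k).num / eval t (F i k).denom)
  field_simp
  rw [this, mul_comm]

/-- On the circle, the bound `‖num‖ ≤ C ‖denom‖` for an entry holds along the radius and passes to
the limit. A pole there would be a common zero of the coprime numerator and denominator. -/
lemma IsAnalytic.den_eval_ne_zero {F : RatMatrix m} (hF : IsAnalytic F) {t : ℂ} (ht : ‖t‖ ≤ 1) :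
    (den F).eval t ≠ 0 := by
  obtain ⟨h1, C, hC⟩ := hF
  rcases ht.lt_or_eq with ht | ht
  · exact fun h => h1 t ht ((isPole_iff F t).2 h)
  intro h
  obtain ⟨i, k, hik⟩ := (isPole_iff F t).2 h
  have hval : ∀ s : ℝ, s ∈ Set.Ico (0:ℝ) 1 →
      ‖(F i k).num.eval (s * t)‖ ≤ C * ‖(F i k).denom.eval (s * t)‖ := by
    intro s hs
    have hst : ‖(s : ℂ) * t‖ < 1 := by
      rw [norm_mul, ht, mul_one, Complex.norm_real, Real.norm_of_nonneg hs.1]; exact hs.2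
    have hd : (F i k).denom.eval (s * t) ≠ 0 := fun h => h1 _ hst ⟨i, k, h⟩
    have h2 := hC _ hst i k
    rw [value, Matrix.of_apply, RatFunc.eval] at h2
    change ‖eval _ (F i k).num / eval _ (F i k).denom‖ ≤ C at h2
    rwa [norm_div, div_le_iff₀ (norm_pos_iff.2 hd)] at h2
  have hcont : ∀ p : ℂ[X], Continuous fun s : ℝ => ‖p.eval ((s : ℂ) * t)‖ := fun p =>
    (p.continuous.comp (by fun_prop)).norm
  have hlim : ‖(F i k).num.eval (((1 : ℝ) : ℂ) * t)‖
      ≤ C * ‖(F i k).denom.eval (((1 : ℝ) : ℂ) * t)‖ := by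
    have hcl : IsClosed {s : ℝ | ‖(F i k).num.eval (s * t)‖
      ≤ C * ‖(F i k).denom.eval (s * t)‖} :=
      isClosed_le (hcont _) ((hcont _).const_mul _)
    have hsub : closure (Set.Ico (0:ℝ) 1) ⊆ _ := hcl.closure_subset_iff.2 hval
    rw [closure_Ico (by norm_num)] at hsub
    exact hsub ⟨zero_le_one, le_rfl⟩
  rw [Complex.ofReal_one, one_mul, hik.eq_zero, norm_zero, mul_zero] at hlim
  have hn : (F i k).num.eval t = 0 := norm_le_zero_iff.1 hlim
  obtain ⟨a, b, hab⟩ := RatFunc.isCoprime_num_denom (F i k)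
  have := congrArg (eval t) hab
  simp [hn, hik.eq_zero] at this

/-! ### Reflection in the unit circle -/

/-- A bound for the degrees of `den F` and of the entries of `num F`. -/
def degBound (F : RatMatrix m) : ℕ :=
  (den F).natDegree + ∑ i, ∑ k, (num F i k).natDegree

/-- The polynomial `t ^ D * conj (p (1 / conj t))`. -/
def refl (D : ℕ) (p : ℂ[X]) : ℂ[X] := (p.map (starRingEnd ℂ)).reflect D

lemma eval_refl {D : ℕ} {p : ℂ[X]} (hp : p.natDegree ≤ D) {t : ℂ} (ht : t ≠ 0) :
    (refl D p).eval t = t ^ D * star (p.eval (star t)⁻¹) := by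
  have hp' : (p.map (starRingEnd ℂ)).natDegree ≤ D := (natDegree_map_le).trans hp
  let _ := invertibleOfNonzero (inv_ne_zero ht)
  have h := eval₂_reflect_mul_pow (RingHom.id ℂ) t⁻¹ D (p.map (starRingEnd ℂ)) hp'
  rw [invOf_eq_inv, inv_inv] at h
  have h2 : eval₂ (RingHom.id ℂ) t (reflect D (p.map (starRingEnd ℂ))) = (refl D p).eval t := rfl
  rw [h2] at h
  have h3 : star (p.eval (star t)⁻¹) = eval₂ (RingHom.id ℂ) t⁻¹ (p.map (starRingEnd ℂ)) := by
    have h4 := hom_eval₂ p (RingHom.id ℂ) (starRingEnd ℂ) (star t)⁻¹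
    rw [RingHom.comp_id, map_inv₀] at h4
    rw [eval₂_map, RingHom.id_comp]
    simpa using h4
  rw [h3, ← h, mul_comm, mul_assoc, ← mul_pow, inv_mul_cancel₀ ht, one_pow, mul_one]

/-- The reflected denominator. -/
def den' (F : RatMatrix m) : ℂ[X] := refl (degBound F) (den F)

/-- The reflected numerator. -/
def num' (F : RatMatrix m) : Matrix (Fin m) (Fin m) ℂ[X] :=
  Matrix.of fun i k => refl (degBound F) (num F k i)

lemma eval_den' (F : RatMatrix m) {t : ℂ} (ht : t ≠ 0) :
    (den' F).eval t = t ^ degBound F * star ((den F).eval (star t)⁻¹) :=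
  eval_refl (Nat.le_add_right _ _) ht

lemma evalMat_num' (F : RatMatrix m) {t : ℂ} (ht : t ≠ 0) :
    evalMat t (num' F) = t ^ degBound F • (evalMat (star t)⁻¹ (num F)).conjTranspose := by
  ext i k
  refine eval_refl ?_ ht
  refine le_trans ?_ (Nat.le_add_left _ _)
  exact (Finset.single_le_sum (f := fun i => (num F k i).natDegree) (fun _ _ => Nat.zero_le _)
    (Finset.mem_univ i)).trans (Finset.single_le_sum
      (f := fun k => ∑ i, (num F k i).natDegree) (fun _ _ => Nat.zero_le _) (Finset.mem_univ k))

lemma den'_eval_eq_zero_iff (F : RatMatrix m) {t : ℂ} (ht : t ≠ 0) :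
    (den' F).eval t = 0 ↔ IsPole F (star t)⁻¹ := by
  rw [eval_den' F ht, isPole_iff, mul_eq_zero, star_eq_zero]
  simp [ht]

/-- The same power `t ^ degBound F` enters `den'` and `num'`, so their quotient is exactly the
reflected adjoint. -/
lemma evalMat_num'_of_ne (F : RatMatrix m) {t : ℂ} (ht : t ≠ 0) (h : (den' F).eval t ≠ 0) :
    evalMat t (num' F) = (den' F).eval t • (value F (star t)⁻¹).conjTranspose := by
  have h1 : (den F).eval (star t)⁻¹ ≠ 0 := by
    rwa [Ne, ← isPole_iff, ← den'_eval_eq_zero_iff F ht]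
  rw [evalMat_num' F ht, evalMat_num F h1, Matrix.conjTranspose_smul, smul_smul, ← eval_den' F ht]

lemma mem_curve0_iff (F : RatMatrix m) (x : Fin 3 → ℂ) :
    x ∈ curve0 F ↔ x 2 ≠ 0 ∧ (den F).eval (x 2) ≠ 0 ∧ (den' F).eval (x 2) ≠ 0 ∧
      ∃ φ : Fin m → ℂ, φ ≠ 0 ∧
        (evalMat (x 2) (num F)).mulVec φ = ((den F).eval (x 2) * x 0) • φ ∧
        (evalMat (x 2) (num' F)).mulVec φ = ((den' F).eval (x 2) * x 1) • φ := by
  rw [curve0, Set.mem_ofPred_eq]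
  refine and_congr_right fun h0 => ?_
  rw [isPole_iff, ← den'_eval_eq_zero_iff F h0]
  refine and_congr_right fun h1 => and_congr_right fun h2 => exists_congr fun φ =>
    and_congr_right fun _ => ?_
  rw [evalMat_num F h1, evalMat_num'_of_ne F h0 h2, Matrix.smul_mulVec, Matrix.smul_mulVec,
    mul_smul, mul_smul, smul_right_inj h1, smul_right_inj h2]

/-! ### Points of the circle -/

lemma norm_circlePt (θ : ℝ) : ‖circlePt θ‖ = 1 := Complex.norm_exp_ofReal_mul_I θ

/-- The points of the unit circle at which `F` is normal. -/
def normalSet (F : RatMatrix m) : Set ℂ := {t | ‖t‖ = 1 ∧ IsStarNormal (value F t)}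

/-- Infinitely many normal points are enough later, since polynomial identities extend from an
infinite set. A finite `normalSet` would pull back to a finite subset of `[0, 1]` under `circlePt`,
which is injective there because `1 < 2π`, and `[0, 1]` would be a null set. -/
lemma normalSet_infinite {F : RatMatrix m} (hF : IsNormal F) : (normalSet F).Infinite := by
  intro hfin
  have hinj : Set.InjOn circlePt (Set.Icc 0 1) := by
    intro a ha b hb hab
    obtain ⟨n, hn⟩ := Complex.exp_eq_exp_iff_exists_int.1 hab
    have h2 : a = b + n * (2 * Real.pi) := by
      have h3 : ((a : ℂ) - (b + n * (2 * Real.pi))) * Complex.I = 0 := by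
        linear_combination hn
      rw [mul_eq_zero, or_iff_left Complex.I_ne_zero, sub_eq_zero] at h3
      exact_mod_cast h3
    have hn0 : n = 0 := by
      have hpi := Real.pi_gt_three
      by_contra hne
      rcases lt_or_gt_of_ne hne with h | h
      · have : (n : ℝ) ≤ -1 := by exact_mod_cast Int.le_sub_one_of_lt h
        nlinarith [ha.1, ha.2, hb.1, hb.2]
      · have : (1 : ℝ) ≤ n := by exact_mod_cast h
        nlinarith [ha.1, ha.2, hb.1, hb.2]
    simpa [hn0] using h2
  have hset : (Set.Icc (0:ℝ) 1 ∩ {θ | IsStarNormal (value F (circlePt θ))}).Finite := by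
    refine Set.Finite.of_finite_image (f := circlePt) (hfin.subset ?_)
      (hinj.mono Set.inter_subset_left)
    rintro _ ⟨θ, hθ, rfl⟩
    exact ⟨norm_circlePt θ, hθ.2⟩
  have h0 : MeasureTheory.volume {θ : ℝ | ¬ IsStarNormal (value F (circlePt θ))} = 0 := by
    have := hF.mono fun θ h => h.2
    exact this
  have h1 : MeasureTheory.volume (Set.Icc (0:ℝ) 1) ≤ 0 := by
    calc MeasureTheory.volume (Set.Icc (0:ℝ) 1)
        ≤ MeasureTheory.volume ((Set.Icc (0:ℝ) 1 ∩ {θ | IsStarNormal (value F (circlePt θ))}) ∪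
          {θ : ℝ | ¬ IsStarNormal (value F (circlePt θ))}) := by
            refine MeasureTheory.measure_mono fun θ hθ => ?_
            by_cases h : IsStarNormal (value F (circlePt θ))
            · exact Or.inl ⟨hθ, h⟩
            · exact Or.inr h
      _ ≤ _ := (MeasureTheory.measure_union_le _ _).trans (by
            rw [h0, hset.measure_zero, add_zero])
  simp at h1

lemma IsAnalytic.den'_eval_ne_zero {F : RatMatrix m} (hF : IsAnalytic F) {t : ℂ}
    (ht : ‖t‖ = 1) : (den' F).eval t ≠ 0 := by
  have h0 : t ≠ 0 := by rintro rfl; simp at ht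
  rw [Ne, den'_eval_eq_zero_iff F h0, isPole_iff]
  exact hF.den_eval_ne_zero (by simp [ht])

lemma star_inv_of_norm_eq_one {t : ℂ} (ht : ‖t‖ = 1) : (star t)⁻¹ = t := by
  have h0 : t ≠ 0 := by rintro rfl; simp at ht
  have : t * star t = 1 := by
    have := Complex.mul_conj' t
    rw [ht] at this
    simpa using this
  exact inv_eq_of_mul_eq_one_left this

/-- The polynomial matrix `den F • (F - lam)`. -/
def shiftNum (F : RatMatrix m) (lam : ℂ) : Matrix (Fin m) (Fin m) ℂ[X] :=
  num F - (C lam * den F) • (1 : Matrix (Fin m) (Fin m) ℂ[X])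

lemma evalMat_shiftNum (F : RatMatrix m) (lam t : ℂ) :
    evalMat t (shiftNum F lam) =
      evalMat t (num F) - (lam * (den F).eval t) • (1 : Matrix (Fin m) (Fin m) ℂ) := by
  ext i k
  simp [shiftNum, Matrix.one_apply, apply_ite (eval t)]

lemma evalMat_shiftNum_of_ne (F : RatMatrix m) (lam : ℂ) {t : ℂ} (ht : (den F).eval t ≠ 0) :
    evalMat t (shiftNum F lam) =
      (den F).eval t • (value F t - lam • (1 : Matrix (Fin m) (Fin m) ℂ)) := by
  rw [evalMat_shiftNum, evalMat_num F ht, smul_sub, smul_smul, mul_comm lam]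

lemma eval_det (P : Matrix (Fin m) (Fin m) ℂ[X]) (t : ℂ) : P.det.eval t = (evalMat t P).det :=
  RingHom.map_det (evalRingHom t) P

lemma exists_circlePt {t : ℂ} (ht : ‖t‖ = 1) :
    ∃ θ ∈ Set.Icc (0 : ℝ) (2 * Real.pi), circlePt θ = t := by
  have h := Complex.norm_mul_exp_arg_mul_I t
  rw [ht, Complex.ofReal_one, one_mul] at h
  have hp := Real.pi_pos
  by_cases h0 : 0 ≤ t.arg
  · exact ⟨t.arg, ⟨h0, by linarith [Complex.arg_le_pi t]⟩, h⟩
  · refine ⟨t.arg + 2 * Real.pi, ⟨by linarith [Complex.neg_pi_lt_arg t], by linarith⟩, ?_⟩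
    rw [circlePt]
    push_cast
    rw [add_mul]
    exact (Complex.exp_periodic _).trans h

lemma det_shiftNum_eval_ne_zero {F : RatMatrix m} (hF : IsAnalytic F) {lam : ℂ}
    (hlam : lam ∉ gammaSet F) {t : ℂ} (ht : ‖t‖ = 1) : (shiftNum F lam).det.eval t ≠ 0 := by
  have hd := hF.den_eval_ne_zero ht.le
  rw [eval_det, evalMat_shiftNum_of_ne F lam hd, Matrix.det_smul]
  refine mul_ne_zero (pow_ne_zero _ hd) fun h => hlam ?_
  obtain ⟨θ, hθ, rfl⟩ := exists_circlePt ht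
  refine Set.mem_iUnion₂.2 ⟨θ, hθ, ?_⟩
  rw [spectrum.mem_iff, Matrix.isUnit_iff_isUnit_det, Algebra.algebraMap_eq_smul_one,
    ← neg_sub, Matrix.det_neg, h]
  simp

end NormalSymbol
end

noncomputable section

namespace NormalSymbol

open Polynomial

variable {m : ℕ}

/-! ### The shift on the vector Hardy space -/

namespace Hardy

/-- The forward shift of a sequence. -/
def shiftSeq (f : ℕ → EuclideanSpace ℂ (Fin m)) : ℕ → EuclideanSpace ℂ (Fin m)
  | 0 => 0
  | n + 1 => f n

lemma memℓp_shift (f : Hardy m) : Memℓp (shiftSeq f) 2 := by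
  refine memℓp_gen ((summable_nat_add_iff 1).1 ?_)
  exact (memℓp_gen_iff (by norm_num)).1 (lp.memℓp f)

lemma memℓp_back (f : Hardy m) : Memℓp (fun n : ℕ => f (n + 1)) 2 := by
  refine memℓp_gen ?_
  exact (summable_nat_add_iff 1).2 ((memℓp_gen_iff (by norm_num)).1 (lp.memℓp f))

/-- The forward shift, as a linear map. -/
def shiftLin : Hardy m →ₗ[ℂ] Hardy m where
  toFun f := ⟨shiftSeq f, memℓp_shift f⟩
  map_add' f g := by
    refine lp.ext (funext fun n => ?_)
    cases n with
    | zero => exact (add_zero 0).symm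
    | succ n => rfl
  map_smul' c f := by
    refine lp.ext (funext fun n => ?_)
    cases n with
    | zero => exact (smul_zero c).symm
    | succ n => rfl

lemma norm_shiftLin_le (f : Hardy m) : ‖shiftLin f‖ ≤ 1 * ‖f‖ := by
  rw [one_mul]
  refine lp.norm_le_of_tsum_le (by norm_num) (norm_nonneg _) ?_
  rw [lp.norm_rpow_eq_tsum (by norm_num),
    ((memℓp_gen_iff (by norm_num)).1 (lp.memℓp (shiftLin f))).tsum_eq_zero_add]
  have h0 : shiftLin f 0 = 0 := rfl
  rw [h0, norm_zero, Real.zero_rpow (by norm_num), zero_add]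
  rfl

/-- The forward shift, that is, multiplication by the variable. -/
def shift : Hardy m →L[ℂ] Hardy m :=
  LinearMap.mkContinuous shiftLin 1 norm_shiftLin_le

/-- The backward shift. -/
def back : Hardy m →L[ℂ] Hardy m :=
  LinearMap.mkContinuous
    { toFun := fun f => ⟨_, memℓp_back f⟩
      map_add' := fun f g => rfl
      map_smul' := fun c f => rfl } 1 fun f => by
    rw [one_mul]
    refine lp.norm_le_of_tsum_le (by norm_num) (norm_nonneg _) ?_
    rw [lp.norm_rpow_eq_tsum (by norm_num),
      ((memℓp_gen_iff (p := 2) (by norm_num)).1 (lp.memℓp f)).tsum_eq_zero_add]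
    exact le_add_of_nonneg_left (by positivity)

@[simp] lemma shift_zero (f : Hardy m) : shift f 0 = 0 := rfl
@[simp] lemma shift_succ (f : Hardy m) (n : ℕ) : shift f (n + 1) = f n := rfl
@[simp] lemma back_apply (f : Hardy m) (n : ℕ) : back f n = f (n + 1) := rfl

lemma norm_shift_le : ‖(shift : Hardy m →L[ℂ] Hardy m)‖ ≤ 1 :=
  LinearMap.mkContinuous_norm_le _ zero_le_one _

lemma norm_back_le : ‖(back : Hardy m →L[ℂ] Hardy m)‖ ≤ 1 :=
  LinearMap.mkContinuous_norm_le _ zero_le_one _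

lemma back_mul_shift : (back * shift : Hardy m →L[ℂ] Hardy m) = 1 := by
  ext f n : 3
  rfl

/-- The action of constant matrices. -/
def const : Matrix (Fin m) (Fin m) ℂ →+* (Hardy m →L[ℂ] Hardy m) where
  toFun A := lp.mapCLM 2 (fun _ : ℕ => Matrix.toEuclideanCLM (n := Fin m) (𝕜 := ℂ) A)
    (norm_nonneg _) (fun _ => le_rfl)
  map_one' := by
    ext f n : 3
    simp [lp.mapCLM_apply_coe]
  map_mul' A B := by
    ext f n : 3
    simp [lp.mapCLM_apply_coe]
  map_zero' := by
    ext f n : 3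
    simp [lp.mapCLM_apply_coe]
  map_add' A B := by
    ext f n : 3
    simp [lp.mapCLM_apply_coe]

lemma const_apply (A : Matrix (Fin m) (Fin m) ℂ) (f : Hardy m) (n : ℕ) :
    const A f n = Matrix.toEuclideanLin A (f n) := by
  rfl

lemma const_mul_shift (A : Matrix (Fin m) (Fin m) ℂ) :
    Commute (const A) (shift : Hardy m →L[ℂ] Hardy m) := by
  ext f n : 3
  cases n with
  | zero => exact map_zero (Matrix.toEuclideanLin A)
  | succ n => rfl

lemma const_mul_back (A : Matrix (Fin m) (Fin m) ℂ) :
    Commute (const A) (back : Hardy m →L[ℂ] Hardy m) := by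
  ext f n : 3
  rfl

/-- The operator of multiplication by a polynomial matrix. -/
def mul : Matrix (Fin m) (Fin m) ℂ[X] →+* (Hardy m →L[ℂ] Hardy m) :=
  -- `matPolyEquiv` turns a matrix of polynomials into a polynomial with matrix coefficients, which
  -- can be evaluated at the shift because constants commute with it.
  (eval₂RingHom' const shift const_mul_shift).comp
    (matPolyEquiv : Matrix (Fin m) (Fin m) ℂ[X] ≃ₐ[ℂ] _).toRingEquiv.toRingHom

lemma mul_map_C (A : Matrix (Fin m) (Fin m) ℂ) : mul (A.map C) = const A := by
  change eval₂ const shift (matPolyEquiv (A.map C)) = _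
  rw [matPolyEquiv_map_C, eval₂_C]

lemma const_smul_one (c : ℂ) :
    const (c • (1 : Matrix (Fin m) (Fin m) ℂ)) = c • (1 : Hardy m →L[ℂ] Hardy m) := by
  ext f n : 3
  rw [const_apply]
  simp

lemma mul_smul_one (p : ℂ[X]) :
    mul (p • (1 : Matrix (Fin m) (Fin m) ℂ[X])) = aeval (shift : Hardy m →L[ℂ] Hardy m) p := by
  change eval₂ const shift (matPolyEquiv (p • (1 : Matrix (Fin m) (Fin m) ℂ[X]))) = _
  rw [matPolyEquiv_smul_one, eval₂_map]
  have : const.comp (algebraMap ℂ (Matrix (Fin m) (Fin m) ℂ)) =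
      algebraMap ℂ (Hardy m →L[ℂ] Hardy m) := by
    ext c : 1
    rw [RingHom.comp_apply, Algebra.algebraMap_eq_smul_one, const_smul_one,
      Algebra.algebraMap_eq_smul_one]
  rw [this]
  rfl

/-! ### Values -/

lemma at_add (f g : Hardy m) {t : ℂ} (ht : ‖t‖ < 1) : (f + g).at t = f.at t + g.at t := by
  simp only [Hardy.at, lp.coeFn_add, Pi.add_apply, smul_add]
  exact (f.summable ht).tsum_add (g.summable ht)

lemma at_const (A : Matrix (Fin m) (Fin m) ℂ) (f : Hardy m) {t : ℂ} (ht : ‖t‖ < 1) :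
    (const A f).at t = Matrix.toEuclideanLin A (f.at t) := by
  have h := ContinuousLinearMap.map_tsum (Matrix.toEuclideanCLM (n := Fin m) (𝕜 := ℂ) A)
    (f.summable ht)
  rw [Hardy.at, Hardy.at]
  refine Eq.trans (tsum_congr fun n => ?_) h.symm
  rw [map_smul]
  rfl

lemma at_shift (f : Hardy m) {t : ℂ} (ht : ‖t‖ < 1) : (shift f).at t = t • f.at t := by
  rw [Hardy.at, ((shift f).summable ht).tsum_eq_zero_add, Hardy.at, ← tsum_const_smul'']
  rw [shift_zero, smul_zero, zero_add]
  refine tsum_congr fun n => ?_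
  rw [shift_succ, smul_smul, pow_succ']

/-- Both sides are additive and multiplicative in `P`, so constants and the variable suffice. -/
lemma at_mul (P : Matrix (Fin m) (Fin m) ℂ[X]) (f : Hardy m) {t : ℂ} (ht : ‖t‖ < 1) :
    (mul P f).at t = Matrix.toEuclideanLin (evalMat t P) (f.at t) := by
  obtain ⟨Q, rfl⟩ := (matPolyEquiv (R := ℂ) (n := Fin m)).symm.surjective P
  have hC : ∀ (A : Matrix (Fin m) (Fin m) ℂ) (f : Hardy m), (mul (matPolyEquiv.symm (C A)) f).at t
      = Matrix.toEuclideanLin (evalMat t (matPolyEquiv.symm (C A))) (f.at t) := by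
    intro A f
    have : evalMat t (A.map C) = A := by
      ext i k
      simp
    rw [matPolyEquiv_symm_C, mul_map_C, at_const A f ht, this]
  have hX : ∀ f : Hardy m, (mul (matPolyEquiv.symm X) f).at t
      = Matrix.toEuclideanLin (evalMat t (matPolyEquiv.symm X)) (f.at t) := by
    intro f
    have h1 : mul (matPolyEquiv.symm X) = (shift : Hardy m →L[ℂ] Hardy m) := by
      change eval₂ const shift (matPolyEquiv (matPolyEquiv.symm X)) = _
      rw [AlgEquiv.apply_symm_apply, eval₂_X]
    have h2 : evalMat t (matPolyEquiv.symm X) = t • (1 : Matrix (Fin m) (Fin m) ℂ) := by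
      ext i k
      simp [Matrix.diagonal_apply, Matrix.one_apply, apply_ite (eval t)]
    rw [h1, at_shift f ht, h2, map_smul, Matrix.toLpLin_one]
    rfl
  have hmul : ∀ Q₁ Q₂ : (Matrix (Fin m) (Fin m) ℂ)[X],
      (∀ f : Hardy m, (mul (matPolyEquiv.symm Q₁) f).at t
        = Matrix.toEuclideanLin (evalMat t (matPolyEquiv.symm Q₁)) (f.at t)) →
      (∀ f : Hardy m, (mul (matPolyEquiv.symm Q₂) f).at t
        = Matrix.toEuclideanLin (evalMat t (matPolyEquiv.symm Q₂)) (f.at t)) →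
      ∀ f : Hardy m, (mul (matPolyEquiv.symm (Q₁ * Q₂)) f).at t
        = Matrix.toEuclideanLin (evalMat t (matPolyEquiv.symm (Q₁ * Q₂))) (f.at t) := by
    intro Q₁ Q₂ h₁ h₂ f
    rw [map_mul, map_mul, show ∀ A B : Hardy m →L[ℂ] Hardy m, (A * B) f = A (B f) from fun _ _ => rfl, h₁, h₂, map_mul, Matrix.toLpLin_mul_same]
    rfl
  revert f
  induction Q using Polynomial.induction_on with
  | C A => exact hC A
  | add Q₁ Q₂ h₁ h₂ =>
    intro f
    rw [map_add, map_add, add_apply, at_add _ _ ht, h₁, h₂, map_add, map_add]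
    rfl
  | monomial n A h =>
    rw [pow_succ, ← mul_assoc]
    exact hmul _ _ h hX

lemma continuousOn_at (f : Hardy m) : ContinuousOn f.at (Metric.closedBall 0 (1 / 2)) := by
  refine continuousOn_tsum (u := fun n => (1 / 2 : ℝ) ^ n * ‖f‖) (fun n => by fun_prop)
    ((summable_geometric_of_lt_one (by norm_num) (by norm_num)).mul_right _) fun n t ht => ?_
  rw [norm_smul, norm_pow]
  rw [mem_closedBall_zero_iff] at ht
  exact mul_le_mul (pow_le_pow_left₀ (norm_nonneg _) ht _)
    (lp.norm_apply_le_norm (by norm_num) f n) (norm_nonneg _) (by positivity)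

lemma at_zero (f : Hardy m) : f.at 0 = f 0 := by
  rw [Hardy.at, tsum_eq_single 0]
  · simp
  · intro n hn
    simp [hn]

/-- The coefficient of index `0` is the value at `0`. If a function vanishes on the disc, so does
its backward shift: away from `0` by division by `t`, at `0` by continuity. Iteration kills every
coefficient. -/
lemma eq_zero_of_at {f : Hardy m} (hf : ∀ t : ℂ, ‖t‖ < 1 → f.at t = 0) : f = 0 := by
  have h0 : ∀ g : Hardy m, (∀ t : ℂ, ‖t‖ < 1 → g.at t = 0) → g 0 = 0 := fun g hg => by
    rw [← at_zero]; exact hg 0 (by simp)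
  have key : ∀ g : Hardy m, (∀ t : ℂ, ‖t‖ < 1 → g.at t = 0) →
      ∀ t : ℂ, ‖t‖ < 1 → (back g).at t = 0 := by
    intro g hg
    have hgs : shift (back g) = g := by
      ext n : 2
      cases n with
      | zero => rw [shift_zero, h0 g hg]
      | succ n => rfl
    have h1 : ∀ t : ℂ, t ≠ 0 → ‖t‖ < 1 → (back g).at t = 0 := fun t ht0 ht => by
      have := hg t ht
      rw [← hgs, at_shift _ ht, smul_eq_zero] at this
      exact this.resolve_left ht0
    intro t ht
    rcases eq_or_ne t 0 with rfl | ht0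
    · have hc : ContinuousAt (back g).at 0 :=
        (continuousOn_at (back g)).continuousAt (Metric.closedBall_mem_nhds 0 (by norm_num))
      have hl : Filter.Tendsto (back g).at (nhdsWithin 0 {0}ᶜ) (nhds 0) := by
        refine tendsto_const_nhds.congr' ?_
        filter_upwards [self_mem_nhdsWithin,
          nhdsWithin_le_nhds (Metric.ball_mem_nhds (0 : ℂ) zero_lt_one)] with t ht0 ht
        exact (h1 t ht0 (by simpa using ht)).symm
      exact tendsto_nhds_unique (hc.tendsto.mono_left nhdsWithin_le_nhds) hl
    · exact h1 t ht0 ht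
  have hall : ∀ n : ℕ, ∀ g : Hardy m, (∀ t : ℂ, ‖t‖ < 1 → g.at t = 0) → g n = 0 := by
    intro n
    induction n with
    | zero => exact h0
    | succ n ih => exact fun g hg => ih (back g) (key g hg)
  ext n : 2
  exact hall n f hf

end Hardy

end NormalSymbol
end

noncomputable section

namespace NormalSymbol

open Polynomial

variable {m : ℕ}

namespace Hardy

/-! ### The index of a multiplication operator -/

lemma rank_ker_comp_of_surjective {V₁ V₂ V₃ : Type} [AddCommGroup V₁] [Module ℂ V₁]
    [AddCommGroup V₂] [Module ℂ V₂] [AddCommGroup V₃] [Module ℂ V₃] (f : V₁ →ₗ[ℂ] V₂)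
    (g : V₂ →ₗ[ℂ] V₃) (hf : Function.Surjective f) :
    Module.rank ℂ (LinearMap.ker (g ∘ₗ f)) =
      Module.rank ℂ (LinearMap.ker g) + Module.rank ℂ (LinearMap.ker f) := by
  have hmap : ∀ x ∈ LinearMap.ker (g ∘ₗ f), f x ∈ LinearMap.ker g := fun x hx => hx
  have hsurj : LinearMap.range (f.restrict hmap) = ⊤ := by
    rw [LinearMap.range_eq_top]
    rintro ⟨y, hy⟩
    obtain ⟨x, rfl⟩ := hf y
    exact ⟨⟨x, hy⟩, rfl⟩
  have hle : LinearMap.ker f ≤ LinearMap.ker (g ∘ₗ f) := LinearMap.ker_le_ker_comp f g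
  have hker : LinearMap.ker (f.restrict hmap) =
      (LinearMap.ker f).comap (LinearMap.ker (g ∘ₗ f)).subtype := by
    ext x
    rw [LinearMap.mem_ker, Submodule.mem_comap, LinearMap.mem_ker, ← Subtype.coe_inj]
    rfl
  have h1 := LinearMap.rank_range_add_rank_ker (f.restrict hmap)
  rw [hsurj, rank_top, hker, (Submodule.comapSubtypeEquivOfLe hle).rank_eq] at h1
  exact h1.symm

/-- The dimension of the orthogonal complement of the range of an operator. -/
def corank (A : Hardy m →L[ℂ] Hardy m) : Cardinal := Module.rank ℂ A.rangeᗮ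

lemma corank_eq (A : Hardy m →L[ℂ] Hardy m) :
    corank A = Module.rank ℂ (LinearMap.ker (ContinuousLinearMap.adjoint A).toLinearMap) := by
  rw [corank, ContinuousLinearMap.orthogonal_range]

/-- The corank is the dimension of the kernel of the adjoint, and `(AB)* = B* A*`. A left inverse of
`A` makes `A*` surjective, so the kernel dimensions add, as cardinals. -/
lemma corank_mul {A B L : Hardy m →L[ℂ] Hardy m} (hL : L * A = 1) :
    corank (A * B) = corank B + corank A := by
  rw [corank_eq, corank_eq, corank_eq]
  have h : Function.Surjective (ContinuousLinearMap.adjoint A) := by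
    intro x
    refine ⟨ContinuousLinearMap.adjoint L x, ?_⟩
    have h1 := ContinuousLinearMap.adjoint_comp L A
    have h2 : L.comp A = 1 := hL
    rw [h2, ← ContinuousLinearMap.star_eq_adjoint, star_one] at h1
    exact (congrArg (fun T : Hardy m →L[ℂ] Hardy m => T x) h1).symm
  rw [← rank_ker_comp_of_surjective _ _ h]
  have h3 : ContinuousLinearMap.adjoint (A * B) =
    (ContinuousLinearMap.adjoint B).comp (ContinuousLinearMap.adjoint A) :=
      ContinuousLinearMap.adjoint_comp A B
  rw [h3]
  rfl

lemma corank_of_surjective {A : Hardy m →L[ℂ] Hardy m} (hA : Function.Surjective A) :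
    corank A = 0 := by
  have : A.range = ⊤ := LinearMap.range_eq_top.2 hA
  rw [corank, this, Submodule.top_orthogonal_eq_bot, rank_bot]

lemma corank_of_isUnit {A : Hardy m →L[ℂ] Hardy m} (hA : IsUnit A) : corank A = 0 := by
  obtain ⟨u, rfl⟩ := hA
  refine corank_of_surjective fun x => ⟨(u⁻¹ : (Hardy m →L[ℂ] Hardy m)ˣ).1 x, ?_⟩
  exact congrArg (fun T : Hardy m →L[ℂ] Hardy m => T x) u.mul_inv

/-- The projection to a coordinate. -/
def proj (i : Fin m) : Hardy m →L[ℂ] Hardy m := const (Matrix.single i i 1)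

lemma proj_apply (i : Fin m) (f : Hardy m) (n : ℕ) :
    proj i f n = EuclideanSpace.single i (f n i) := by
  rw [proj, const_apply]
  ext k
  simp [Matrix.single_mulVec, Matrix.toLpLin_apply, Function.update_apply]

lemma norm_proj_le (i : Fin m) : ‖(proj i : Hardy m →L[ℂ] Hardy m)‖ ≤ 1 := by
  refine ContinuousLinearMap.opNorm_le_bound _ zero_le_one fun f => ?_
  rw [one_mul]
  refine lp.norm_mono (by norm_num) fun n => ?_
  rw [proj_apply, PiLp.norm_single]
  exact PiLp.norm_apply_le _ _

lemma proj_mul_proj (i : Fin m) : (proj i * proj i : Hardy m →L[ℂ] Hardy m) = proj i := by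
  rw [proj, ← map_mul, Matrix.single_mul_single_same, one_mul]

/-- The isometry that shifts one coordinate. -/
def coordShift (i : Fin m) : Hardy m →L[ℂ] Hardy m := 1 - proj i + shift * proj i

/-- A left inverse of `coordShift`. -/
def coordBack (i : Fin m) : Hardy m →L[ℂ] Hardy m := 1 - proj i + back * proj i

lemma coordShift_left_inv (i : Fin m) : coordBack i * coordShift i = 1 := by
  have h1 : proj i * shift = shift * proj i := const_mul_shift _
  have h2 := proj_mul_proj i
  have h3 : proj i * (shift * proj i) = shift * proj i := by rw [← mul_assoc, h1, mul_assoc, h2]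
  have h4 : back * (shift * proj i) = proj i := by rw [← mul_assoc, back_mul_shift, one_mul]
  rw [coordShift, coordBack]
  simp only [mul_add, add_mul, mul_sub, sub_mul, one_mul, mul_one, mul_assoc, h2, h3, h4]
  abel

lemma coordShift_apply_zero (i : Fin m) (f : Hardy m) : (coordShift i f) 0 i = 0 := by
  change (f 0 - proj i f 0 + shift (proj i f) 0) i = 0
  rw [proj_apply, shift_zero]
  simp

/-- `coordShift i * coordBack i` deletes the coefficient of index `0` in the coordinate `i` and
nothing else. -/
lemma coordShift_right (i : Fin m) (f : Hardy m) :
    f = lp.single (E := fun _ : ℕ => EuclideanSpace ℂ (Fin m)) 2 0 (EuclideanSpace.single i (f 0 i)) +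
      coordShift i (coordBack i f) := by
  have h1 : proj i * shift = shift * proj i := const_mul_shift _
  have h1' : proj i * back = back * proj i := const_mul_back _
  have h2 := proj_mul_proj i
  have h3 : proj i * (back * proj i) = back * proj i := by rw [← mul_assoc, h1', mul_assoc, h2]
  have h4 : coordShift i * coordBack i = 1 - proj i + shift * back * proj i := by
    rw [coordShift, coordBack]
    simp only [mul_add, add_mul, mul_sub, sub_mul, one_mul, mul_one, mul_assoc, h2, h3]
    abel
  have h5 : coordShift i (coordBack i f) = f - proj i f +
      shift (back (proj i f)) := congrArg (fun T : Hardy m →L[ℂ] Hardy m => T f) h4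
  rw [h5]
  refine lp.ext (funext fun n => ?_)
  change f n = lp.single (E := fun _ : ℕ => EuclideanSpace ℂ (Fin m)) 2 0 (EuclideanSpace.single i (f 0 i)) n +
    (f n - proj i f n + shift (back (proj i f)) n)
  cases n with
  | zero => rw [lp.single_apply_self, shift_zero, proj_apply]; abel
  | succ n =>
    rw [lp.single_apply_ne _ _ _ n.succ_ne_zero, shift_succ, back_apply]; abel

/-- The orthogonal complement is the line of the constant function with value the `i`-th basis
vector: the range is orthogonal to it, and with the range it spans everything by `coordShift_right`.
-/
lemma corank_coordShift (i : Fin m) : corank (coordShift i) = 1 := by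
  set e : Hardy m := lp.single 2 0 (EuclideanSpace.single i 1) with he
  have hinner : ∀ f : Hardy m, inner ℂ e f = f 0 i := by
    intro f
    rw [he, lp.inner_single_left, EuclideanSpace.inner_single_left]
    simp
  have hspan : (coordShift i).rangeᗮ = Submodule.span ℂ {e} := by
    apply le_antisymm
    · intro g hg
      rw [Submodule.mem_orthogonal] at hg
      have h1 := coordShift_right i g
      set h := coordBack i g
      have h2 : lp.single (E := fun _ : ℕ => EuclideanSpace ℂ (Fin m)) 2 0 (EuclideanSpace.single i (g 0 i)) = g 0 i • e := by
        rw [he, ← lp.single_smul]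
        congr 1
        ext k
        simp
      rw [h2] at h1
      have h3 : inner ℂ (coordShift i h) e = 0 := by
        rw [← inner_conj_symm, hinner, coordShift_apply_zero, map_zero]
      have h4 := hg (coordShift i h) ⟨h, rfl⟩
      have h5 : coordShift i h = 0 := by
        rw [h1, inner_add_right, inner_smul_right, h3, mul_zero, zero_add] at h4
        exact inner_self_eq_zero.1 h4
      rw [h1, h5, add_zero]
      exact Submodule.smul_mem _ _ (Submodule.mem_span_singleton_self _)
    · rw [Submodule.span_singleton_le_iff_mem, Submodule.mem_orthogonal]
      rintro _ ⟨f, rfl⟩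
      rw [← inner_conj_symm, hinner]
      have : (coordShift i) f 0 i = 0 := coordShift_apply_zero i f
      simpa using this
  have hne : e ≠ 0 := by
    intro h
    have := hinner e
    rw [h] at this
    have h2 : e 0 i = 1 := by rw [he, lp.single_apply_self]; simp
    rw [← h, h2] at this
    rw [h, inner_zero_left] at this
    exact zero_ne_one this
  rw [corank, hspan, rank_submodule_eq_one_iff]
  exact ⟨e, Submodule.mem_span_singleton_self _, hne, le_rfl⟩

/-- The diagonal polynomial matrix with a factor `X - a` at one place. -/
def linFactor (i : Fin m) (a : ℂ) : Matrix (Fin m) (Fin m) ℂ[X] :=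
  Matrix.diagonal (Function.update 1 i (X - C a))

lemma linFactor_eq (i : Fin m) (a : ℂ) : linFactor i a =
    1 - (Matrix.single i i 1 : Matrix (Fin m) (Fin m) ℂ).map C +
      ((X - C a) • (1 : Matrix (Fin m) (Fin m) ℂ[X])) *
        (Matrix.single i i 1 : Matrix (Fin m) (Fin m) ℂ).map C := by
  ext k l
  rw [smul_mul_assoc, one_mul]
  simp only [linFactor, Matrix.diagonal_apply, Matrix.add_apply, Matrix.sub_apply,
    Matrix.one_apply, Matrix.map_apply, Matrix.smul_apply, Matrix.single_apply,
    Function.update_apply, smul_eq_mul]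
  by_cases h : k = l
  · subst h
    by_cases h2 : k = i
    · subst h2; simp
    · have h3 : ¬ i = k := fun h => h2 h.symm
      simp [h2, h3]
  · have h3 : ¬ (i = k ∧ i = l) := fun h' => h (h'.1.symm.trans h'.2)
    simp [h, h3]

/-- With `S` the shift and `T` the backward shift, `T S = 1` gives `S - a = (1 - a T) S`. The factor
`1 - a T` is invertible because `‖a‖ < 1` and `‖T‖ ≤ 1`. -/
lemma exists_mul_linFactor (i : Fin m) {a : ℂ} (ha : ‖a‖ < 1) :
    ∃ W : Hardy m →L[ℂ] Hardy m, IsUnit W ∧ mul (linFactor i a) = W * coordShift i := by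
  refine ⟨1 - a • (back * proj i), isUnit_one_sub_of_norm_lt_one ?_, ?_⟩
  · rw [norm_smul]
    calc ‖a‖ * ‖(back * proj i : Hardy m →L[ℂ] Hardy m)‖ ≤ ‖a‖ * 1 := by
          gcongr
          exact (norm_mul_le _ _).trans (mul_le_one₀ norm_back_le (norm_nonneg _) (norm_proj_le i))
      _ < 1 := by rwa [mul_one]
  · rw [linFactor_eq, map_add, map_sub, map_one, map_mul, mul_map_C, mul_smul_one, map_sub, aeval_X,
      aeval_C, Algebra.algebraMap_eq_smul_one]
    change 1 - proj i + (shift - a • 1) * proj i = _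
    have h1 : proj i * shift = shift * proj i := const_mul_shift _
    have h2 := proj_mul_proj i
    have h3 : proj i * (shift * proj i) = shift * proj i := by rw [← mul_assoc, h1, mul_assoc, h2]
    have h4 : back * (shift * proj i) = proj i := by rw [← mul_assoc, back_mul_shift, one_mul]
    rw [coordShift]
    simp only [mul_add, mul_sub, sub_mul, one_mul, mul_one, smul_mul_assoc, mul_assoc, h2,
      h3, h4]
    abel_nf

/-- The spectrum of a contraction lies in the closed disc, and `p` of an operator can fail to be
invertible only if some root of `p` is in the spectrum. -/
lemma isUnit_aeval_shift {p : ℂ[X]} (hp : ∀ t : ℂ, ‖t‖ ≤ 1 → p.eval t ≠ 0) :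
    IsUnit (aeval (shift : Hardy m →L[ℂ] Hardy m) p) := by
  have hp0 : p ≠ 0 := by
    rintro rfl
    exact hp 0 (by simp) eval_zero
  have hs := IsAlgClosed.splits p
  by_contra hu
  have hu' : ¬ IsUnit (aeval (shift : Hardy m →L[ℂ] Hardy m)
      (Multiset.map (fun x => X - C x) p.roots).prod) := by
    intro h
    apply hu
    rw [hs.eq_prod_roots, map_mul, aeval_C]
    exact ((isUnit_iff_ne_zero.2 (leadingCoeff_ne_zero.2 hp0)).map _).mul h
  obtain ⟨k, hk, hk0⟩ := spectrum.exists_mem_of_not_isUnit_aeval_prod hu'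
  refine hp k ?_ hk0
  by_contra hlt
  rw [not_le] at hlt
  -- The bound carries a factor `‖1‖`, which is only known to be at most `1`: the space is zero when
  -- `m = 0`.
  refine hk (spectrum.mem_resolventSet_of_norm_lt_mul (lt_of_le_of_lt ?_ hlt))
  exact mul_le_one₀ norm_shift_le (norm_nonneg _) ContinuousLinearMap.norm_id_le

/-- The roots of a polynomial in the open unit disc. -/
def _root_.NormalSymbol.discRoots (p : ℂ[X]) : Multiset ℂ :=
  open Classical in p.roots.filter fun t => ‖t‖ < 1

/-- The rows of `P(a)` are dependent: `v P(a) = 0` with some `v i ≠ 0`. Putting `v` into row `i` of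
the identity gives an invertible constant matrix `V`, and row `i` of `V P` is divisible by `X - a`.
-/
lemma exists_factor {P : Matrix (Fin m) (Fin m) ℂ[X]} {a : ℂ} (h : P.det.eval a = 0) :
    ∃ (U : Matrix (Fin m) (Fin m) ℂ) (i : Fin m) (P₁ : Matrix (Fin m) (Fin m) ℂ[X]),
      IsUnit U ∧ P = U.map C * (linFactor i a * P₁) := by
  rw [eval_det] at h
  obtain ⟨v, hv, hvP⟩ := Matrix.exists_vecMul_eq_zero_iff.2 h
  obtain ⟨i, hi⟩ := Function.ne_iff.1 hv
  set V : Matrix (Fin m) (Fin m) ℂ := Matrix.updateRow 1 i v with hV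
  have hdet : V.det = v i := by
    have h1 := Matrix.cramer_transpose_apply (1 : Matrix (Fin m) (Fin m) ℂ) v i
    rw [Matrix.transpose_one, Matrix.cramer_one] at h1
    exact h1.symm
  have hVu : IsUnit V := by
    rw [Matrix.isUnit_iff_isUnit_det, hdet]
    exact isUnit_iff_ne_zero.2 hi
  have hrow : ∀ k, (X - C a) ∣ (V.map C * P) i k := by
    intro k
    rw [dvd_iff_isRoot, IsRoot, ← coe_evalRingHom, Matrix.mul_apply, map_sum]
    have := congrFun hvP k
    rw [Matrix.vecMul, dotProduct] at this
    refine Eq.trans (Finset.sum_congr rfl fun l _ => ?_) this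
    simp [hV, evalMat_apply]
  choose r hr using hrow
  have hVP : V.map C * P = linFactor i a * Matrix.updateRow (V.map C * P) i r := by
    ext1 k l
    rw [linFactor, Matrix.diagonal_mul]
    by_cases hk : k = i
    · subst hk
      rw [Function.update_self, Matrix.updateRow_self, hr]
    · rw [Function.update_of_ne hk, Matrix.updateRow_ne hk, Pi.one_apply, one_mul]
  refine ⟨V⁻¹, i, Matrix.updateRow (V.map C * P) i r, ?_, ?_⟩
  · exact Matrix.isUnit_nonsing_inv_iff.2 hVu
  · rw [← hVP, ← mul_assoc, ← Matrix.map_mul, Matrix.nonsing_inv_mul _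
      ((Matrix.isUnit_iff_isUnit_det _).1 hVu)]
    simp

/-- Induction on the number of zeros of the determinant in the disc, each splitting off a factor of
corank one. When none is left, the determinant is invertible at the shift and `P * adjugate P = det
P` makes `mul P` surjective. -/
lemma corank_mul_eq (n : ℕ) : ∀ P : Matrix (Fin m) (Fin m) ℂ[X],
    (∀ t : ℂ, ‖t‖ = 1 → P.det.eval t ≠ 0) → Multiset.card (discRoots P.det) = n →
      corank (mul P) = n := by
  induction n with
  | zero =>
    intro P hP hn
    have hdisc : ∀ t : ℂ, ‖t‖ ≤ 1 → P.det.eval t ≠ 0 := by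
      intro t ht h0
      rcases ht.lt_or_eq with ht | ht
      · have hne : P.det ≠ 0 := by
          intro h
          exact hP 1 (by simp) (by rw [h, eval_zero])
        have : t ∈ discRoots P.det := Multiset.mem_filter.2 ⟨(mem_roots hne).2 h0, ht⟩
        rw [Multiset.card_eq_zero.1 hn] at this
        simp at this
      · exact hP t ht h0
    obtain ⟨u, hu⟩ := isUnit_aeval_shift (m := m) hdisc
    have h1 : mul P * mul P.adjugate = u.1 := by
      rw [← map_mul, Matrix.mul_adjugate, mul_smul_one, hu]
    rw [Nat.cast_zero]
    refine corank_of_surjective fun x => ⟨mul P.adjugate (u⁻¹.1 x), ?_⟩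
    have h2 : mul P * mul P.adjugate * u⁻¹.1 = 1 := by rw [h1, u.mul_inv]
    exact congrArg (fun T : Hardy m →L[ℂ] Hardy m => T x) h2
  | succ n ih =>
    intro P hP hn
    obtain ⟨a, ha⟩ := Multiset.card_pos_iff_exists_mem.1 (by rw [hn]; exact n.succ_pos)
    obtain ⟨ha, ha1⟩ := Multiset.mem_filter.1 ha
    have hne : P.det ≠ 0 := by
      intro h
      rw [h, roots_zero] at ha
      exact Multiset.notMem_zero _ ha
    obtain ⟨U, i, P₁, hU, hPf⟩ := exists_factor ((mem_roots hne).1 ha)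
    have hdet : P.det = C U.det * ((X - C a) * P₁.det) := by
      rw [hPf, Matrix.det_mul, Matrix.det_mul, linFactor, Matrix.det_diagonal,
        Finset.prod_update_of_mem (Finset.mem_univ i)]
      have : (U.map C).det = C U.det := (RingHom.map_det C U).symm
      rw [this]
      simp
    have hUd : U.det ≠ 0 := ((Matrix.isUnit_iff_isUnit_det _).1 hU).ne_zero
    have h1 : P₁.det ≠ 0 := by
      intro h
      rw [h, mul_zero, mul_zero] at hdet
      exact hne hdet
    have hroots : discRoots P.det = a ::ₘ discRoots P₁.det := by
      rw [discRoots, hdet, roots_C_mul _ hUd, roots_mul (mul_ne_zero (X_sub_C_ne_zero a) h1), roots_X_sub_C,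
        Multiset.singleton_add]
      classical
      rw [discRoots, Multiset.filter_cons_of_pos (a := a) _ ha1]
    have hP₁ : ∀ t : ℂ, ‖t‖ = 1 → P₁.det.eval t ≠ 0 := by
      intro t ht h
      apply hP t ht
      rw [hdet]
      simp [h]
    rw [hroots, Multiset.card_cons, Nat.add_right_cancel_iff] at hn
    have hi := ih P₁ hP₁ hn
    obtain ⟨W, hW, hWs⟩ := exists_mul_linFactor i ha1
    have hUu : IsUnit (mul (U.map C)) := by rw [mul_map_C]; exact hU.map const
    have hUW : IsUnit (mul (U.map C) * W) := hUu.mul hW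
    rw [hPf, map_mul, map_mul, hWs, ← mul_assoc, ← mul_assoc, mul_assoc _ (coordShift i)]
    obtain ⟨u, hu⟩ := hUW
    rw [corank_mul (L := u⁻¹.1) (by rw [← hu, u.inv_mul]), corank_mul (coordShift_left_inv i), hi,
      corank_coordShift, ← hu, corank_of_isUnit u.isUnit]
    push_cast
    rw [add_zero]

end Hardy

/-- Multiplication by `den F` is invertible on the Hardy space and commutes with `shiftNum F lam`,
so it can be moved from the value to the argument without changing the range. -/
lemma mulRange_eq {F : RatMatrix m} (hF : IsAnalytic F) (lam : ℂ) :
    mulRange F lam = (Hardy.mul (shiftNum F lam)).range := by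
  have hd : ∀ t : ℂ, ‖t‖ < 1 → (den F).eval t ≠ 0 := fun t ht => hF.den_eval_ne_zero ht.le
  set D : Matrix (Fin m) (Fin m) ℂ[X] := den F • 1 with hD
  have hDev : ∀ t : ℂ, evalMat t D = (den F).eval t • (1 : Matrix (Fin m) (Fin m) ℂ) := by
    intro t
    ext i k
    simp [hD, Matrix.one_apply, apply_ite (eval t)]
  have hDat : ∀ (f : Hardy m) {t : ℂ}, ‖t‖ < 1 → (Hardy.mul D f).at t = (den F).eval t • f.at t := by
    intro f t ht
    rw [Hardy.at_mul D f ht, hDev, map_smul, Matrix.toLpLin_one]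
    rfl
  have hPat : ∀ (f : Hardy m) {t : ℂ}, ‖t‖ < 1 → (Hardy.mul (shiftNum F lam) f).at t =
      (den F).eval t • (Matrix.toEuclideanLin (value F t) (f.at t) - lam • f.at t) := by
    intro f t ht
    rw [Hardy.at_mul _ f ht, evalMat_shiftNum_of_ne F lam (hd t ht), map_smul, map_sub, map_smul,
      Matrix.toLpLin_one]
    rfl
  have hcomm : D * shiftNum F lam = shiftNum F lam * D := by
    rw [hD, smul_mul_assoc, one_mul, mul_smul_comm, mul_one]
  obtain ⟨u, hu⟩ := Hardy.isUnit_aeval_shift (m := m) (p := den F)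
    fun t ht => hF.den_eval_ne_zero ht
  have huD : u.1 = Hardy.mul D := by rw [hu, hD, Hardy.mul_smul_one]
  have hinj : ∀ f g : Hardy m, (∀ t : ℂ, ‖t‖ < 1 → f.at t = g.at t) → f = g := by
    intro f g h
    rw [← sub_eq_zero]
    refine Hardy.eq_zero_of_at fun t ht => ?_
    have : f.at t = (f - g).at t + g.at t := by
      rw [← Hardy.at_add _ _ ht, sub_add_cancel]
    rw [h t ht] at this
    simpa using this
  have hleft : ∀ f : Hardy m, u⁻¹.1 (Hardy.mul D f) = f := fun f => by
    rw [← huD]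
    exact congrArg (fun T : Hardy m →L[ℂ] Hardy m => T f) u.inv_mul
  have hright : ∀ f : Hardy m, Hardy.mul D (u⁻¹.1 f) = f := fun f => by
    rw [← huD]
    exact congrArg (fun T : Hardy m →L[ℂ] Hardy m => T f) u.mul_inv
  have hcomm' : ∀ f : Hardy m, Hardy.mul D (Hardy.mul (shiftNum F lam) f) =
      Hardy.mul (shiftNum F lam) (Hardy.mul D f) := fun f => by
    have := congrArg (fun T => Hardy.mul T f) hcomm
    simp only [map_mul] at this
    exact this
  ext g
  constructor
  · rintro ⟨f, hf⟩
    refine ⟨u⁻¹.1 f, ?_⟩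
    have h1 : Hardy.mul D g = Hardy.mul (shiftNum F lam) f := by
      refine hinj _ _ fun t ht => ?_
      rw [hDat g ht, hPat f ht, hf t ht]
    have h2 : Hardy.mul D (Hardy.mul (shiftNum F lam) (u⁻¹.1 f)) = Hardy.mul D g := by
      rw [hcomm', hright, h1]
    have h3 := congrArg u⁻¹.1 h2
    rwa [hleft, hleft] at h3
  · rintro ⟨h, rfl⟩
    refine ⟨Hardy.mul D h, fun t ht => ?_⟩
    change (Hardy.mul (shiftNum F lam) h).at t = _
    rw [hPat h ht, hDat h ht, map_smul, smul_comm lam, smul_sub]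

lemma rank_mulRange_orthogonal {F : RatMatrix m} (hF : IsAnalytic F) {lam : ℂ}
    (hlam : lam ∉ gammaSet F) :
    Module.rank ℂ (mulRange F lam)ᗮ = (Multiset.card (discRoots (shiftNum F lam).det) : ℕ) := by
  rw [mulRange_eq hF]
  exact Hardy.corank_mul_eq _ _ (fun t ht => det_shiftNum_eval_ne_zero hF hlam ht) rfl

end NormalSymbol
end

noncomputable section

namespace NormalSymbol

open Polynomial

/-! ### Continuous selection from a continuous family of multisets -/

/-- `M` depends continuously on `t ∈ s`, in the matching distance. -/
def MultisetContinuousOn (M : ℝ → Multiset ℂ) (s : Set ℝ) : Prop :=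
  ∀ t₀ ∈ s, ∀ ε > 0, ∀ᶠ t in nhdsWithin t₀ s,
    Multiset.Rel (fun x y => dist x y < ε) (M t) (M t₀)

/-- `ζ` is a continuous enumeration of the multisets `M t`, `t ∈ s`. -/
structure IsBranches {ι : Type} [Fintype ι] (ζ : ι → ℝ → ℂ) (M : ℝ → Multiset ℂ)
    (s : Set ℝ) : Prop where
  cont : ∀ j, ContinuousOn (ζ j) s
  eq : ∀ t ∈ s, M t = (Finset.univ : Finset ι).val.map fun j => ζ j t

/-- The multisets `M t`, `t ∈ s`, have a continuous enumeration. -/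
def HasBranches (n : ℕ) (M : ℝ → Multiset ℂ) (s : Set ℝ) : Prop :=
  ∃ ζ : Fin n → ℝ → ℂ, IsBranches ζ M s

lemma IsBranches.mono {ι : Type} [Fintype ι] {ζ : ι → ℝ → ℂ} {M : ℝ → Multiset ℂ} {s s' : Set ℝ}
    (h : IsBranches ζ M s) (hs : s' ⊆ s) : IsBranches ζ M s' :=
  ⟨fun j => (h.cont j).mono hs, fun t ht => h.eq t (hs ht)⟩

lemma HasBranches.mono {n : ℕ} {M : ℝ → Multiset ℂ} {s s' : Set ℝ}
    (h : HasBranches n M s) (hs : s' ⊆ s) : HasBranches n M s' :=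
  h.imp fun _ h => h.mono hs

lemma exists_perm_of_map_eq {ι : Type} [Fintype ι] {f g : ι → ℂ}
    (h : (Finset.univ : Finset ι).val.map f = (Finset.univ : Finset ι).val.map g) :
    ∃ σ : Equiv.Perm ι, ∀ j, g (σ j) = f j := by
  classical
  have hc : ∀ c, Nonempty ({a // f a = c} ≃ {b // g b = c}) := by
    intro c
    refine Fintype.card_eq.1 ?_
    have := congrArg (Multiset.count c) h
    rw [Multiset.count_map, Multiset.count_map] at this
    rw [Fintype.card_subtype, Fintype.card_subtype]
    simp only [eq_comm (a := c)] at this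
    exact this
  exact ⟨Equiv.ofFiberEquiv fun c => (hc c).some, fun j => Equiv.ofFiberEquiv_map _ j⟩

/-- At `y` both families enumerate `M y`, so they differ by a permutation, which relabels the
right-hand branches. The left-hand ones stay unchanged, which is needed for gluing infinitely often.
-/
lemma IsBranches.glue {n : ℕ} {ζ ξ : Fin n → ℝ → ℂ} {M : ℝ → Multiset ℂ} {s : Set ℝ} {y : ℝ}
    (hy : y ∈ s) (h₁ : IsBranches ζ M (s ∩ Set.Iic y)) (h₂ : IsBranches ξ M (s ∩ Set.Ici y)) :
    ∃ η : Fin n → ℝ → ℂ, IsBranches η M s ∧ ∀ j, Set.EqOn (η j) (ζ j) (s ∩ Set.Iic y) := by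
  obtain ⟨σ, hσ⟩ := exists_perm_of_map_eq
    ((h₁.eq y ⟨hy, Set.self_mem_Iic⟩).symm.trans (h₂.eq y ⟨hy, Set.self_mem_Ici⟩))
  set η : Fin n → ℝ → ℂ := fun j t => if t ≤ y then ζ j t else ξ (σ j) t
  have e₁ : ∀ j, Set.EqOn (η j) (ζ j) (s ∩ Set.Iic y) := fun j t ht => if_pos ht.2
  have e₂ : ∀ j, Set.EqOn (η j) (ξ (σ j)) (s ∩ Set.Ici y) := fun j t ht => by
    rcases eq_or_lt_of_le (show y ≤ t from ht.2) with rfl | hlt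
    · exact (if_pos le_rfl).trans (hσ j).symm
    · exact if_neg (not_le.2 hlt)
  have hs : s = (s ∩ Set.Iic y) ∪ (s ∩ Set.Ici y) := by
    rw [← Set.inter_union_distrib_left, Set.Iic_union_Ici, Set.inter_univ]
  refine ⟨η, ⟨fun j t ht => ?_, fun t ht => ?_⟩, e₁⟩
  · rw [hs]
    refine ContinuousWithinAt.union ?_ ?_
    · by_cases hty : t ≤ y
      · exact ((h₁.cont j).congr (e₁ j)) t ⟨ht, hty⟩
      · refine continuousWithinAt_of_notMem_closure fun h => hty ?_
        exact isClosed_Iic.closure_subset_iff.2 Set.inter_subset_right h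
    · by_cases hty : y ≤ t
      · exact ((h₂.cont (σ j)).congr (e₂ j)) t ⟨ht, hty⟩
      · refine continuousWithinAt_of_notMem_closure fun h => hty ?_
        exact isClosed_Ici.closure_subset_iff.2 Set.inter_subset_right h
  · by_cases hty : t ≤ y
    · rw [h₁.eq t ⟨ht, hty⟩]
      exact Multiset.map_congr rfl fun j _ => (e₁ j ⟨ht, hty⟩).symm
    · have hty' : t ∈ s ∩ Set.Ici y := ⟨ht, (not_le.1 hty).le⟩
      rw [h₂.eq t hty']
      conv_lhs => rw [← Multiset.map_univ_val_equiv σ, Multiset.map_map]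
      exact Multiset.map_congr rfl fun j _ => (e₂ j hty').symm

lemma HasBranches.neg {n : ℕ} {M : ℝ → Multiset ℂ} {s : Set ℝ}
    (h : HasBranches n M s) : HasBranches n (fun t => M (-t)) (Neg.neg ⁻¹' s) := by
  obtain ⟨ζ, hζ⟩ := h
  exact ⟨fun j t => ζ j (-t), fun j => (hζ.cont j).comp continuous_neg.continuousOn
    fun t ht => ht, fun t ht => hζ.eq (-t) ht⟩

/-- By compactness the interval has a finite subdivision each piece of which lies in a set with
local branches; these are glued in turn. -/
lemma hasBranches_Icc {n : ℕ} {M : ℝ → Multiset ℂ} {s : Set ℝ}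
    (hloc : ∀ t ∈ s, ∃ η > 0, HasBranches n M (s ∩ Set.Ioo (t - η) (t + η)))
    {x y : ℝ} (hxy : x ≤ y) (hs : Set.Icc x y ⊆ s) : HasBranches n M (Set.Icc x y) := by
  choose! η hη hbr using hloc
  obtain ⟨u, hu0, hmono, ⟨N, hN⟩, hu⟩ := exists_monotone_Icc_subset_open_cover_Icc hxy
    (c := fun i : Set.Icc x y => {t : Set.Icc x y | (t : ℝ) ∈ Set.Ioo (i - η i) (i + η i)})
    (fun i => isOpen_Ioo.preimage continuous_subtype_val)
    (fun t _ => Set.mem_iUnion.2 ⟨t, by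
      have := hη t (hs t.2)
      exact ⟨by linarith, by linarith⟩⟩)
  have key : ∀ k, HasBranches n M (Set.Icc x (u k)) := by
    intro k
    have hpiece : ∀ k, HasBranches n M (Set.Icc (u k : ℝ) (u (k + 1))) := by
      intro k
      obtain ⟨i, hi⟩ := hu k
      refine (hbr i (hs i.2)).mono fun t ht => ?_
      have htxy : t ∈ Set.Icc x y := ⟨(u k).2.1.trans ht.1, ht.2.trans (u (k + 1)).2.2⟩
      exact ⟨hs htxy, hi (show (⟨t, htxy⟩ : Set.Icc x y) ∈ Set.Icc (u k) (u (k + 1)) from ht)⟩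
    induction k with
    | zero =>
      refine (hpiece 0).mono ?_
      rw [hu0]
      intro t ht
      exact ⟨ht.1, ht.2.trans (u 1).2.1⟩
    | succ k ih =>
      obtain ⟨ζ, hζ⟩ := ih
      obtain ⟨ξ, hξ⟩ := hpiece k
      have hk : (u k : ℝ) ≤ u (k + 1) := hmono k.le_succ
      obtain ⟨θ, hθ, -⟩ := IsBranches.glue (s := Set.Icc x (u (k + 1))) (y := u k)
        ⟨(u k).2.1, hk⟩ (hζ.mono fun t ht => ⟨ht.1.1, ht.2⟩) (hξ.mono fun t ht => ⟨ht.2, ht.1.2⟩)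
      exact ⟨θ, hθ⟩
  have := key N
  rwa [hN N le_rfl] at this

/-- The set is exhausted by intervals `[x, b k]` with `b` cofinal. Each extension of the branches
leaves the earlier ones alone, so the limit is well defined. -/
lemma hasBranches_inter_Ici {n : ℕ} {M : ℝ → Multiset ℂ} {s : Set ℝ} [s.OrdConnected]
    (hIcc : ∀ x ∈ s, ∀ y ∈ s, x ≤ y → HasBranches n M (Set.Icc x y)) {x : ℝ} (hx : x ∈ s) :
    HasBranches n M (s ∩ Set.Ici x) := by
  have : (s ∩ Set.Ici x).OrdConnected := inferInstance
  have : Nonempty ↥(s ∩ Set.Ici x) := ⟨⟨x, hx, Set.self_mem_Ici⟩⟩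
  obtain ⟨b, hb, hbt⟩ := Filter.exists_seq_monotone_tendsto_atTop_atTop ↥(s ∩ Set.Ici x)
  have hstep : ∀ k (z : {ζ : Fin n → ℝ → ℂ // IsBranches ζ M (Set.Icc x (b k))}),
      ∃ w : {ζ : Fin n → ℝ → ℂ // IsBranches ζ M (Set.Icc x (b (k + 1)))},
        ∀ j, Set.EqOn (w.1 j) (z.1 j) (Set.Icc x (b k)) := by
    rintro k ⟨ζ, hζ⟩
    have hk : (b k : ℝ) ≤ b (k + 1) := hb k.le_succ
    obtain ⟨ξ, hξ⟩ := hIcc _ (b k).2.1 _ (b (k + 1)).2.1 hk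
    obtain ⟨θ, hθ, hθe⟩ := IsBranches.glue (s := Set.Icc x (b (k + 1))) (y := b k)
      ⟨(b k).2.2, hk⟩ (hζ.mono fun t ht => ⟨ht.1.1, ht.2⟩) (hξ.mono fun t ht => ⟨ht.2, ht.1.2⟩)
    exact ⟨⟨θ, hθ⟩, fun j t ht => hθe j ⟨⟨ht.1, ht.2.trans hk⟩, ht.2⟩⟩
  choose step hstep using hstep
  obtain ⟨ζ₀, hζ₀⟩ := hIcc x hx _ (b 0).2.1 (b 0).2.2
  let Z : ∀ k, {ζ : Fin n → ℝ → ℂ // IsBranches ζ M (Set.Icc x (b k))} :=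
    fun k => Nat.rec ⟨ζ₀, hζ₀⟩ step k
  have hZ : ∀ k l, k ≤ l → ∀ j, Set.EqOn ((Z l).1 j) ((Z k).1 j) (Set.Icc x (b k)) := by
    intro k l hkl
    induction l, hkl using Nat.le_induction with
    | base => exact fun j t _ => rfl
    | succ l hkl ih =>
      intro j t ht
      have : (b k : ℝ) ≤ b l := hb hkl
      exact (hstep l (Z l) j ⟨ht.1, ht.2.trans this⟩).trans (ih j ht)
  have hidx : ∀ t ∈ s ∩ Set.Ici x, ∃ k, t ≤ b k := fun t ht =>
    (hbt.eventually_ge_atTop ⟨t, ht⟩).exists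
  choose! idx hidx using hidx
  have hη : ∀ k j, Set.EqOn (fun t => (Z (idx t)).1 j t) ((Z k).1 j)
      ((s ∩ Set.Ici x) ∩ Set.Iic (b k)) := by
    intro k j t ht
    rcases le_total k (idx t) with h | h
    · exact hZ _ _ h j ⟨ht.1.2, ht.2⟩
    · exact (hZ _ _ h j ⟨ht.1.2, hidx t ht.1⟩).symm
  refine ⟨fun j t => (Z (idx t)).1 j t, fun j t ht => ?_, fun t ht => ?_⟩
  -- If `t` is not the maximum of `s`, some `b k` lies beyond a later point and a neighbourhood of
  -- `t` is covered; if it is, `[x, b k]` is already everything once it contains `t`.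
  · have hnhds : ∃ k, t ≤ b k ∧ (s ∩ Set.Ici x) ∩ Set.Iic (b k) ∈ nhdsWithin t (s ∩ Set.Ici x) := by
      by_cases hmax : ∃ t' ∈ s, t < t'
      · obtain ⟨t', ht', hlt⟩ := hmax
        have htx : t' ∈ s ∩ Set.Ici x := ⟨ht', le_trans ht.2 hlt.le⟩
        refine ⟨idx t', hlt.le.trans (hidx t' htx), ?_⟩
        filter_upwards [self_mem_nhdsWithin, nhdsWithin_le_nhds (Iio_mem_nhds hlt)] with r hr hr'
        exact ⟨hr, (le_of_lt hr').trans (hidx t' htx)⟩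
      · push Not at hmax
        refine ⟨idx t, hidx t ht, ?_⟩
        filter_upwards [self_mem_nhdsWithin] with r hr
        exact ⟨hr, (hmax r hr.1).trans (hidx t ht)⟩
    obtain ⟨k, htk, hk⟩ := hnhds
    have h1 : ContinuousOn (fun t => (Z (idx t)).1 j t) ((s ∩ Set.Ici x) ∩ Set.Iic (b k)) :=
      (((Z k).2.cont j).mono fun r hr => ⟨hr.1.2, hr.2⟩).congr (hη k j)
    exact (h1 t ⟨ht, htk⟩).mono_of_mem_nhdsWithin hk
  · exact (Z (idx t)).2.eq t ⟨ht.2, hidx t ht⟩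

lemma hasBranches_of_local {n : ℕ} {M : ℝ → Multiset ℂ} {s : Set ℝ} [hs : s.OrdConnected]
    (hloc : ∀ t ∈ s, ∃ η > 0, HasBranches n M (s ∩ Set.Ioo (t - η) (t + η))) :
    HasBranches n M s := by
  have hIcc : ∀ x ∈ s, ∀ y ∈ s, x ≤ y → HasBranches n M (Set.Icc x y) := fun x hx y hy hxy =>
    hasBranches_Icc hloc hxy (hs.out hx hy)
  rcases s.eq_empty_or_nonempty with rfl | ⟨x, hx⟩
  · exact ⟨fun _ _ => 0, fun _ => continuousOn_empty _, fun t ht => ht.elim⟩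
  obtain ⟨ξ, hξ⟩ := hasBranches_inter_Ici hIcc hx
  have hord : (Neg.neg ⁻¹' s).OrdConnected := by
    refine ⟨fun a ha b hb c hc => ?_⟩
    exact hs.out hb ha ⟨neg_le_neg hc.2, neg_le_neg hc.1⟩
  have hleft := hasBranches_inter_Ici (n := n) (M := fun t => M (-t)) (s := Neg.neg ⁻¹' s)
    (fun a ha b hb hab => ((hIcc (-b) hb (-a) ha (neg_le_neg hab)).neg).mono fun t ht =>
      ⟨neg_le_neg ht.2, neg_le_neg ht.1⟩) (x := -x) (by simpa using hx)
  obtain ⟨ζ, hζ⟩ := hleft.neg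
  simp only [neg_neg] at hζ
  obtain ⟨θ, hθ, -⟩ := IsBranches.glue hx
    (hζ.mono fun t ht => (⟨by simpa using ht.1, Set.mem_Ici.2 (neg_le_neg ht.2)⟩ : -t ∈ Neg.neg ⁻¹' s ∩ Set.Ici (-x)))
    hξ
  exact ⟨θ, hθ⟩

lemma HasBranches.add {n₁ n₂ : ℕ} {M₁ M₂ : ℝ → Multiset ℂ} {s : Set ℝ}
    (h₁ : HasBranches n₁ M₁ s) (h₂ : HasBranches n₂ M₂ s) :
    HasBranches (n₁ + n₂) (fun t => M₁ t + M₂ t) s := by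
  obtain ⟨ζ₁, h₁⟩ := h₁
  obtain ⟨ζ₂, h₂⟩ := h₂
  let f : Fin n₁ ⊕ Fin n₂ → ℝ → ℂ := Sum.elim ζ₁ ζ₂
  refine ⟨fun j => f (finSumFinEquiv.symm j), fun j => ?_, fun t ht => ?_⟩
  · cases finSumFinEquiv.symm j with
    | inl j => exact h₁.cont j
    | inr j => exact h₂.cont j
  · have h3 : (Finset.univ : Finset (Fin (n₁ + n₂))).val.map
        (fun j => f (finSumFinEquiv.symm j) t) =
        (Finset.univ : Finset (Fin n₁ ⊕ Fin n₂)).val.map fun j => f j t := by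
      rw [← Multiset.map_univ_val_equiv (finSumFinEquiv (m := n₁) (n := n₂)), Multiset.map_map]
      simp
    rw [h3, ← Finset.univ_disjSum_univ, Finset.val_disjSum, Multiset.disjSum, Multiset.map_add,
      Multiset.map_map, Multiset.map_map]
    exact congrArg₂ _ (h₁.eq t ht) (h₂.eq t ht)

lemma rel_filter {r : ℂ → ℂ → Prop} {p : ℂ → Prop} [DecidablePred p] {A B : Multiset ℂ}
    (h : Multiset.Rel r A B) (hp : ∀ a ∈ A, ∀ b ∈ B, r a b → (p a ↔ p b)) :
    Multiset.Rel r (A.filter p) (B.filter p) := by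
  induction h with
  | zero => exact Multiset.Rel.zero
  | @cons a b as bs hab h ih =>
    have ih' := ih fun a' ha' b' hb' => hp a' (Multiset.mem_cons_of_mem ha') b'
      (Multiset.mem_cons_of_mem hb')
    have hab' := hp a (Multiset.mem_cons_self _ _) b (Multiset.mem_cons_self _ _) hab
    by_cases ha : p a
    · rw [Multiset.filter_cons_of_pos _ ha, Multiset.filter_cons_of_pos _ (hab'.1 ha)]
      exact Multiset.Rel.cons hab ih'
    · rw [Multiset.filter_cons_of_neg _ ha, Multiset.filter_cons_of_neg _ (fun h => ha (hab'.2 h))]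
      exact ih'

lemma MultisetContinuousOn.mono {M : ℝ → Multiset ℂ} {s s' : Set ℝ}
    (h : MultisetContinuousOn M s) (hs : s' ⊆ s) : MultisetContinuousOn M s' :=
  fun t ht ε hε => nhdsWithin_mono _ hs (h t (hs ht) ε hε)

/-- If `M t₀` has two distinct points, let `δ` be the distance from one of them, `x`, to the nearest
other. Near `t₀` the multiset splits into the points close to `x` and those far from it. Both parts
are nonempty and vary continuously, so the induction hypothesis applies to them. The last conclusion
says that having two distinct points is a relatively open condition. -/
lemma exists_local_split {n : ℕ} {M : ℝ → Multiset ℂ} {s : Set ℝ} [s.OrdConnected]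
    (hM : MultisetContinuousOn M s) (hcard : ∀ t ∈ s, Multiset.card (M t) = n)
    (ih : ∀ n' < n, ∀ (M' : ℝ → Multiset ℂ) (s' : Set ℝ), s'.OrdConnected →
      MultisetContinuousOn M' s' → (∀ t ∈ s', Multiset.card (M' t) = n') → HasBranches n' M' s')
    {t₀ : ℝ} (ht₀ : t₀ ∈ s) (hne : ∀ v, M t₀ ≠ Multiset.replicate n v) (hn : n ≠ 0) :
    ∃ η > 0, HasBranches n M (s ∩ Set.Ioo (t₀ - η) (t₀ + η)) ∧
      ∀ t ∈ s ∩ Set.Ioo (t₀ - η) (t₀ + η), ∀ v, M t ≠ Multiset.replicate n v := by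
  classical
  obtain ⟨x, hx⟩ : ∃ x, x ∈ M t₀ := by
    refine Multiset.exists_mem_of_ne_zero fun h => hn ?_
    rw [← hcard t₀ ht₀, h, Multiset.card_zero]
  obtain ⟨y, hy, hyx⟩ : ∃ y ∈ M t₀, y ≠ x := by
    by_contra! h
    exact hne x (Multiset.eq_replicate.2 ⟨hcard t₀ ht₀, h⟩)
  obtain ⟨w, hw, hwmin⟩ := Finset.exists_min_image ((M t₀).toFinset.erase x) (fun z => dist z x)
    ⟨y, Finset.mem_erase.2 ⟨hyx, Multiset.mem_toFinset.2 hy⟩⟩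
  set δ := dist w x with hδ
  have hδ0 : 0 < δ := dist_pos.2 (Finset.mem_erase.1 hw).1
  have hsep : ∀ z ∈ M t₀, z ≠ x → δ ≤ dist z x := fun z hz hzx =>
    hwmin z (Finset.mem_erase.2 ⟨hzx, Multiset.mem_toFinset.2 hz⟩)
  -- With tolerance `δ / 4`, points matched to `x` stay within `δ / 4` of it and all others stay
  -- beyond `3δ / 4`; the threshold `δ / 2` separates them.
  obtain ⟨η, hη, hball⟩ := Metric.mem_nhdsWithin_iff.1 (hM t₀ ht₀ (δ / 4) (by positivity))
  set V := s ∩ Set.Ioo (t₀ - η) (t₀ + η) with hV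
  have hVs : V ⊆ s := Set.inter_subset_left
  have hVord : V.OrdConnected := inferInstance
  have hrel : ∀ t ∈ V, Multiset.Rel (fun x y => dist x y < δ / 4) (M t) (M t₀) := fun t ht =>
    hball ⟨by rw [Real.ball_eq_Ioo]; exact ht.2, ht.1⟩
  set p : ℂ → Prop := fun z => dist z x < δ / 2 with hp
  have hpz : ∀ z z₀, z₀ ∈ M t₀ → dist z z₀ < δ / 4 →
      (dist z x < δ / 4 ∧ p z₀) ∨ (3 * δ / 4 < dist z x ∧ ¬ p z₀) := by
    intro z z₀ hz₀ hzz
    by_cases h : z₀ = x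
    · subst h
      left
      exact ⟨hzz, by simp only [hp, dist_self]; positivity⟩
    · right
      have h1 := hsep z₀ hz₀ h
      have h2 := dist_triangle_left z₀ x z
      refine ⟨by linarith, ?_⟩
      simp only [hp, not_lt]
      linarith
  have hdich : ∀ t ∈ V, ∀ z ∈ M t, dist z x < δ / 4 ∨ 3 * δ / 4 < dist z x := by
    intro t ht z hz
    obtain ⟨z₀, hz₀, hzz⟩ := Multiset.exists_mem_of_rel_of_mem (hrel t ht) hz
    exact (hpz z z₀ hz₀ hzz).imp And.left And.left
  have hcons : ∀ t ∈ V, ∀ z ∈ M t, ∀ z₀ ∈ M t₀, dist z z₀ < δ / 4 → (p z ↔ p z₀) := by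
    intro t ht z hz z₀ hz₀ hzz
    rcases hpz z z₀ hz₀ hzz with ⟨h, h'⟩ | ⟨h, h'⟩
    · exact iff_of_true (by simp only [hp]; linarith) h'
    · exact iff_of_false (by simp only [hp, not_lt]; linarith) h'
  have hcont : ∀ (q : ℂ → Prop) [DecidablePred q], (∀ z, q z ↔ p z) ∨ (∀ z, q z ↔ ¬ p z) →
      MultisetContinuousOn (fun t => (M t).filter q) V ∧
      ∀ t ∈ V, Multiset.card ((M t).filter q) = Multiset.card ((M t₀).filter q) := by
    intro q _ hq
    have hq' : ∀ z z', (p z ↔ p z') → (q z ↔ q z') := by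
      intro z z' h
      rcases hq with hq | hq
      · rw [hq, hq, h]
      · rw [hq, hq, h]
    refine ⟨fun t₁ ht₁ ε hε => ?_, fun t ht => ?_⟩
    -- Points matched within `δ / 2`, the width of the gap, lie on the same side of it.
    · filter_upwards [self_mem_nhdsWithin,
        (hM.mono hVs) t₁ ht₁ (min ε (δ / 2)) (lt_min hε (by positivity))] with t ht hrt
      refine (rel_filter hrt fun z hz z₁ hz₁ hzz => hq' _ _ ?_).mono fun z _ z₁ _ h =>
        h.trans_le (min_le_left _ _)
      have h1 := hzz.trans_le (min_le_right _ _)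
      have h2 := dist_triangle_left z x z₁
      have h3 := dist_triangle z₁ z x
      have h2' := dist_triangle z z₁ x
      rw [dist_comm z₁ z] at h3
      simp only [hp]
      rcases hdich t ht z hz with h4 | h4 <;> rcases hdich t₁ ht₁ z₁ hz₁ with h5 | h5
      · exact iff_of_true (by linarith) (by linarith)
      · linarith
      · linarith
      · exact iff_of_false (by linarith) (by linarith)
    · exact Multiset.card_eq_card_of_rel (rel_filter (hrel t ht) fun z hz z₀ hz₀ h =>
        hq' _ _ (hcons t ht z hz z₀ hz₀ h))
  obtain ⟨hc₁, hk₁⟩ := hcont p (Or.inl fun _ => Iff.rfl)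
  obtain ⟨hc₂, hk₂⟩ := hcont (fun z => ¬ p z) (Or.inr fun _ => Iff.rfl)
  set n₁ := Multiset.card ((M t₀).filter p)
  set n₂ := Multiset.card ((M t₀).filter fun z => ¬ p z)
  have hpx : p x := by simp only [hp, dist_self]; positivity
  have hpy : ¬ p y := by
    have := hsep y hy hyx
    simp only [hp, not_lt]; linarith
  have hn₁ : 0 < n₁ := Multiset.card_pos_iff_exists_mem.2 ⟨x, Multiset.mem_filter.2 ⟨hx, hpx⟩⟩
  have hn₂ : 0 < n₂ := Multiset.card_pos_iff_exists_mem.2 ⟨y, Multiset.mem_filter.2 ⟨hy, hpy⟩⟩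
  have hsum : n₁ + n₂ = n := by
    rw [← Multiset.card_add, Multiset.filter_add_not, hcard t₀ ht₀]
  refine ⟨η, hη, ?_, ?_⟩
  · have h1 := ih n₁ (by omega) _ V hVord hc₁ hk₁
    have h2 := ih n₂ (by omega) _ V hVord hc₂ hk₂
    have h3 := h1.add h2
    simp only [Multiset.filter_add_not] at h3
    rwa [hsum] at h3
  · intro t ht v hv
    have h1 := hk₁ t ht
    have h2 := hk₂ t ht
    rw [hv] at h1 h2
    by_cases hpv : p v
    · rw [Multiset.filter_eq_nil.2 fun a ha => by
        rw [Multiset.eq_of_mem_replicate ha]; exact not_not.2 hpv] at h2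
      rw [Multiset.card_zero] at h2
      omega
    · rw [Multiset.filter_eq_nil.2 fun a ha => by
        rw [Multiset.eq_of_mem_replicate ha]; exact hpv] at h1
      rw [Multiset.card_zero] at h1
      omega

/-- Strong induction on `n`. The set `U` of parameters at which `M t` has two distinct points is
relatively open, and the local branches glue on each of its order-connected components. Off `U` all
branches take the single value of `M t`. -/
theorem MultisetContinuousOn.hasBranches (n : ℕ) : ∀ (M : ℝ → Multiset ℂ) (s : Set ℝ),
    s.OrdConnected → MultisetContinuousOn M s → (∀ t ∈ s, Multiset.card (M t) = n) →
      HasBranches n M s := by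
  induction n using Nat.strong_induction_on with
  | _ n ih =>
  intro M s hs hM hcard
  rcases Nat.eq_zero_or_pos n with rfl | hn
  · exact ⟨fun j => j.elim0, fun j => j.elim0, fun t ht => by
      rw [Multiset.card_eq_zero.1 (hcard t ht)]; rfl⟩
  classical
  set U : Set ℝ := {t ∈ s | ∀ v, M t ≠ Multiset.replicate n v} with hU
  have hlocal : ∀ t₀ ∈ U, ∃ η > 0, HasBranches n M (s ∩ Set.Ioo (t₀ - η) (t₀ + η)) ∧
      s ∩ Set.Ioo (t₀ - η) (t₀ + η) ⊆ U := by
    intro t₀ ht₀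
    obtain ⟨η, hη, h1, h2⟩ := exists_local_split hM hcard ih ht₀.1 ht₀.2 hn.ne'
    exact ⟨η, hη, h1, fun t ht => ⟨ht.1, h2 t ht⟩⟩
  have hcomp : ∀ t, HasBranches n M (U.ordConnectedComponent t) := by
    intro t
    refine hasBranches_of_local fun t₁ ht₁ => ?_
    have hsub := Set.ordConnectedComponent_subset (s := U) (x := t)
    obtain ⟨η, hη, h1, -⟩ := hlocal t₁ (hsub ht₁)
    exact ⟨η, hη, h1.mono fun r hr => ⟨(hsub hr.1).1, hr.2⟩⟩
  -- The choice depends only on the component as a set, so all points of a component share the same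
  -- branches.
  set Z : Set ℝ → Fin n → ℝ → ℂ := fun D =>
    if h : HasBranches n M D then h.choose else fun _ _ => 0 with hZdef
  have hZ : ∀ t, IsBranches (Z (U.ordConnectedComponent t)) M (U.ordConnectedComponent t) := by
    intro t
    simp only [hZdef, dif_pos (hcomp t)]
    exact (hcomp t).choose_spec
  set η : Fin n → ℝ → ℂ := fun j t =>
    if t ∈ U then Z (U.ordConnectedComponent t) j t
    else if h : ∃ v, M t = Multiset.replicate n v then h.choose else 0 with hη
  have hηU : ∀ t ∈ U, ∀ j, η j t = Z (U.ordConnectedComponent t) j t := fun t ht j => if_pos ht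
  have hηK : ∀ t ∈ s, t ∉ U → ∀ v, M t = Multiset.replicate n v → ∀ j, η j t = v := by
    intro t ht htU v hv j
    have hex : ∃ v, M t = Multiset.replicate n v := ⟨v, hv⟩
    simp only [hη, if_neg htU, dif_pos hex]
    exact Multiset.replicate_right_injective hn.ne' (hex.choose_spec.symm.trans hv)
  have hEq : ∀ t ∈ s, M t = (Finset.univ : Finset (Fin n)).val.map fun j => η j t := by
    intro t ht
    by_cases htU : t ∈ U
    · rw [(hZ t).eq t (Set.self_mem_ordConnectedComponent.2 htU)]
      exact Multiset.map_congr rfl fun j _ => (hηU t htU j).symm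
    · obtain ⟨v, hv⟩ : ∃ v, M t = Multiset.replicate n v := by
        by_contra! h
        exact htU ⟨ht, h⟩
      rw [hv, Multiset.map_congr rfl fun j _ => hηK t ht htU v hv j]
      simp
  refine ⟨η, fun j t₀ ht₀ => ?_, hEq⟩
  by_cases htU : t₀ ∈ U
  · obtain ⟨δ, hδ, -, hsub⟩ := hlocal t₀ htU
    have hmem : s ∩ Set.Ioo (t₀ - δ) (t₀ + δ) ⊆ U.ordConnectedComponent t₀ :=
      Set.subset_ordConnectedComponent ⟨ht₀, by linarith, by linarith⟩ hsub
    have hnhds : U.ordConnectedComponent t₀ ∈ nhdsWithin t₀ s :=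
      Filter.mem_of_superset (inter_mem_nhdsWithin s
        (Ioo_mem_nhds (by linarith) (by linarith))) hmem
    have hc : ContinuousOn (η j) (U.ordConnectedComponent t₀) := by
      refine ((hZ t₀).cont j).congr fun t ht => ?_
      rw [hηU t (Set.ordConnectedComponent_subset ht), Set.ordConnectedComponent_eq ht]
    exact (hc t₀ (Set.self_mem_ordConnectedComponent.2 htU)).mono_of_mem_nhdsWithin hnhds
  · obtain ⟨v, hv⟩ : ∃ v, M t₀ = Multiset.replicate n v := by
      by_contra! h
      exact htU ⟨ht₀, h⟩
    -- No compatibility between components is needed here: near a point off `U` every element of `M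
    -- t` is close to `v`.
    rw [ContinuousWithinAt, hηK t₀ ht₀ htU v hv, Metric.tendsto_nhds]
    intro ε hε
    filter_upwards [self_mem_nhdsWithin, hM t₀ ht₀ ε hε] with t ht hrel
    have hmem : η j t ∈ M t := by
      rw [hEq t ht]
      exact Multiset.mem_map_of_mem _ (Finset.mem_univ j)
    obtain ⟨y, hy, hd⟩ := Multiset.exists_mem_of_rel_of_mem hrel hmem
    rw [hv] at hy
    rwa [Multiset.eq_of_mem_replicate hy] at hd

end NormalSymbol
end

noncomputable section

namespace NormalSymbol

open Polynomial

variable {m : ℕ}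

/-! ### Continuity of eigenvalues -/

/-- Gershgorin's theorem. The bound is continuous in the matrix, so eigenvalues stay in a fixed ball
locally. -/
lemma norm_le_of_mem_roots_charpoly {A : Matrix (Fin m) (Fin m) ℂ} {z : ℂ}
    (hz : z ∈ A.charpoly.roots) : ‖z‖ ≤ ∑ i, ∑ k, ‖A i k‖ := by
  have hev : Module.End.HasEigenvalue (Matrix.toLin' A) z := by
    rw [Module.End.hasEigenvalue_iff_isRoot_charpoly, Matrix.charpoly_toLin']
    exact (mem_roots A.charpoly_monic.ne_zero).1 hz
  obtain ⟨k, hk⟩ := eigenvalue_mem_ball hev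
  rw [mem_closedBall_iff_norm] at hk
  have h1 : ‖z‖ ≤ ‖A k k‖ + ∑ j ∈ Finset.univ.erase k, ‖A k j‖ := by
    have := norm_add_le (z - A k k) (A k k)
    rw [sub_add_cancel] at this
    linarith
  have h2 := Finset.add_sum_erase Finset.univ (fun j => ‖A k j‖) (Finset.mem_univ k)
  exact (h1.trans h2.le).trans (Finset.single_le_sum (f := fun i => ∑ k, ‖A i k‖)
    (fun _ _ => Finset.sum_nonneg fun _ _ => norm_nonneg _) (Finset.mem_univ k))

lemma exists_enum {n : ℕ} {M : Multiset ℂ} (h : Multiset.card M = n) :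
    ∃ v : Fin n → ℂ, (Finset.univ : Finset (Fin n)).val.map v = M := by
  subst h
  induction M using Quotient.inductionOn with
  | _ l => exact ⟨l.get, by
      change Finset.univ.val.map l.get = (l : Multiset ℂ)
      rw [Fin.univ_val_map, List.ofFn_get]⟩

lemma rel_map_univ {n : ℕ} {r : ℂ → ℂ → Prop} {v w : Fin n → ℂ} (h : ∀ i, r (v i) (w i)) :
    Multiset.Rel r ((Finset.univ : Finset (Fin n)).val.map v)
      ((Finset.univ : Finset (Fin n)).val.map w) := by
  rw [Multiset.rel_map]
  exact Multiset.rel_refl_of_refl_on fun i _ => h i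

/-- A compactness argument. Vectors in a large ball that are not `ε`-close to a reordering of the
roots at `t₀` form a compact set `Z`. The monic polynomials with roots in `Z` form a closed set
missing the characteristic polynomial at `t₀`, hence also those at nearby `t`. -/
lemma multisetContinuousOn_roots_charpoly {A : ℝ → Matrix (Fin m) (Fin m) ℂ} {s : Set ℝ}
    (hA : ContinuousOn A s) : MultisetContinuousOn (fun t => (A t).charpoly.roots) s := by
  intro t₀ ht₀ ε hε
  have hcard : ∀ t, Multiset.card (A t).charpoly.roots = m := fun t => by
    rw [← (IsAlgClosed.splits _).natDegree_eq_card_roots, Matrix.charpoly_natDegree_eq_dim,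
      Fintype.card_fin]
  have hprod : ∀ (t : ℝ) (v : Fin m → ℂ),
      (Finset.univ : Finset (Fin m)).val.map v = (A t).charpoly.roots →
      (fun z => ∏ i, (z - v i)) = fun z => (A t).charpoly.eval z := by
    intro t v hv
    funext z
    rw [(IsAlgClosed.splits (A t).charpoly).eq_prod_roots_of_monic (Matrix.charpoly_monic _), ← hv,
      Multiset.map_map, eval_multiset_prod, Multiset.map_map]
    simp [Finset.prod_eq_multiset_prod]
  set R : ℝ := (∑ i, ∑ k, ‖A t₀ i k‖) + 1
  obtain ⟨u, hu⟩ := exists_enum (hcard t₀)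
  set G : Set (Fin m → ℂ) := ⋃ σ : Equiv.Perm (Fin m), ⋂ i, {v | dist (v i) (u (σ i)) < ε} with hG
  have hGopen : IsOpen G := isOpen_iUnion fun σ => isOpen_iInter_of_finite fun i =>
    isOpen_lt (by fun_prop) continuous_const
  have hGrel : ∀ v ∈ G, Multiset.Rel (fun x y => dist x y < ε)
      ((Finset.univ : Finset (Fin m)).val.map v) (A t₀).charpoly.roots := by
    intro v hv
    obtain ⟨σ, hσ⟩ := Set.mem_iUnion.1 hv
    rw [← hu, ← Multiset.map_univ_val_equiv σ, Multiset.map_map (g := u),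
      Multiset.map_univ_val_equiv σ]
    exact rel_map_univ fun i => Set.mem_iInter.1 hσ i
  set Z : Set (Fin m → ℂ) := Metric.closedBall 0 R \ G
  have hZ : IsCompact Z := (isCompact_closedBall _ _).diff hGopen
  -- Polynomials are compared as functions under pointwise convergence, a Hausdorff topology, so
  -- that compact images are closed.
  have hh : Continuous fun v : Fin m → ℂ => fun z : ℂ => ∏ i, (z - v i) := by fun_prop
  have hcl : IsClosed ((fun v : Fin m → ℂ => fun z : ℂ => ∏ i, (z - v i)) '' Z) :=
    (hZ.image hh).isClosed
  have hnot : (fun z => (A t₀).charpoly.eval z) ∉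
      (fun v : Fin m → ℂ => fun z : ℂ => ∏ i, (z - v i)) '' Z := by
    rintro ⟨v, hv, hvz⟩
    apply hv.2
    have hroots : (A t₀).charpoly = ((Finset.univ : Finset (Fin m)).val.map fun i => X - C (v i)).prod := by
      refine Polynomial.funext fun z => ?_
      refine (congrFun hvz z).symm.trans ?_
      rw [eval_multiset_prod, Multiset.map_map]
      simp [Finset.prod_eq_multiset_prod]
    have hr2 : (A t₀).charpoly.roots = (Finset.univ : Finset (Fin m)).val.map v := by
      rw [hroots, ← roots_multiset_prod_X_sub_C ((Finset.univ : Finset (Fin m)).val.map v),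
        Multiset.map_map]
      rfl
    obtain ⟨σ, hσ⟩ := exists_perm_of_map_eq (hr2.symm.trans hu.symm)
    exact Set.mem_iUnion.2 ⟨σ, Set.mem_iInter.2 fun i => by
      change dist (v i) (u (σ i)) < ε
      rwa [hσ, dist_self]⟩
  have hcontc : ContinuousWithinAt (fun t => fun z : ℂ => (A t).charpoly.eval z) s t₀ := by
    rw [continuousWithinAt_pi]
    intro z
    simp only [Matrix.eval_charpoly]
    have hdet : Continuous fun B : Matrix (Fin m) (Fin m) ℂ => (Matrix.scalar (Fin m) z - B).det := by
      fun_prop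
    exact hdet.continuousAt.comp_continuousWithinAt (hA t₀ ht₀)
  have hev1 := hcontc.eventually (hcl.isOpen_compl.mem_nhds hnot)
  have hev2 : ∀ᶠ t in nhdsWithin t₀ s, (∑ i, ∑ k, ‖A t i k‖) < R := by
    have hc : Continuous fun B : Matrix (Fin m) (Fin m) ℂ => ∑ i, ∑ k, ‖B i k‖ := by fun_prop
    exact (hc.continuousAt.comp_continuousWithinAt (hA t₀ ht₀)).eventually_lt_const
      (lt_add_one _)
  filter_upwards [hev1, hev2] with t h1 h2
  obtain ⟨v, hv⟩ := exists_enum (hcard t)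
  by_contra hrel
  refine h1 ⟨v, ⟨?_, fun hvG => hrel ?_⟩, hprod t v hv⟩
  · rw [mem_closedBall_zero_iff, pi_norm_le_iff_of_nonneg (by positivity)]
    intro i
    refine (norm_le_of_mem_roots_charpoly ?_).trans h2.le
    rw [← hv]
    exact Multiset.mem_map_of_mem _ (Finset.mem_univ i)
  · have := hGrel v hvG
    rwa [hv] at this

end NormalSymbol
end

noncomputable section

namespace NormalSymbol

open Polynomial

variable {m : ℕ}

/-! ### Continuous arguments -/

/-- Extended by constants, `f` is a nowhere zero function on the simply connected line and has a
continuous logarithm; its imaginary part is the argument. -/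
lemma exists_continuousArg {f : ℝ → ℂ} (hf : ContinuousOn f (Set.Icc 0 (2 * Real.pi)))
    (h0 : ∀ θ ∈ Set.Icc (0 : ℝ) (2 * Real.pi), f θ ≠ 0) : ∃ a, IsContinuousArg f a := by
  have hle : (0 : ℝ) ≤ 2 * Real.pi := by positivity
  set g : ℝ → ℂ := Set.IccExtend hle ((Set.Icc 0 (2 * Real.pi)).domRestrict f) with hg
  have hgc : Continuous g := (continuousOn_iff_continuous_domRestrict.1 hf).Icc_extend'
  have hgf : ∀ θ ∈ Set.Icc (0 : ℝ) (2 * Real.pi), g θ = f θ := fun θ hθ =>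
    Set.IccExtend_of_mem hle _ hθ
  have hg0 : ∀ θ, g θ ≠ 0 := fun θ => h0 _ (Set.projIcc 0 (2 * Real.pi) hle θ).2
  have hsc : IsSimplyConnected (Set.univ : Set ℝ) := by
    have : ContractibleSpace ↥(Set.univ : Set ℝ) := convex_univ.contractibleSpace ⟨0, trivial⟩
    change SimplyConnectedSpace ↥(Set.univ : Set ℝ)
    infer_instance
  obtain ⟨L, hL, hLe⟩ := Complex.exists_continuousOn_eqOn_exp_comp hsc isOpen_univ
    hgc.continuousOn (by rintro ⟨θ, -, hθ⟩; exact hg0 θ hθ)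
  refine ⟨fun θ => (L θ).im, ?_, h0, fun θ hθ => ?_⟩
  · exact Complex.continuous_im.comp_continuousOn (hL.mono (Set.subset_univ _))
  · have h1 : Complex.exp (L θ) = f θ := (hLe (Set.mem_univ θ)).trans (hgf θ hθ)
    rw [← h1, Complex.norm_exp, Complex.ofReal_exp, ← Complex.exp_add, Complex.re_add_im]

/-- The difference of two arguments is continuous with values in `2πℤ`, hence constant. -/
lemma IsContinuousArg.increment_eq {f : ℝ → ℂ} {a b : ℝ → ℝ} (ha : IsContinuousArg f a)
    (hb : IsContinuousArg f b) :
    a (2 * Real.pi) - a 0 = b (2 * Real.pi) - b 0 := by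
  have hle : (0 : ℝ) ≤ 2 * Real.pi := by positivity
  have hint : ∀ θ ∈ Set.Icc (0 : ℝ) (2 * Real.pi), ∃ k : ℤ, a θ - b θ = k * (2 * Real.pi) := by
    intro θ hθ
    have h1 := (ha.arg_eq θ hθ).symm.trans (hb.arg_eq θ hθ)
    have h2 : (‖f θ‖ : ℂ) ≠ 0 := by exact_mod_cast norm_ne_zero_iff.2 (ha.ne_zero θ hθ)
    obtain ⟨k, hk⟩ := Complex.exp_eq_exp_iff_exists_int.1 (mul_left_cancel₀ h2 h1)
    refine ⟨k, ?_⟩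
    have h3 : ((a θ : ℂ) - (b θ + k * (2 * Real.pi))) * Complex.I = 0 := by
      linear_combination hk
    rw [mul_eq_zero, or_iff_left Complex.I_ne_zero, sub_eq_zero] at h3
    have h4 : a θ = b θ + k * (2 * Real.pi) := by exact_mod_cast h3
    linarith
  have hcont : ContinuousOn (fun θ => (a θ - b θ) / (2 * Real.pi)) (Set.Icc 0 (2 * Real.pi)) :=
    (ha.continuousOn.sub hb.continuousOn).div_const _
  have hconst : ∀ x ∈ Set.Icc (0 : ℝ) (2 * Real.pi), ∀ y ∈ Set.Icc (0 : ℝ) (2 * Real.pi),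
      (a x - b x) / (2 * Real.pi) = (a y - b y) / (2 * Real.pi) := by
    intro x hx y hy
    have hmaps : Set.MapsTo (fun θ => (a θ - b θ) / (2 * Real.pi)) (Set.Icc 0 (2 * Real.pi))
        (((↑) : ℤ → ℝ) '' Set.univ) := by
      intro θ hθ
      obtain ⟨k, hk⟩ := hint θ hθ
      refine ⟨k, trivial, ?_⟩
      change (k : ℝ) = (a θ - b θ) / (2 * Real.pi)
      rw [hk, mul_div_assoc, div_self (by positivity), mul_one]
    exact isPreconnected_Icc.constant_of_mapsTo
      (IsDiscrete.univ.image Int.isClosedEmbedding_coe_real.isInducing) hcont hmaps hx hy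
  have h := hconst (2 * Real.pi) ⟨hle, le_rfl⟩ 0 ⟨le_rfl, hle⟩
  have h2 : (2 * Real.pi) ≠ 0 := by positivity
  field_simp at h
  linarith

lemma IsContinuousArg.mul {f g : ℝ → ℂ} {a b : ℝ → ℝ} (ha : IsContinuousArg f a)
    (hb : IsContinuousArg g b) :
    IsContinuousArg (fun θ => f θ * g θ) (fun θ => a θ + b θ) := by
  refine ⟨ha.continuousOn.add hb.continuousOn, fun θ hθ =>
    mul_ne_zero (ha.ne_zero θ hθ) (hb.ne_zero θ hθ), fun θ hθ => ?_⟩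
  rw [norm_mul, Complex.ofReal_add, Complex.ofReal_mul, add_mul, Complex.exp_add]
  conv_lhs => rw [ha.arg_eq θ hθ, hb.arg_eq θ hθ]
  ring

lemma isContinuousArg_const {c : ℂ} (hc : c ≠ 0) :
    IsContinuousArg (fun _ => c) (fun _ => c.arg) :=
  ⟨continuousOn_const, fun _ _ => hc, fun _ _ => (Complex.norm_mul_exp_arg_mul_I c).symm⟩

lemma isContinuousArg_prod {ι : Type} (s : Finset ι) {f : ι → ℝ → ℂ} {a : ι → ℝ → ℝ}
    (h : ∀ i ∈ s, IsContinuousArg (f i) (a i)) :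
    IsContinuousArg (fun θ => ∏ i ∈ s, f i θ) (fun θ => ∑ i ∈ s, a i θ) := by
  classical
  induction s using Finset.induction_on with
  | empty => simpa using isContinuousArg_const one_ne_zero
  | insert i s hi ih =>
    simp only [Finset.prod_insert hi, Finset.sum_insert hi]
    exact (h i (Finset.mem_insert_self _ _)).mul
      (ih fun j hj => h j (Finset.mem_insert_of_mem hj))

lemma continuous_circlePt : Continuous circlePt := by
  unfold circlePt
  fun_prop

lemma isContinuousArg_circlePt : IsContinuousArg circlePt id :=
  ⟨continuousOn_id, fun _ _ => Complex.exp_ne_zero _, fun θ _ => by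
    rw [norm_circlePt, Complex.ofReal_one, one_mul]; rfl⟩

/-- `1 - f` stays in the right half plane, where the principal argument is continuous. -/
lemma isContinuousArg_of_norm_lt {f : ℝ → ℂ} (hf : Continuous f) (h : ∀ θ, ‖f θ‖ < 1) :
    IsContinuousArg (fun θ => 1 - f θ) (fun θ => (1 - f θ).arg) := by
  have hre : ∀ θ, 0 < (1 - f θ).re := by
    intro θ
    have := (Complex.re_le_norm (f θ)).trans_lt (h θ)
    simp only [Complex.sub_re, Complex.one_re]
    linarith
  refine ⟨?_, ?_, fun θ _ => (Complex.norm_mul_exp_arg_mul_I _).symm⟩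
  · refine Continuous.continuousOn (continuous_iff_continuousAt.2 fun θ => ?_)
    exact ContinuousAt.comp (g := Complex.arg) (Complex.continuousAt_arg (Or.inl (hre θ)))
      (by fun_prop)
  · intro θ _ h0
    have := hre θ
    simp only [h0, Complex.zero_re, lt_self_iff_false] at this

lemma circlePt_two_pi : circlePt (2 * Real.pi) = circlePt 0 := by
  simp [circlePt]

/-- With `u` the point of the circle, `u - z` is `u (1 - z / u)` if `‖z‖ < 1` and `-z (1 - u / z)`
if `‖z‖ > 1`. The bracket has a periodic argument, so only the factor `u` contributes a turn. -/
lemma exists_arg_sub {z : ℂ} (hz : ‖z‖ ≠ 1) : ∃ b, IsContinuousArg (fun θ => circlePt θ - z) b ∧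
    b (2 * Real.pi) - b 0 = 2 * Real.pi * (if ‖z‖ < 1 then 1 else 0) := by
  have h0 : ∀ θ, circlePt θ ≠ 0 := fun θ => Complex.exp_ne_zero _
  split_ifs with hlt
  · have h1 := isContinuousArg_of_norm_lt (f := fun θ => z * (circlePt θ)⁻¹)
      (continuous_const.mul (continuous_circlePt.inv₀ h0))
      (fun θ => by rw [norm_mul, norm_inv, norm_circlePt, inv_one, mul_one]; exact hlt)
    have h2 := isContinuousArg_circlePt.mul h1
    have h3 : (fun θ => circlePt θ * (1 - z * (circlePt θ)⁻¹)) = fun θ => circlePt θ - z := by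
      funext θ
      have := h0 θ
      field_simp
    rw [h3] at h2
    refine ⟨_, h2, ?_⟩
    · simp only [circlePt_two_pi, id]
      ring
  · have hgt : 1 < ‖z‖ := lt_of_le_of_ne (not_lt.1 hlt) (Ne.symm hz)
    have hz0 : z ≠ 0 := by rintro rfl; simp at hgt; linarith
    have h1 := isContinuousArg_of_norm_lt (f := fun θ => circlePt θ * z⁻¹)
      (continuous_circlePt.mul continuous_const)
      (fun θ => by rw [norm_mul, norm_circlePt, one_mul, norm_inv]; exact inv_lt_one_of_one_lt₀ hgt)
    have h2 := (isContinuousArg_const (neg_ne_zero.2 hz0)).mul h1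
    have h3 : (fun θ => -z * (1 - circlePt θ * z⁻¹)) = fun θ => circlePt θ - z := by
      funext θ
      field_simp
      ring
    rw [h3] at h2
    refine ⟨_, h2, ?_⟩
    · simp only [circlePt_two_pi]
      ring

/-- The argument principle for a polynomial on the unit circle. -/
lemma exists_arg_eval {p : ℂ[X]} (hp : ∀ t : ℂ, ‖t‖ = 1 → p.eval t ≠ 0) :
    ∃ b, IsContinuousArg (fun θ => p.eval (circlePt θ)) b ∧
      b (2 * Real.pi) - b 0 = 2 * Real.pi * (Multiset.card (discRoots p) : ℕ) := by
  classical
  have hp0 : p ≠ 0 := by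
    rintro rfl
    exact hp 1 (by simp) eval_zero
  have key : ∀ A : Multiset ℂ, (∀ z ∈ A, ‖z‖ ≠ 1) →
      ∃ b, IsContinuousArg (fun θ => (A.map fun z => circlePt θ - z).prod) b ∧
        b (2 * Real.pi) - b 0 = 2 * Real.pi * (Multiset.card (A.filter fun z => ‖z‖ < 1) : ℕ) := by
    intro A
    induction A using Multiset.induction_on with
    | empty =>
      intro _
      exact ⟨_, by simpa using isContinuousArg_const one_ne_zero, by simp⟩
    | cons z A ih =>
      intro h
      obtain ⟨b, hb, hbi⟩ := ih fun w hw => h w (Multiset.mem_cons_of_mem hw)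
      obtain ⟨c, hc, hci⟩ := exists_arg_sub (h z (Multiset.mem_cons_self _ _))
      refine ⟨fun θ => c θ + b θ, ?_, ?_⟩
      · simp only [Multiset.map_cons, Multiset.prod_cons]
        exact hc.mul hb
      · have : c (2 * Real.pi) + b (2 * Real.pi) - (c 0 + b 0) =
            (c (2 * Real.pi) - c 0) + (b (2 * Real.pi) - b 0) := by ring
        rw [this, hbi, hci]
        by_cases hz : ‖z‖ < 1
        · rw [if_pos hz, Multiset.filter_cons_of_pos (p := fun z : ℂ => ‖z‖ < 1) _ hz, Multiset.card_cons]
          push_cast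
          ring
        · rw [if_neg hz, Multiset.filter_cons_of_neg (p := fun z : ℂ => ‖z‖ < 1) _ hz]
          ring
  obtain ⟨b, hb, hbi⟩ := key p.roots fun z hz h1 => hp z h1 ((mem_roots hp0).1 hz)
  have h2 := (isContinuousArg_const (leadingCoeff_ne_zero.2 hp0)).mul hb
  have h3 : (fun θ => p.leadingCoeff * (p.roots.map fun z => circlePt θ - z).prod) =
      fun θ => p.eval (circlePt θ) := by
    funext θ
    conv_rhs => rw [(IsAlgClosed.splits p).eq_prod_roots]
    rw [eval_mul, eval_C, eval_multiset_prod, Multiset.map_map]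
    simp
  rw [h3] at h2
  refine ⟨_, h2, ?_⟩
  · rw [add_sub_add_left_eq_sub, hbi, discRoots]

/-! ### The winding number -/

lemma continuous_value_circlePt {F : RatMatrix m} (hF : IsAnalytic F) :
    Continuous fun θ => value F (circlePt θ) := by
  have hd : ∀ θ, (den F).eval (circlePt θ) ≠ 0 := fun θ =>
    hF.den_eval_ne_zero (norm_circlePt θ).le
  have h : (fun θ => value F (circlePt θ)) = fun θ =>
      ((den F).eval (circlePt θ))⁻¹ • evalMat (circlePt θ) (num F) := by
    funext θ
    rw [evalMat_num F (hd θ), smul_smul, inv_mul_cancel₀ (hd θ), one_smul]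
  rw [h]
  refine Continuous.smul (((den F).continuous.comp continuous_circlePt).inv₀ hd) ?_
  refine continuous_matrix fun i k => ?_
  exact (num F i k).continuous.comp continuous_circlePt

lemma exists_eigenvalueBranches {F : RatMatrix m} (hF : IsAnalytic F) :
    ∃ ζ, IsEigenvalueBranches F ζ := by
  obtain ⟨ζ, h1, h2⟩ := MultisetContinuousOn.hasBranches m
    (fun θ => (value F (circlePt θ)).charpoly.roots) (Set.Icc 0 (2 * Real.pi)) inferInstance
    (multisetContinuousOn_roots_charpoly (continuous_value_circlePt hF).continuousOn)
    (fun t _ => by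
      rw [← (IsAlgClosed.splits _).natDegree_eq_card_roots, Matrix.charpoly_natDegree_eq_dim,
        Fintype.card_fin])
  exact ⟨ζ, h1, h2⟩

lemma IsEigenvalueBranches.prod_eq {F : RatMatrix m} {ζ : Fin m → ℝ → ℂ}
    (h : IsEigenvalueBranches F ζ) (lam : ℂ) {θ : ℝ} (hθ : θ ∈ Set.Icc (0 : ℝ) (2 * Real.pi)) :
    ∏ j, (ζ j θ - lam) = (value F (circlePt θ) - lam • (1 : Matrix (Fin m) (Fin m) ℂ)).det := by
  have h1 := congrArg (eval lam) ((IsAlgClosed.splits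
    (value F (circlePt θ)).charpoly).eq_prod_roots_of_monic (Matrix.charpoly_monic _))
  rw [h.eigenvalues θ hθ, Multiset.map_map, eval_multiset_prod, Multiset.map_map,
    Matrix.eval_charpoly] at h1
  have h2 : ∏ j, (ζ j θ - lam) = (-1) ^ m * ∏ j, (lam - ζ j θ) := by
    have : ∀ j, ζ j θ - lam = -1 * (lam - ζ j θ) := fun j => by ring
    simp only [this, Finset.prod_mul_distrib, Finset.prod_const, Finset.card_univ,
      Fintype.card_fin]
  have h3 : ∏ j, (lam - ζ j θ) = (Matrix.scalar (Fin m) lam - value F (circlePt θ)).det := by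
    rw [h1]
    simp [Finset.prod_eq_multiset_prod]
  rw [h2, h3, ← neg_sub (value F (circlePt θ)) , Matrix.det_neg, Fintype.card_fin, ← mul_assoc,
    ← mul_pow]
  simp [Matrix.smul_one_eq_diagonal]

/-- The determinant of `shiftNum F lam` is `(den F) ^ m` times the product of the `ζ j - lam`, and
`den F` has increment zero. One direction gives independence of the branches and arguments, the
other their existence. -/
lemma isWindingNumber_iff {F : RatMatrix m} (hF : IsAnalytic F) {lam : ℂ}
    (hlam : lam ∉ gammaSet F) (x : ℝ) : IsWindingNumber F lam x ↔
      x = (Multiset.card (discRoots (shiftNum F lam).det) : ℕ) := by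
  obtain ⟨b, hb, hbi⟩ := exists_arg_eval (p := (shiftNum F lam).det)
    fun t ht => det_shiftNum_eval_ne_zero hF hlam ht
  obtain ⟨d, hd, hdi⟩ := exists_arg_eval (p := den F) fun t ht => hF.den_eval_ne_zero ht.le
  have hden : discRoots (den F) = 0 := by
    classical
    rw [discRoots, Multiset.filter_eq_nil]
    intro z hz hz1
    exact hF.den_eval_ne_zero hz1.le ((mem_roots (den_ne_zero F)).1 hz)
  have hdet : ∀ θ, (shiftNum F lam).det.eval (circlePt θ) = (den F).eval (circlePt θ) ^ m *
      (value F (circlePt θ) - lam • (1 : Matrix (Fin m) (Fin m) ℂ)).det := by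
    intro θ
    rw [eval_det, evalMat_shiftNum_of_ne F lam (hF.den_eval_ne_zero (norm_circlePt θ).le),
      Matrix.det_smul, Fintype.card_fin]
  have key : ∀ (ζ : Fin m → ℝ → ℂ) (a : Fin m → ℝ → ℝ), IsEigenvalueBranches F ζ →
      (∀ j, IsContinuousArg (fun θ => ζ j θ - lam) (a j)) →
      1 / (2 * Real.pi) * ∑ j, (a j (2 * Real.pi) - a j 0) =
        (Multiset.card (discRoots (shiftNum F lam).det) : ℕ) := by
    intro ζ a hζ ha
    have h1 := (isContinuousArg_prod (Finset.range m) fun _ _ => hd).mul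
      (isContinuousArg_prod Finset.univ fun j _ => ha j)
    have h2 : IsContinuousArg (fun θ => (shiftNum F lam).det.eval (circlePt θ))
        (fun θ => ∑ _i ∈ Finset.range m, d θ + ∑ j, a j θ) := by
      have heq : ∀ θ ∈ Set.Icc (0 : ℝ) (2 * Real.pi), (shiftNum F lam).det.eval (circlePt θ) =
          (∏ _i ∈ Finset.range m, (den F).eval (circlePt θ)) * ∏ j, (ζ j θ - lam) := by
        intro θ hθ
        rw [hdet, hζ.prod_eq lam hθ, Finset.prod_const, Finset.card_range]
      refine ⟨h1.continuousOn, fun θ hθ => ?_, fun θ hθ => ?_⟩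
      · rw [heq θ hθ]
        exact h1.ne_zero θ hθ
      · rw [heq θ hθ]
        exact h1.arg_eq θ hθ
    have h3 := h2.increment_eq hb
    rw [hbi] at h3
    rw [hden, Multiset.card_zero, Nat.cast_zero, mul_zero, sub_eq_zero] at hdi
    rw [hdi, add_sub_add_left_eq_sub, ← Finset.sum_sub_distrib] at h3
    rw [h3]
    field_simp
  constructor
  · rintro ⟨ζ, a, hζ, ha, rfl⟩
    exact key ζ a hζ ha
  · rintro rfl
    obtain ⟨ζ, hζ⟩ := exists_eigenvalueBranches hF
    have hne : ∀ j, ∀ θ ∈ Set.Icc (0 : ℝ) (2 * Real.pi), ζ j θ - lam ≠ 0 := by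
      intro j θ hθ h0
      have h1 := hdet θ
      rw [← hζ.prod_eq lam hθ, Finset.prod_eq_zero (Finset.mem_univ j) h0, mul_zero] at h1
      exact det_shiftNum_eval_ne_zero hF hlam (norm_circlePt θ) h1
    choose a ha using fun j => exists_continuousArg
      ((hζ.continuousOn j).sub continuousOn_const) (hne j)
    exact ⟨ζ, a, hζ, ha, (key ζ a hζ ha).symm⟩

end NormalSymbol
end

/-! ### The integral closure of `ℂ[t]` in a finite extension of `ℂ(t)`, and valuation rings over
Dedekind domains. -/

noncomputable section

namespace NormalSymbol

open Polynomial IsDedekindDomain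

section Places

variable (K : Type) [Field K] [Algebra ℂ[X] K] [Algebra (RatFunc ℂ) K]
  [IsScalarTower ℂ[X] (RatFunc ℂ) K]

/-- The functions that are integral over `ℂ[t]`. -/
abbrev IntFun : Type := integralClosure ℂ[X] K

section

include K

lemma faithfulSMul_polynomial : FaithfulSMul ℂ[X] K :=
  have := FaithfulSMul.trans ℂ[X] (RatFunc ℂ) K
  this

end

instance : Module.IsTorsionFree ℂ[X] (IntFun K) := by
  have := faithfulSMul_polynomial K
  infer_instance

variable [FiniteDimensional (RatFunc ℂ) K]

instance : Module.Finite ℂ[X] (IntFun K) :=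
  IsIntegralClosure.finite ℂ[X] (RatFunc ℂ) K (integralClosure ℂ[X] K)

instance : IsDedekindDomain (IntFun K) := integralClosure.isDedekindDomain ℂ[X] (RatFunc ℂ) K

instance : IsFractionRing (IntFun K) K :=
  integralClosure.isFractionRing_of_finite_extension (RatFunc ℂ) K

end Places

/-! ### Valuation rings attached to primes of a Dedekind domain -/

section Dedekind

variable {R : Type*} [CommRing R] [IsDedekindDomain R] {K : Type*} [Field K] [Algebra R K]
  [IsFractionRing R K]

lemma ne_top_of_isDiscreteValuationRing {K : Type*} [Field K] (V : ValuationSubring K)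
    [IsDiscreteValuationRing V] : V ≠ ⊤ := by
  rintro rfl
  obtain ⟨ϖ, hϖ⟩ := IsDiscreteValuationRing.exists_irreducible (⊤ : ValuationSubring K)
  refine hϖ.not_isUnit ?_
  have h0 : (ϖ : K) ≠ 0 := by
    intro h
    exact hϖ.ne_zero (Subtype.ext h)
  exact IsUnit.of_mul_eq_one ⟨(ϖ : K)⁻¹, ValuationSubring.mem_top _⟩
    (Subtype.ext (mul_inv_cancel₀ h0))

/-- A nontrivial valuation ring of `K` containing a Dedekind domain with field of fractions `K`
comes from a maximal ideal of the domain. -/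
lemma exists_heightOneSpectrum (V : ValuationSubring K) (hVtop : V ≠ ⊤)
    (hV : ∀ r : R, algebraMap R K r ∈ V) :
    ∃ v : HeightOneSpectrum R, (v.valuation K).valuationSubring = V := by
  let i : R →+* V := (algebraMap R K).codRestrict V.toSubring hV
  let q : Ideal R := (IsLocalRing.maximalIdeal V).comap i
  have hq : q.IsPrime := Ideal.IsPrime.comap i
  have hunit : ∀ r : R, r ∉ q → (algebraMap R K r)⁻¹ ∈ V := by
    intro r hr
    have hu : IsUnit (i r) := by
      by_contra h
      exact hr ((IsLocalRing.mem_maximalIdeal _).2 h)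
    obtain ⟨u, hu⟩ := hu
    have h1 : ((u : V) : K) * ((u⁻¹ : Vˣ) : V) = 1 := by
      rw [← MulMemClass.coe_mul]; simp
    have h2 : ((u : V) : K) = algebraMap R K r := by rw [hu]; rfl
    rw [h2] at h1
    rw [← eq_inv_of_mul_eq_one_right h1]
    exact ((u⁻¹ : Vˣ) : V).2
  have hq0 : q ≠ ⊥ := by
    intro hq0
    apply hVtop
    rw [eq_top_iff]
    intro x _
    obtain ⟨a, b, hb, rfl⟩ := IsFractionRing.div_surjective (A := R) x
    rw [div_eq_mul_inv]
    refine mul_mem (hV a) (hunit b ?_)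
    rw [hq0, Ideal.mem_bot]
    exact nonZeroDivisors.ne_zero hb
  refine ⟨⟨q, hq, hq0⟩, ?_⟩
  rw [← HeightOneSpectrum.valuationSubringAtPrime_eq_valuationSubring]
  -- The valuation ring of a height one prime is discrete, hence maximal among proper valuation
  -- rings of `K`, so its inclusion in `V` is enough.
  refine ValuationSubring.eq_of_le_of_ne_top _ ?_ hVtop
  rw [HeightOneSpectrum.valuationSubringAtPrime_eq_valuationSubring]
  intro x hx
  obtain ⟨n, d, hd⟩ := HeightOneSpectrum.exists_primeCompl_mul_eq_of_integer
    (v := (⟨q, hq, hq0⟩ : HeightOneSpectrum R)) x hx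
  have hd0 : algebraMap R K d ≠ 0 := by
    intro h
    have : (d : R) = 0 := (IsFractionRing.injective R K) (by rw [h, map_zero])
    exact d.2 (by rw [this]; exact q.zero_mem)
  have hx : x = algebraMap R K n * (algebraMap R K d)⁻¹ := by
    rw [← hd, mul_assoc, mul_inv_cancel₀ hd0, mul_one]
  rw [hx]
  exact mul_mem (hV n) (hunit d d.2)

lemma valuationSubring_heightOneSpectrum_injective {v w : HeightOneSpectrum R}
    (h : (v.valuation K).valuationSubring = (w.valuation K).valuationSubring) : v = w :=
  HeightOneSpectrum.eq_of_valuation_isEquiv_valuation (K := K)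
    (Valuation.isEquiv_iff_valuationSubring _ _ |>.2 h)

lemma isDiscreteValuationRing_heightOneSpectrum (v : HeightOneSpectrum R) :
    IsDiscreteValuationRing (v.valuation K).valuationSubring := by
  rw [← HeightOneSpectrum.valuationSubringAtPrime_eq_valuationSubring]
  exact IsLocalization.AtPrime.isDiscreteValuationRing_of_dedekind_domain R v.ne_bot
    (HeightOneSpectrum.valuationSubringAtPrime K v)

/-- The order in the valuation ring is the exponent of the valuation. -/
lemma addVal_eq_of_valuation_eq (v : HeightOneSpectrum R)
    [IsDiscreteValuationRing (v.valuation K).valuationSubring]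
    (f : (v.valuation K).valuationSubring) (n : ℕ)
    (hf : v.valuation K f = WithZero.exp (-(n : ℤ))) :
    IsDiscreteValuationRing.addVal _ f = n := by
  obtain ⟨π, hπ⟩ := v.valuation_exists_uniformizer K
  have hπ0 : π ≠ 0 := by
    rintro rfl
    rw [map_zero] at hπ
    exact WithZero.exp_ne_zero hπ.symm
  have hunit : ∀ x : (v.valuation K).valuationSubring, IsUnit x ↔ v.valuation K x = 1 := by
    intro x
    exact Valuation.Integers.isUnit_iff_valuation_eq_one
      (Valuation.valuationSubring.integers (v.valuation K))
  let ϖ : (v.valuation K).valuationSubring := ⟨π, by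
    rw [Valuation.mem_valuationSubring_iff, hπ, ← WithZero.exp_zero, WithZero.exp_le_exp]
    norm_num⟩
  have hval : ∀ x : (v.valuation K).valuationSubring, x ≠ 0 → ¬ IsUnit x →
      v.valuation K x ≤ WithZero.exp (-1) := by
    intro x hx hxu
    have h1 : v.valuation K x < 1 := lt_of_le_of_ne x.2 fun h => hxu ((hunit x).2 h)
    rw [← WithZero.lt_mul_exp_iff_le WithZero.exp_ne_zero, ← WithZero.exp_add]
    simpa using h1
  have hirr : Irreducible ϖ := by
    refine ⟨fun h => ?_, fun {a b} hab => ?_⟩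
    · have := (hunit ϖ).1 h
      change v.valuation K π = 1 at this
      rw [hπ, ← WithZero.exp_zero, WithZero.exp_inj] at this
      norm_num at this
    · by_contra! hcon
      have hab' : π = (a : K) * b := congrArg Subtype.val hab
      have ha : a ≠ 0 := by rintro rfl; simp at hab'; exact hπ0 hab'
      have hb : b ≠ 0 := by rintro rfl; simp at hab'; exact hπ0 hab'
      have := mul_le_mul' (hval a ha hcon.1) (hval b hb hcon.2)
      rw [← map_mul, ← hab', hπ, ← WithZero.exp_add, WithZero.exp_le_exp] at this
      norm_num at this
  have hpow : v.valuation K (π ^ n) = WithZero.exp (-(n : ℤ)) := by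
    rw [map_pow, hπ, ← WithZero.exp_nsmul]
    simp
  have hu : v.valuation K ((f : K) / π ^ n) = 1 := by
    rw [map_div₀, hf, hpow, div_self WithZero.exp_ne_zero]
  have huu : IsUnit (⟨(f : K) / π ^ n, le_of_eq hu⟩ : (v.valuation K).valuationSubring) :=
    (hunit _).2 hu
  obtain ⟨u, hu'⟩ := huu
  refine IsDiscreteValuationRing.addVal_def f u hirr n (Subtype.ext ?_)
  rw [hu']
  change (f : K) = (f : K) / π ^ n * π ^ n
  rw [div_mul_cancel₀ _ (pow_ne_zero n hπ0)]

open UniqueFactorizationMonoid in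
lemma valuation_eq_exp_count [DecidableEq (Ideal R)] (v : HeightOneSpectrum R) {r : R}
    (hr : r ≠ 0) :
    v.valuation K (algebraMap R K r) =
      WithZero.exp (-((normalizedFactors (Ideal.span {r})).count v.asIdeal : ℤ)) := by
  have h0 : Ideal.span {r} ≠ ⊥ := by rwa [ne_eq, Ideal.span_singleton_eq_bot]
  rw [HeightOneSpectrum.valuation_of_algebraMap,
    HeightOneSpectrum.intValuation_eq_exp_neg_multiplicity _ hr]
  congr 3
  have := emultiplicity_eq_count_normalizedFactors (R := Ideal R) v.irreducible h0
  rw [normalize_eq] at this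
  exact multiplicity_eq_of_emultiplicity_eq_some this

end Dedekind

end NormalSymbol

end

/-! ### Centres of primes and the zeros of a norm. -/

noncomputable section

namespace NormalSymbol

open Polynomial IsDedekindDomain

section Places

variable {K : Type} [Field K] [Algebra ℂ[X] K]

lemma isUnit_algebraMap_C (c : ℂ) (hc : c ≠ 0) :
    IsUnit (algebraMap ℂ[X] (IntFun K) (C c)) :=
  ((isUnit_C.2 hc.isUnit).map _)

/-- By integrality a nonzero prime contains a nonzero polynomial in `t`, which splits into linear
factors over `ℂ`. -/
lemma exists_X_sub_C_mem (P : Ideal (IntFun K)) [P.IsPrime] (hP : P ≠ ⊥) :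
    ∃ c : ℂ, algebraMap ℂ[X] (IntFun K) (X - C c) ∈ P := by
  have h0 : P.comap (algebraMap ℂ[X] (IntFun K)) ≠ ⊥ := by
    obtain ⟨x, hx, hx0⟩ := Submodule.exists_mem_ne_zero_of_ne_bot hP
    exact Ideal.comap_ne_bot_of_integral_mem hx0 hx (Algebra.IsIntegral.isIntegral x)
  obtain ⟨g, hg, hg0⟩ := Submodule.exists_mem_ne_zero_of_ne_bot h0
  have hsp := (IsAlgClosed.splits g).eq_prod_roots
  have hg' : algebraMap ℂ[X] (IntFun K) (C g.leadingCoeff) *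
      ((g.roots.map fun a => X - C a).map (algebraMap ℂ[X] (IntFun K))).prod ∈ P := by
    rw [Multiset.prod_hom, ← map_mul, ← hsp]
    exact hg
  rcases Ideal.IsPrime.mem_or_mem ‹_› hg' with h | h
  · exact absurd (P.eq_top_of_isUnit_mem h (isUnit_algebraMap_C _ (leadingCoeff_ne_zero.2 hg0)))
      Ideal.IsPrime.ne_top'
  · rw [Ideal.IsPrime.multiset_prod_mem_iff_exists_mem ‹_›] at h
    obtain ⟨p, hp, hpP⟩ := h
    simp only [Multiset.mem_map, exists_exists_and_eq_and] at hp
    obtain ⟨a, -, rfl⟩ := hp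
    exact ⟨a, hpP⟩

open Classical in
/-- The value of `t` at a prime of the ring of functions integral over `ℂ[t]`. -/
def centre (P : Ideal (IntFun K)) : ℂ :=
  if h : ∃ c : ℂ, algebraMap ℂ[X] (IntFun K) (X - C c) ∈ P then h.choose else 0

lemma X_sub_C_centre_mem (P : Ideal (IntFun K)) [P.IsPrime] (hP : P ≠ ⊥) :
    algebraMap ℂ[X] (IntFun K) (X - C (centre P)) ∈ P := by
  have h := exists_X_sub_C_mem P hP
  rw [centre, dif_pos h]
  exact h.choose_spec

lemma algebraMap_mem_iff_eval (P : Ideal (IntFun K)) [hPp : P.IsPrime] {c : ℂ}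
    (hc : algebraMap ℂ[X] (IntFun K) (X - C c) ∈ P) (p : ℂ[X]) :
    algebraMap ℂ[X] (IntFun K) p ∈ P ↔ p.eval c = 0 := by
  have key : algebraMap ℂ[X] (IntFun K) (p - C (p.eval c)) ∈ P := by
    obtain ⟨q, hq⟩ := X_sub_C_dvd_sub_C_eval (a := c) (p := p)
    rw [hq, map_mul]
    exact P.mul_mem_right _ hc
  constructor
  · intro h
    by_contra h0
    have : algebraMap ℂ[X] (IntFun K) (C (p.eval c)) ∈ P := by
      have := P.sub_mem h key
      rwa [← map_sub, sub_sub_cancel] at this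
    exact hPp.ne_top (P.eq_top_of_isUnit_mem this (isUnit_algebraMap_C _ h0))
  · intro h
    rwa [h, C_0, sub_zero] at key

lemma centre_eq (P : Ideal (IntFun K)) [P.IsPrime] (hP : P ≠ ⊥) {c : ℂ}
    (hc : algebraMap ℂ[X] (IntFun K) (X - C c) ∈ P) : centre P = c := by
  have := (algebraMap_mem_iff_eval P hc _).1 (X_sub_C_centre_mem P hP)
  simpa [sub_eq_zero, eq_comm] using this

variable [Algebra (RatFunc ℂ) K] [IsScalarTower ℂ[X] (RatFunc ℂ) K]
  [FiniteDimensional (RatFunc ℂ) K]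

/-- The inertia degree is one: the residue field of `P` is integral over that of `ℂ[t]` at the
centre, which is the algebraically closed field `ℂ`. -/
lemma relNorm_eq (P : Ideal (IntFun K)) [P.IsPrime] (hP : P ≠ ⊥) :
    Ideal.relNorm ℂ[X] P = Ideal.span {X - C (centre P)} := by
  have hPmax : P.IsMaximal := Ring.DimensionLEOne.maximalOfPrime hP ‹_›
  let p : Ideal ℂ[X] := Ideal.span {X - C (centre P)}
  have hp : p.IsMaximal :=
    PrincipalIdealRing.isMaximal_of_irreducible (irreducible_X_sub_C _)
  have hover : P.LiesOver p := by
    refine ⟨hp.eq_of_le (Ideal.IsPrime.ne_top inferInstance) ?_⟩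
    rw [Ideal.span_singleton_le_iff_mem]
    exact X_sub_C_centre_mem P hP
  rw [Ideal.relNorm_eq_pow_of_isMaximal P p, Ideal.inertiaDeg_eq_of_isMaximal p P]
  let _ : Field (ℂ[X] ⧸ p) := Ideal.Quotient.field p
  let e : ℂ[X] ⧸ p ≃+* ℂ :=
    (Polynomial.quotientSpanXSubCAlgEquiv (centre P)).toRingEquiv
  have : IsAlgClosed (ℂ[X] ⧸ p) := IsAlgClosed.of_ringEquiv ℂ _ e.symm
  have hbij : Function.Bijective (algebraMap (ℂ[X] ⧸ p) (IntFun K ⧸ P)) :=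
    IsAlgClosed.algebraMap_bijective_of_isIntegral
  have hf : Module.finrank (ℂ[X] ⧸ p) (IntFun K ⧸ P) = 1 := by
    rw [← (LinearEquiv.ofBijective (Algebra.linearMap (ℂ[X] ⧸ p) (IntFun K ⧸ P)) hbij).finrank_eq]
    exact Module.finrank_self _
  rw [hf, pow_one]

open UniqueFactorizationMonoid in
-- The ideal norm is multiplicative, and each prime factor `P` of `f` contributes `X - centre P`.
-- This turns the count of zeros on the Riemann surface into a count of roots of a polynomial.
lemma roots_intNorm (f : IntFun K) (hf : f ≠ 0) :
    (Algebra.intNorm ℂ[X] (IntFun K) f).roots =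
      (normalizedFactors (Ideal.span {f})).map centre := by
  have h0 : Ideal.span {f} ≠ ⊥ := by rwa [ne_eq, Ideal.span_singleton_eq_bot]
  have h1 : Ideal.span {Algebra.intNorm ℂ[X] (IntFun K) f} =
      Ideal.span {(((normalizedFactors (Ideal.span {f})).map centre).map fun a => X - C a).prod} := by
    rw [← Ideal.relNorm_singleton]
    conv_lhs => rw [← Ideal.prod_normalizedFactors_eq_self h0]
    rw [map_multiset_prod, ← Ideal.multiset_prod_span_singleton, Multiset.map_map,
      Multiset.map_map]
    congr 1
    refine Multiset.map_congr rfl fun P hP => ?_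
    have hPp := prime_of_normalized_factor P hP
    have := Ideal.isPrime_of_prime hPp
    exact relNorm_eq P hPp.ne_zero
  rw [Ideal.span_singleton_eq_span_singleton] at h1
  obtain ⟨u, hu⟩ := h1.symm
  rw [← hu, mul_comm]
  obtain ⟨r, hr, hr'⟩ := Polynomial.isUnit_iff.1 u.isUnit
  rw [← hr', roots_C_mul _ hr.ne_zero, roots_multiset_prod_X_sub_C]

end Places

end NormalSymbol

end

/-! ### Places over the open disc and the orders of zeros there. -/

noncomputable section

namespace NormalSymbol

open Polynomial IsDedekindDomain

lemma mem_of_valuation_sub_lt {K : Type*} [Field K] [Algebra ℂ K]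
    (V : ValuationSubring K) (hV : ∀ c : ℂ, algebraMap ℂ K c ∈ V)
    {f : K} {c : ℂ} (hf : V.valuation (f - algebraMap ℂ K c) < 1) : f ∈ V := by
  have h1 : f - algebraMap ℂ K c ∈ V := (V.valuation_le_one_iff _).1 hf.le
  simpa using add_mem h1 (hV c)

lemma valuation_algebraMap_eq_one {K : Type} [Field K] [Algebra ℂ[X] K] [Algebra (RatFunc ℂ) K]
    [IsScalarTower ℂ[X] (RatFunc ℂ) K] [FiniteDimensional (RatFunc ℂ) K]
    {v : HeightOneSpectrum (IntFun K)} {c : ℂ}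
    (hc : algebraMap ℂ[X] (IntFun K) (X - C c) ∈ v.asIdeal) {d : ℂ[X]} (hd : d.eval c ≠ 0) :
    v.valuation K (algebraMap ℂ[X] K d) = 1 := by
  rw [IsScalarTower.algebraMap_apply ℂ[X] (IntFun K) K, HeightOneSpectrum.valuation_eq_one_iff_notMem]
  rwa [algebraMap_mem_iff_eval _ hc]

/-- The norm is the determinant of multiplication by `a - y`, that is, the characteristic polynomial
of `y` at `a`; for a generator `y` this is the minimal polynomial. -/
lemma norm_algebraMap_sub_gen {K : Type} [Field K] [Algebra ℂ[X] K] [Algebra (RatFunc ℂ) K]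
    [IsScalarTower ℂ[X] (RatFunc ℂ) K] (B : PowerBasis (RatFunc ℂ) K) {μ : ℂ[X][X]}
    (hB : minpoly (RatFunc ℂ) B.gen = μ.map (algebraMap ℂ[X] (RatFunc ℂ))) (a : ℂ[X]) :
    Algebra.norm (RatFunc ℂ) (algebraMap ℂ[X] K a - B.gen) =
      algebraMap ℂ[X] (RatFunc ℂ) (μ.eval a) := by
  rw [Algebra.norm_eq_matrix_det B.basis, map_sub, IsScalarTower.algebraMap_apply ℂ[X] (RatFunc ℂ) K,
    AlgHom.commutes, Algebra.algebraMap_eq_smul_one, Matrix.smul_one_eq_diagonal, ← Matrix.scalar_apply]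
  rw [← Matrix.eval_charpoly, charpoly_leftMulMatrix, hB, eval_map_algebraMap, aeval_algebraMap_apply]
  rfl

section Places

variable {K : Type} [Field K] [Algebra ℂ K] [Algebra ℂ[X] K] [IsScalarTower ℂ ℂ[X] K]

lemma algebraMap_polynomial_mem (V : ValuationSubring K) (hV : ∀ c : ℂ, algebraMap ℂ K c ∈ V)
    (ht : algebraMap ℂ[X] K X ∈ V) (p : ℂ[X]) : algebraMap ℂ[X] K p ∈ V := by
  induction p using Polynomial.induction_on' with
  | add p q hp hq => rw [map_add]; exact add_mem hp hq
  | monomial n a =>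
    rw [← C_mul_X_pow_eq_monomial, map_mul, map_pow]
    refine mul_mem ?_ (pow_mem ht n)
    have := hV a
    rwa [IsScalarTower.algebraMap_apply ℂ ℂ[X] K] at this

lemma intFun_mem (V : ValuationSubring K) (hV : ∀ c : ℂ, algebraMap ℂ K c ∈ V)
    (ht : algebraMap ℂ[X] K X ∈ V) (r : IntFun K) : (r : K) ∈ V := by
  obtain ⟨p, hp, hp0⟩ := r.2
  let i : ℂ[X] →+* V := (algebraMap ℂ[X] K).codRestrict V.toSubring
    (algebraMap_polynomial_mem V hV ht)
  have hr : IsIntegral V (r : K) := by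
    refine ⟨p.map i, hp.map i, ?_⟩
    rw [eval₂_map]
    exact hp0
  obtain ⟨y, hy⟩ := IsIntegrallyClosed.isIntegral_iff.1 hr
  rw [← hy]
  exact y.2

lemma valuation_lt_one_iff_mem_nonunits {K : Type*} [Field K] {Γ : Type*}
    [LinearOrderedCommGroupWithZero Γ] (v : Valuation K Γ) (x : K) :
    v.valuationSubring.valuation x < 1 ↔ v x < 1 :=
  (Valuation.isEquiv_valuation_valuationSubring v).symm.lt_one_iff_lt_one

/-- The valuation ring `V` is a point at which `t` has the value `c`. -/
structure IsPlaceAt (V : ValuationSubring K) (c : ℂ) : Prop where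
  const_mem : ∀ a : ℂ, algebraMap ℂ K a ∈ V
  dvr : IsDiscreteValuationRing V
  value : V.valuation (algebraMap ℂ[X] K X - algebraMap ℂ K c) < 1

variable [Algebra (RatFunc ℂ) K] [IsScalarTower ℂ[X] (RatFunc ℂ) K]
  [FiniteDimensional (RatFunc ℂ) K]

/-- Where `t` is finite, `V` contains `IntFun K`, because valuation rings are integrally closed, and
so comes from one of its primes. `isPlaceAt_of_mem` is the converse. -/
lemma IsPlaceAt.exists_prime {V : ValuationSubring K} {c : ℂ} (hV : IsPlaceAt V c) :
    ∃ v : HeightOneSpectrum (IntFun K), (v.valuation K).valuationSubring = V ∧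
      algebraMap ℂ[X] (IntFun K) (X - C c) ∈ v.asIdeal := by
  have ht := mem_of_valuation_sub_lt V hV.const_mem hV.value
  have := hV.dvr
  obtain ⟨v, rfl⟩ := exists_heightOneSpectrum (R := IntFun K) V
    (ne_top_of_isDiscreteValuationRing V) (intFun_mem V hV.const_mem ht)
  refine ⟨v, rfl, ?_⟩
  rw [← HeightOneSpectrum.valuation_lt_one_iff_mem (K := K)]
  change v.valuation K (algebraMap ℂ[X] K (X - C c)) < 1
  rw [← valuation_lt_one_iff_mem_nonunits, map_sub]
  have h := hV.value
  rwa [IsScalarTower.algebraMap_apply ℂ ℂ[X] K] at h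

lemma isPlaceAt_of_mem {v : HeightOneSpectrum (IntFun K)} {c : ℂ}
    (hc : algebraMap ℂ[X] (IntFun K) (X - C c) ∈ v.asIdeal) :
    IsPlaceAt (v.valuation K).valuationSubring c := by
  refine ⟨fun a => ?_, isDiscreteValuationRing_heightOneSpectrum v, ?_⟩
  · rw [IsScalarTower.algebraMap_apply ℂ ℂ[X] K, IsScalarTower.algebraMap_apply ℂ[X] (IntFun K) K]
    exact v.valuation_le_one _
  · rw [← HeightOneSpectrum.valuation_lt_one_iff_mem (K := K)] at hc
    change v.valuation K (algebraMap ℂ[X] K (X - C c)) < 1 at hc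
    rw [← valuation_lt_one_iff_mem_nonunits, map_sub] at hc
    rwa [IsScalarTower.algebraMap_apply ℂ ℂ[X] K]

/-- `d` is a unit at a place where it does not vanish. With `d = den F` this shows that `z` has no
pole over the closed disc. -/
lemma IsPlaceAt.mem_of_mul_isIntegral {V : ValuationSubring K} {c : ℂ} (hV : IsPlaceAt V c)
    {d : ℂ[X]} (hd : d.eval c ≠ 0) {z : K} (hz : IsIntegral ℂ[X] (algebraMap ℂ[X] K d * z)) :
    z ∈ V := by
  obtain ⟨v, rfl, hc⟩ := hV.exists_prime
  have h1 : v.valuation K (algebraMap ℂ[X] K d * z) ≤ 1 :=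
    v.valuation_le_one (⟨_, hz⟩ : IntFun K)
  rwa [map_mul, valuation_algebraMap_eq_one hc hd, one_mul] at h1

open Classical in
/-- The order of `f` in a discrete valuation ring, `0` if `f` is not in the ring. -/
def ringOrder (V : ValuationSubring K) (hV : IsDiscreteValuationRing V) (f : K) : ℕ∞ :=
  if h : f ∈ V then IsDiscreteValuationRing.addVal V ⟨f, h⟩ else 0

open UniqueFactorizationMonoid in
open Classical in
/-- The zeros of `z - lam` in the disc `|t| < 1`, counted with their orders, correspond to the
zeros of the norm of `lam * d - d * z`. -/
theorem tsum_ringOrder_eq (B : PowerBasis (RatFunc ℂ) K) {μ : ℂ[X][X]} (hμ : μ.Monic)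
    (hB : minpoly (RatFunc ℂ) B.gen = μ.map (algebraMap ℂ[X] (RatFunc ℂ)))
    {d : ℂ[X]} (hd : ∀ c : ℂ, ‖c‖ < 1 → d.eval c ≠ 0) {z : K}
    (hz : algebraMap ℂ[X] K d * z = B.gen) {lam : ℂ} (hlam : μ.eval (C lam * d) ≠ 0) :
    Finite {V : ValuationSubring K // (∃ c : ℂ, ‖c‖ < 1 ∧ IsPlaceAt V c) ∧
        V.valuation (z - algebraMap ℂ K lam) < 1} ∧
    ∑' V : {V : ValuationSubring K // (∃ c : ℂ, ‖c‖ < 1 ∧ IsPlaceAt V c) ∧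
        V.valuation (z - algebraMap ℂ K lam) < 1},
      ringOrder V.1 V.2.1.choose_spec.2.dvr (z - algebraMap ℂ K lam) =
    (Multiset.card (discRoots (μ.eval (C lam * d))) : ℕ∞) := by
  have hint : IsIntegral ℂ[X] (algebraMap ℂ[X] K (C lam * d) - B.gen) := by
    refine IsIntegral.sub isIntegral_algebraMap ⟨μ, hμ, ?_⟩
    have h := minpoly.aeval (RatFunc ℂ) B.gen
    rwa [hB, aeval_map_algebraMap] at h
  -- `f` is `-d (z - lam)`. Since `d` is a unit over the open disc, `f` and `z - lam` have the same
  -- order at every place there, while `f` is integral and has a norm in `ℂ[X]`.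
  let f : IntFun K := ⟨_, hint⟩
  have hfz : algebraMap (IntFun K) K f = -(algebraMap ℂ[X] K d * (z - algebraMap ℂ K lam)) := by
    change algebraMap ℂ[X] K (C lam * d) - B.gen = _
    rw [← hz, map_mul, IsScalarTower.algebraMap_apply ℂ ℂ[X] K]
    simp only [algebraMap_eq]
    ring
  have hnorm : Algebra.intNorm ℂ[X] (IntFun K) f = μ.eval (C lam * d) := by
    apply IsFractionRing.injective ℂ[X] (RatFunc ℂ)
    rw [Algebra.algebraMap_intNorm (L := K)]
    exact norm_algebraMap_sub_gen B hB _
  have hf0 : f ≠ 0 := by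
    intro h
    rw [h, Algebra.intNorm_zero] at hnorm
    exact hlam hnorm.symm
  have hval : ∀ (v : HeightOneSpectrum (IntFun K)) (c : ℂ), ‖c‖ < 1 →
      algebraMap ℂ[X] (IntFun K) (X - C c) ∈ v.asIdeal →
      v.valuation K (z - algebraMap ℂ K lam) = v.valuation K (algebraMap (IntFun K) K f) := by
    intro v c hc hv
    rw [hfz, Valuation.map_neg, map_mul, valuation_algebraMap_eq_one hv (hd c hc), one_mul]
  -- The distinct members of `s` are the places to be counted, and their multiplicities in `s` are
  -- the orders of the zeros.
  set s : Multiset (Ideal (IntFun K)) :=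
    (normalizedFactors (Ideal.span {f})).filter fun P => ‖centre P‖ < 1 with hs
  have hprime : ∀ P ∈ s, P.IsPrime ∧ P ≠ ⊥ := by
    intro P hP
    have := prime_of_normalized_factor P (Multiset.mem_filter.1 hP).1
    exact ⟨Ideal.isPrime_of_prime this, this.ne_zero⟩
  have hmem : ∀ v : HeightOneSpectrum (IntFun K), v.asIdeal ∈ s ↔
      ‖centre v.asIdeal‖ < 1 ∧ f ∈ v.asIdeal := by
    intro v
    have h0 : Ideal.span {f} ≠ ⊥ := by rwa [ne_eq, Ideal.span_singleton_eq_bot]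
    rw [hs, Multiset.mem_filter, and_comm, Ideal.mem_normalizedFactors_iff h0,
      Ideal.span_singleton_le_iff_mem]
    simp [v.isPrime]
  let w : ∀ P : s.toFinset, HeightOneSpectrum (IntFun K) := fun P =>
    ⟨P.1, (hprime P.1 (Multiset.mem_toFinset.1 P.2)).1, (hprime P.1 (Multiset.mem_toFinset.1 P.2)).2⟩
  have hw : ∀ P : s.toFinset, ‖centre (w P).asIdeal‖ < 1 ∧ f ∈ (w P).asIdeal := fun P =>
    (hmem (w P)).1 (Multiset.mem_toFinset.1 P.2)
  have hwc : ∀ P : s.toFinset,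
      algebraMap ℂ[X] (IntFun K) (X - C (centre (w P).asIdeal)) ∈ (w P).asIdeal := fun P =>
    have := (w P).isPrime
    X_sub_C_centre_mem _ (w P).ne_bot
  let e : s.toFinset → {V : ValuationSubring K // (∃ c : ℂ, ‖c‖ < 1 ∧ IsPlaceAt V c) ∧
        V.valuation (z - algebraMap ℂ K lam) < 1} := fun P =>
    ⟨((w P).valuation K).valuationSubring, ⟨_, (hw P).1, isPlaceAt_of_mem (hwc P)⟩, by
      rw [valuation_lt_one_iff_mem_nonunits, hval _ _ (hw P).1 (hwc P),
        HeightOneSpectrum.valuation_lt_one_iff_mem]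
      exact (hw P).2⟩
  have he : Function.Bijective e := by
    constructor
    · intro P Q h
      have := valuationSubring_heightOneSpectrum_injective (congrArg Subtype.val h)
      exact Subtype.ext (congrArg HeightOneSpectrum.asIdeal this)
    · rintro ⟨V, ⟨c, hc, hV⟩, hVz⟩
      obtain ⟨v, rfl, hv⟩ := hV.exists_prime
      have hcen := centre_eq v.asIdeal v.ne_bot hv
      rw [valuation_lt_one_iff_mem_nonunits, hval _ _ hc hv,
        HeightOneSpectrum.valuation_lt_one_iff_mem] at hVz
      exact ⟨⟨v.asIdeal, Multiset.mem_toFinset.2 ((hmem v).2 ⟨hcen ▸ hc, hVz⟩)⟩, rfl⟩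
  have hord : ∀ P : s.toFinset, ringOrder (e P).1 (e P).2.1.choose_spec.2.dvr
      (z - algebraMap ℂ K lam) = (s.count P.1 : ℕ∞) := by
    intro P
    have hdvr := (e P).2.1.choose_spec.2.dvr
    have hin : z - algebraMap ℂ K lam ∈ (e P).1 :=
      ((e P).1.valuation_le_one_iff _).1 (e P).2.2.le
    have hcount : s.count P.1 = (normalizedFactors (Ideal.span {f})).count P.1 :=
      Multiset.count_filter_of_pos (p := fun P : Ideal (IntFun K) => ‖centre P‖ < 1) (hw P).1
    rw [ringOrder, dif_pos hin, hcount]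
    refine addVal_eq_of_valuation_eq (w P) ⟨_, hin⟩ _ ?_
    change (w P).valuation K (z - algebraMap ℂ K lam) = _
    rw [hval _ _ (hw P).1 (hwc P), valuation_eq_exp_count (w P) hf0]
  refine ⟨Finite.of_surjective e he.2, ?_⟩
  rw [← (Equiv.ofBijective e he).tsum_eq]
  simp only [Equiv.ofBijective_apply]
  rw [tsum_congr hord, tsum_fintype, Finset.sum_coe_sort s.toFinset fun P => (s.count P : ℕ∞),
    ← Nat.cast_sum, Multiset.toFinset_sum_count_eq, ← hnorm, discRoots, roots_intNorm f hf0,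
    Multiset.filter_map, Multiset.card_map]
  congr!

end Places

end NormalSymbol

end

/-! ### Existence of poles and discreteness of places. -/

noncomputable section

namespace NormalSymbol

open Polynomial IsDedekindDomain

/-- A nontrivial valuation ring of a function field that contains the constants and a
transcendental function `t` is discrete. -/
lemma isDiscreteValuationRing_of_mem {K : Type} [Field K] [Algebra ℂ K] (φ : RatFunc ℂ →ₐ[ℂ] K)
    (hφ : φ.toRingHom.Finite) (V : ValuationSubring K) (hV : ∀ c : ℂ, algebraMap ℂ K c ∈ V)
    (hVtop : V ≠ ⊤) (ht : φ RatFunc.X ∈ V) : IsDiscreteValuationRing V := by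
  let _ : Algebra (RatFunc ℂ) K := φ.toRingHom.toAlgebra
  let _ : Algebra ℂ[X] K := (φ.toRingHom.comp (algebraMap ℂ[X] (RatFunc ℂ))).toAlgebra
  have : IsScalarTower ℂ[X] (RatFunc ℂ) K := IsScalarTower.of_algebraMap_eq fun _ => rfl
  have : IsScalarTower ℂ ℂ[X] K := IsScalarTower.of_algebraMap_eq fun c => by
    change _ = φ (algebraMap ℂ[X] (RatFunc ℂ) (algebraMap ℂ ℂ[X] c))
    rw [← IsScalarTower.algebraMap_apply, AlgHom.commutes]
  have : FiniteDimensional (RatFunc ℂ) K := hφ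
  have hX : algebraMap ℂ[X] K X ∈ V := by
    change φ (algebraMap ℂ[X] (RatFunc ℂ) X) ∈ V
    rwa [RatFunc.algebraMap_X]
  obtain ⟨v, rfl⟩ := exists_heightOneSpectrum (R := IntFun K) V hVtop (intFun_mem V hV hX)
  exact isDiscreteValuationRing_heightOneSpectrum v

/-- The substitution of `1 / t` for `t` reduces places over `t = ∞` to places with finite
coordinate. -/
lemma exists_ratFunc_inversion :
    ∃ σ : RatFunc ℂ →ₐ[ℂ] RatFunc ℂ, Function.Surjective σ ∧ σ RatFunc.X = RatFunc.X⁻¹ := by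
  have htr : Transcendental ℂ (RatFunc.X⁻¹ : RatFunc ℂ) := by
    intro h
    have := h.inv
    rw [inv_inv] at this
    exact RatFunc.transcendental_X this
  have hinj : Function.Injective (aeval (R := ℂ) (RatFunc.X⁻¹ : RatFunc ℂ)) :=
    transcendental_iff_injective.1 htr
  let σ : RatFunc ℂ →ₐ[ℂ] RatFunc ℂ := RatFunc.liftAlgHom (aeval (RatFunc.X⁻¹ : RatFunc ℂ))
    (nonZeroDivisors_le_comap_nonZeroDivisors_of_injective _ hinj)
  have hσ : ∀ p : ℂ[X], σ (algebraMap _ _ p) = aeval (RatFunc.X⁻¹ : RatFunc ℂ) p := by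
    intro p
    simp [σ, RatFunc.liftAlgHom_apply]
  have hσX : σ RatFunc.X = RatFunc.X⁻¹ := by
    rw [← RatFunc.algebraMap_X, hσ, aeval_X, RatFunc.algebraMap_X]
  refine ⟨σ, fun x => ?_, hσX⟩
  have key : ∀ p : ℂ[X], σ (aeval (RatFunc.X⁻¹ : RatFunc ℂ) p) = algebraMap _ _ p := by
    intro p
    rw [← aeval_algHom_apply, map_inv₀, hσX, inv_inv, ← RatFunc.algebraMap_X,
      aeval_algebraMap_apply, aeval_X_left_apply]
  refine ⟨aeval (RatFunc.X⁻¹ : RatFunc ℂ) x.num / aeval (RatFunc.X⁻¹ : RatFunc ℂ) x.denom, ?_⟩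
  rw [map_div₀, key, key, RatFunc.num_div_denom]

/-- A transcendental function has a pole. -/
lemma exists_isDiscreteValuationRing_notMem {K : Type} [Field K] [Algebra ℂ K]
    (φ : RatFunc ℂ →ₐ[ℂ] K) (hφ : φ.toRingHom.Finite) {z : K} (hz : Transcendental ℂ z) :
    ∃ V : ValuationSubring K, (∀ c : ℂ, algebraMap ℂ K c ∈ V) ∧ IsDiscreteValuationRing V ∧
      z ∉ V := by
  have h1 : ∃ V : ValuationSubring K, (∀ c : ℂ, algebraMap ℂ K c ∈ V) ∧ z ∉ V := by
    -- An element outside an integrally closed subring is omitted by some valuation ring containing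
    -- that subring.
    have hzR : z ∉ (integralClosure ℂ K).toSubring := fun h => hz (IsIntegral.isAlgebraic h)
    have : IsIntegrallyClosedIn (integralClosure ℂ K).toSubring K :=
      inferInstanceAs (IsIntegrallyClosedIn (integralClosure ℂ K) K)
    obtain ⟨V, hV, hzV⟩ := Subring.exists_le_valuationSubring_of_isIntegrallyClosedIn hzR
    exact ⟨V, fun c => hV ((integralClosure ℂ K).algebraMap_mem c), hzV⟩
  obtain ⟨V, hV, hzV⟩ := h1
  have htop : V ≠ ⊤ := by rintro rfl; exact hzV (ValuationSubring.mem_top z)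
  refine ⟨V, hV, ?_, hzV⟩
  -- Discreteness follows by taking as coordinate whichever of `t` and `1 / t` lies in `V`.
  rcases V.mem_or_inv_mem (φ RatFunc.X) with h | h
  · exact isDiscreteValuationRing_of_mem φ hφ V hV htop h
  · obtain ⟨σ, hσ, hσX⟩ := exists_ratFunc_inversion
    refine isDiscreteValuationRing_of_mem (φ.comp σ) ?_ V hV htop ?_
    · exact RingHom.Finite.comp hφ (RingHom.Finite.of_surjective σ.toRingHom hσ)
    · rwa [AlgHom.comp_apply, hσX, map_inv₀]

/-- A discrete valuation ring containing the constants and `t` is a point at which `t` has some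
value. -/
lemma exists_isPlaceAt {K : Type} [Field K] [Algebra ℂ K] [Algebra ℂ[X] K] [IsScalarTower ℂ ℂ[X] K]
    [Algebra (RatFunc ℂ) K] [IsScalarTower ℂ[X] (RatFunc ℂ) K] [FiniteDimensional (RatFunc ℂ) K]
    {V : ValuationSubring K} (hV : ∀ c : ℂ, algebraMap ℂ K c ∈ V)
    (hdvr : IsDiscreteValuationRing V) (ht : algebraMap ℂ[X] K X ∈ V) :
    ∃ c : ℂ, IsPlaceAt V c := by
  obtain ⟨v, rfl⟩ := exists_heightOneSpectrum (R := IntFun K) V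
    (ne_top_of_isDiscreteValuationRing V) (intFun_mem V hV ht)
  have := v.isPrime
  exact ⟨_, isPlaceAt_of_mem (X_sub_C_centre_mem _ v.ne_bot)⟩

end NormalSymbol

end

noncomputable section

namespace NormalSymbol

open Polynomial

variable {m : ℕ}

/-! ### Polynomials in a normal matrix -/

open scoped Matrix.Norms.L2Operator in
-- The polynomial interpolates complex conjugation on the finite spectrum, and the functional
-- calculus of a normal matrix sees only the spectrum.
lemma star_eq_aeval (A : Matrix (Fin m) (Fin m) ℂ) [hA : IsStarNormal A] :
    ∃ p : ℂ[X], star A = aeval A p := by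
  have hfin : (spectrum ℂ A).Finite := Matrix.finite_spectrum A
  refine ⟨Lagrange.interpolate hfin.toFinset id star, ?_⟩
  rw [← cfc_polynomial _ A hA, ← cfc_star_id (R := ℂ) (a := A)]
  refine cfc_congr fun x hx => ?_
  exact (Lagrange.eval_interpolate_at_node (v := id) (r := star) Function.injective_id.injOn
    (hfin.mem_toFinset.2 hx)).symm

open scoped Matrix.Norms.L2Operator in
-- By spectral mapping `p` vanishes on the spectrum of `A`, hence `p(A) = 0` by the functional
-- calculus.
lemma aeval_eq_zero_of_isNilpotent (A : Matrix (Fin m) (Fin m) ℂ) [hA : IsStarNormal A] (p : ℂ[X])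
    (hp : IsNilpotent (aeval A p)) : aeval A p = 0 := by
  rw [← cfc_polynomial _ A hA, ← cfc_zero ℂ A]
  refine cfc_congr fun x hx => ?_
  have h1 : p.eval x ∈ spectrum ℂ (aeval A p) := spectrum.subset_polynomial_aeval A p ⟨x, hx, rfl⟩
  by_contra h0
  rw [spectrum.mem_iff] at h1
  apply h1
  have hu : IsUnit (algebraMap ℂ (Matrix (Fin m) (Fin m) ℂ) (p.eval x)) :=
    (Ne.isUnit (by simpa using h0)).map _
  rw [sub_eq_add_neg]
  exact IsNilpotent.isUnit_add_left_of_commute hp.neg hu (Algebra.commutes _ _).symm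

/-! ### The adjoint symbol as a polynomial in the symbol -/

/-- The numerator matrix, with entries regarded as rational functions. -/
def numK (F : RatMatrix m) : Matrix (Fin m) (Fin m) (RatFunc ℂ) :=
  (num F).map (algebraMap ℂ[X] (RatFunc ℂ))

/-- The numerator matrix of the reflected symbol, with entries regarded as rational functions. -/
def numK' (F : RatMatrix m) : Matrix (Fin m) (Fin m) (RatFunc ℂ) :=
  (num' F).map (algebraMap ℂ[X] (RatFunc ℂ))

lemma eq_zero_of_infinite {p : ℂ[X]} {S : Set ℂ} (hS : S.Infinite) (h : ∀ t ∈ S, p.eval t = 0) :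
    p = 0 := by
  refine Polynomial.eq_zero_of_infinite_isRoot p (hS.mono fun t ht => h t ht)

lemma infinite_diff_roots {S : Set ℂ} (hS : S.Infinite) {p : ℂ[X]} (hp : p ≠ 0) :
    {t ∈ S | p.eval t ≠ 0}.Infinite := by
  intro hfin
  refine hS ((hfin.union (p.roots.toFinset.finite_toSet)).subset fun t ht => ?_)
  by_cases h : p.eval t = 0
  · exact Or.inr (by simpa [hp] using h)
  · exact Or.inl ⟨ht, h⟩

/-- Duality over `ℂ(t)`: otherwise some linear functional kills all powers of `numK F` but not
`numK' F`. Cleared of denominators, it can be evaluated at a circle point where `F` is normal; there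
the adjoint is a polynomial in the value, so the functional kills it as well. -/
lemma exists_numK'_eq_aeval {F : RatMatrix m} (hF : IsAnalytic F) (hN : IsNormal F) :
    ∃ q : (RatFunc ℂ)[X], numK' F = aeval (numK F) q := by
  by_contra! hcon
  have hmem : numK' F ∉ Subalgebra.toSubmodule (Algebra.adjoin (RatFunc ℂ) {numK F}) := by
    intro h
    rw [Subalgebra.mem_toSubmodule, Algebra.adjoin_singleton_eq_range_aeval] at h
    obtain ⟨q, hq⟩ := h
    exact hcon q hq.symm
  obtain ⟨l, hl, hker⟩ := Submodule.exists_le_ker_of_notMem hmem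
  obtain ⟨b, hb⟩ := IsLocalization.exist_integer_multiples_of_finite (nonZeroDivisors ℂ[X])
    fun ij : Fin m × Fin m => l (Matrix.single ij.1 ij.2 1)
  choose c hc using hb
  have hlin : ∀ M : Matrix (Fin m) (Fin m) ℂ[X],
      algebraMap ℂ[X] (RatFunc ℂ) (∑ i, ∑ j, c (i, j) * M i j) =
        algebraMap ℂ[X] (RatFunc ℂ) b * l (M.map (algebraMap ℂ[X] (RatFunc ℂ))) := by
    intro M
    conv_rhs => rw [Matrix.matrix_eq_sum_single (M.map (algebraMap ℂ[X] (RatFunc ℂ)))]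
    simp only [map_sum, map_mul, Finset.mul_sum]
    refine Finset.sum_congr rfl fun i _ => Finset.sum_congr rfl fun j _ => ?_
    have h1 : Matrix.single i j (M.map (algebraMap ℂ[X] (RatFunc ℂ)) i j) =
        algebraMap ℂ[X] (RatFunc ℂ) (M i j) • Matrix.single i j (1 : RatFunc ℂ) := by
      rw [Matrix.smul_single, Matrix.map_apply, smul_eq_mul, mul_one]
    have h2 := hc (i, j)
    simp only [Algebra.smul_def] at h2
    rw [h1, map_smul, h2, smul_eq_mul]
    ring
  have hbne : algebraMap ℂ[X] (RatFunc ℂ) b ≠ 0 := by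
    rw [ne_eq, FaithfulSMul.algebraMap_eq_zero_iff]
    exact nonZeroDivisors.ne_zero b.2
  have hpow : ∀ n : ℕ, ∑ i, ∑ j, c (i, j) * (num F ^ n) i j = 0 := by
    intro n
    apply FaithfulSMul.algebraMap_injective ℂ[X] (RatFunc ℂ)
    rw [hlin, map_zero]
    have : (num F ^ n).map (algebraMap ℂ[X] (RatFunc ℂ)) = numK F ^ n :=
      map_pow (algebraMap ℂ[X] (RatFunc ℂ)).mapMatrix (num F) n
    rw [this]
    have hk : numK F ^ n ∈ LinearMap.ker l :=
      hker (pow_mem (Algebra.self_mem_adjoin_singleton _ _) n)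
    rw [LinearMap.mem_ker.1 hk, mul_zero]
  set g : ℂ[X] := ∑ i, ∑ j, c (i, j) * num' F i j with hg
  have hg0 : g ≠ 0 := by
    intro h
    have := hlin (num' F)
    rw [← hg, h, map_zero] at this
    exact (mul_ne_zero hbne hl) this.symm
  -- `g` is the cleared functional applied to `num' F`. It has finitely many roots, so some normal
  -- point is not among them.
  obtain ⟨t, ⟨ht1, ht2⟩, htg⟩ := (infinite_diff_roots (normalSet_infinite hN) hg0).nonempty
  apply htg
  have ht0 : t ≠ 0 := by rintro rfl; simp at ht1
  have hd := hF.den_eval_ne_zero ht1.le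
  have hd' := hF.den'_eval_ne_zero ht1
  obtain ⟨p, hp⟩ := star_eq_aeval (value F t)
  have hv : value F t = ((den F).eval t)⁻¹ • evalMat t (num F) := by
    rw [evalMat_num F hd, inv_smul_smul₀ hd]
  have hN' : evalMat t (num' F) = (den' F).eval t • aeval (value F t) p := by
    rw [evalMat_num'_of_ne F ht0 hd', star_inv_of_norm_eq_one ht1, ← hp]
    rfl
  let L : Matrix (Fin m) (Fin m) ℂ →ₗ[ℂ] ℂ :=
    ∑ i, ∑ j, (c (i, j)).eval t • Matrix.entryLinearMap ℂ ℂ i j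
  have hL : ∀ M, L M = ∑ i, ∑ j, (c (i, j)).eval t * M i j := by
    intro M
    simp [L, LinearMap.sum_apply]
  have hLpow : ∀ n, L (evalMat t (num F) ^ n) = 0 := by
    intro n
    rw [hL, ← map_pow]
    have := congrArg (Polynomial.eval t) (hpow n)
    simpa [eval_finsetSum] using this
  have hgL : g.eval t = L (evalMat t (num' F)) := by
    rw [hL, hg]
    simp [eval_finsetSum]
  rw [hgL, hN', map_smul, hv, aeval_eq_sum_range, map_sum, Finset.sum_eq_zero, smul_zero]
  intro n _
  rw [_root_.smul_pow, map_smul, map_smul, hLpow, smul_zero, smul_zero]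

end NormalSymbol

end

/-! ### Semisimplicity of the symbol and clearing of denominators over `ℂ(t)`. -/

noncomputable section

namespace NormalSymbol

open Polynomial

variable {m : ℕ}

lemma evalMat_aeval (N : Matrix (Fin m) (Fin m) ℂ[X]) (p : ℂ[X][X]) (t : ℂ) :
    evalMat t (aeval N p) = aeval (evalMat t N) (p.map (evalRingHom t)) := by
  rw [aeval_def, aeval_def, hom_eval₂, eval₂_map]
  congr 1
  refine RingHom.ext fun r => ?_
  ext i j
  by_cases h : i = j <;> simp [h, Matrix.algebraMap_matrix_apply]

lemma eq_zero_of_evalMat {P : Matrix (Fin m) (Fin m) ℂ[X]} {S : Set ℂ} (hS : S.Infinite)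
    (h : ∀ t ∈ S, evalMat t P = 0) : P = 0 := by
  ext1 i j
  refine eq_zero_of_infinite hS fun t ht => ?_
  exact congrFun (congrFun (h t ht) i) j

/-- The identity holds at the infinitely many normal points, hence everywhere. This is where
normality yields semisimplicity of `num F`. -/
lemma aeval_num_eq_zero {F : RatMatrix m} (hF : IsAnalytic F) (hN : IsNormal F) (p : ℂ[X][X])
    (hp : IsNilpotent (aeval (num F) p)) : aeval (num F) p = 0 := by
  refine eq_zero_of_evalMat (normalSet_infinite hN) fun t ht => ?_
  have hn := ht.2
  have hnorm : IsStarNormal (evalMat t (num F)) := by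
    rw [evalMat_num F (hF.den_eval_ne_zero ht.1.le)]
    infer_instance
  have := hp.map (evalMat t)
  rw [evalMat_aeval] at this ⊢
  exact aeval_eq_zero_of_isNilpotent _ _ this

/-- A polynomial in two variables, regarded as a polynomial over the field of rational functions
in the first variable. -/
abbrev overK (μ : ℂ[X][X]) : (RatFunc ℂ)[X] := μ.map (algebraMap ℂ[X] (RatFunc ℂ))

lemma overK_injective : Function.Injective overK :=
  map_injective _ (FaithfulSMul.algebraMap_injective ℂ[X] (RatFunc ℂ))

/-- Clearing denominators. -/
lemma exists_overK_eq (u : (RatFunc ℂ)[X]) :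
    ∃ (a : ℂ[X]) (U : ℂ[X][X]), a ≠ 0 ∧ overK U = C (algebraMap ℂ[X] (RatFunc ℂ) a) * u := by
  obtain ⟨a, ha, h⟩ := IsLocalization.integerNormalization_spec (nonZeroDivisors ℂ[X]) u
  refine ⟨a, _, nonZeroDivisors.ne_zero ha, h.trans ?_⟩
  rw [← algebraMap_smul (RatFunc ℂ) a u, smul_eq_C_mul]

lemma map_aeval_numK (F : RatMatrix m) (p : ℂ[X][X]) :
    (aeval (num F) p).map (algebraMap ℂ[X] (RatFunc ℂ)) =
      aeval (numK F) (overK p) := by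
  rw [overK, aeval_map_algebraMap]
  exact (aeval_algHom_apply ((Algebra.ofId ℂ[X] (RatFunc ℂ)).mapMatrix) (num F) p).symm

lemma exists_smul_num'_eq_aeval {F : RatMatrix m} (hF : IsAnalytic F) (hN : IsNormal F) :
    ∃ (b : ℂ[X]) (Q : ℂ[X][X]), b ≠ 0 ∧ b • num' F = aeval (num F) Q := by
  obtain ⟨q, hq⟩ := exists_numK'_eq_aeval hF hN
  obtain ⟨b, Q, hb0, hb⟩ := exists_overK_eq q
  refine ⟨b, Q, hb0, ?_⟩
  apply Matrix.map_injective (FaithfulSMul.algebraMap_injective ℂ[X] (RatFunc ℂ))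
  dsimp only
  rw [map_aeval_numK, hb, map_mul, ← hq, aeval_C, ← Algebra.smul_def]
  ext i j
  simp [numK']

/-! ### Irreducible factors of the characteristic polynomial -/

/-- The irreducible factors of the characteristic polynomial of the numerator matrix. -/
def factors (F : RatMatrix m) : Multiset ℂ[X][X] :=
  UniqueFactorizationMonoid.normalizedFactors (num F).charpoly

lemma factors_prod (F : RatMatrix m) : (factors F).prod = (num F).charpoly := by
  have hm := (num F).charpoly_monic
  have h := UniqueFactorizationMonoid.prod_normalizedFactors_eq hm.ne_zero
  rwa [hm.normalize_eq_self] at h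

variable {F : RatMatrix m} {μ ν : ℂ[X][X]}

lemma dvd_charpoly_of_mem (hμ : μ ∈ factors F) : μ ∣ (num F).charpoly :=
  UniqueFactorizationMonoid.dvd_of_mem_normalizedFactors hμ

lemma monic_of_mem (hμ : μ ∈ factors F) : μ.Monic := by
  have h1 : IsUnit μ.leadingCoeff := by
    obtain ⟨c, hc⟩ := dvd_charpoly_of_mem hμ
    have := congrArg leadingCoeff hc
    rw [(num F).charpoly_monic.leadingCoeff, leadingCoeff_mul] at this
    exact IsUnit.of_mul_eq_one _ this.symm
  have h2 := congrArg leadingCoeff (UniqueFactorizationMonoid.normalize_normalized_factor μ hμ)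
  rw [leadingCoeff_normalize, normalize_eq_one.2 h1] at h2
  exact h2.symm

lemma irreducible_overK (hμ : μ ∈ factors F) : Irreducible (overK μ) :=
  ((monic_of_mem hμ).irreducible_iff_irreducible_map_fraction_map (K := RatFunc ℂ)).1
    (UniqueFactorizationMonoid.irreducible_of_normalized_factor μ hμ)

lemma eq_of_overK_dvd (hμ : μ ∈ factors F) (hν : ν ∈ factors F) (h : overK μ ∣ overK ν) :
    μ = ν :=
  overK_injective (eq_of_monic_of_associated ((monic_of_mem hμ).map _) ((monic_of_mem hν).map _)
    ((irreducible_overK hμ).associated_of_dvd (irreducible_overK hν) h))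

lemma isCoprime_overK (hμ : μ ∈ factors F) (hν : ν ∈ factors F) (h : μ ≠ ν) :
    IsCoprime (overK μ) (overK ν) :=
  (irreducible_overK hμ).coprime_iff_not_dvd.2 fun hd => h (eq_of_overK_dvd hμ hν hd)

/-- Coprime polynomials over the field of rational functions have no common zero over almost
every point. -/
lemma exists_bezout {p q : ℂ[X][X]} (h : IsCoprime (overK p) (overK q)) :
    ∃ (u v : ℂ[X][X]) (g : ℂ[X]), g ≠ 0 ∧ u * p + v * q = C g := by
  obtain ⟨u, v, huv⟩ := h
  obtain ⟨a, U, ha0, ha⟩ := exists_overK_eq u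
  obtain ⟨b, V, hb0, hb⟩ := exists_overK_eq v
  refine ⟨C b * U, C a * V, a * b, mul_ne_zero ha0 hb0, overK_injective ?_⟩
  simp only [overK, Polynomial.map_add, Polynomial.map_mul, map_C, map_mul] at ha hb ⊢
  rw [ha, hb]
  linear_combination (C (algebraMap ℂ[X] (RatFunc ℂ) a) * C (algebraMap ℂ[X] (RatFunc ℂ) b)) * huv

end NormalSymbol

end

noncomputable section

namespace NormalSymbol

open Polynomial

variable {m : ℕ}

/-! ### Homogenized evaluation of polynomials in three variables -/

/-- The value of `f` at `(a / d₁, b / d₂, t)` multiplied by a power of `d₁ d₂`. -/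
def clear {A : Type*} [Ring A] [Algebra ℂ A] (f : MvPolynomial (Fin 3) ℂ) (d₁ d₂ a b t : A) : A :=
  ∑ s ∈ f.support, f.coeff s •
    (d₁ ^ (f.totalDegree - s 0) * d₂ ^ (f.totalDegree - s 1) * (a ^ s 0 * b ^ s 1 * t ^ s 2))

lemma map_clear {A B : Type*} [Ring A] [Algebra ℂ A] [Ring B] [Algebra ℂ B] (ψ : A →ₐ[ℂ] B)
    (f : MvPolynomial (Fin 3) ℂ) (d₁ d₂ a b t : A) :
    ψ (clear f d₁ d₂ a b t) = clear f (ψ d₁) (ψ d₂) (ψ a) (ψ b) (ψ t) := by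
  simp [clear]

lemma clear_eq {A : Type*} [CommRing A] [Algebra ℂ A] (f : MvPolynomial (Fin 3) ℂ)
    (d₁ d₂ z w t : A) :
    clear f d₁ d₂ (d₁ * z) (d₂ * w) t =
      (d₁ * d₂) ^ f.totalDegree * MvPolynomial.aeval ![z, w, t] f := by
  have hle : ∀ s ∈ f.support, ∀ i, s i ≤ f.totalDegree := by
    intro s hs i
    refine le_trans ?_ (MvPolynomial.le_totalDegree hs)
    rw [Finsupp.sum_fintype _ _ (fun _ => rfl)]
    exact Finset.single_le_sum (f := fun i => s i) (fun _ _ => Nat.zero_le _) (Finset.mem_univ i)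
  rw [clear, MvPolynomial.aeval_def, MvPolynomial.eval₂_eq', Finset.mul_sum]
  refine Finset.sum_congr rfl fun s hs => ?_
  rw [Fin.prod_univ_three, Algebra.smul_def]
  have h1 := pow_sub_mul_pow d₁ (hle s hs 0)
  have h2 := pow_sub_mul_pow d₂ (hle s hs 1)
  simp only [Matrix.cons_val]
  rw [mul_pow d₁ d₂, mul_pow d₁ z, mul_pow d₂ w, ← h1, ← h2]
  ring

/-- A common eigenvector passes through all products and sums, so the matrices need not commute. -/
lemma clear_mulVec (f : MvPolynomial (Fin 3) ℂ) {d₁ d₂ a b t : Matrix (Fin m) (Fin m) ℂ}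
    {e₁ e₂ α β τ : ℂ} {φ : Fin m → ℂ} (h₁ : d₁.mulVec φ = e₁ • φ) (h₂ : d₂.mulVec φ = e₂ • φ)
    (ha : a.mulVec φ = α • φ) (hb : b.mulVec φ = β • φ) (ht : t.mulVec φ = τ • φ) :
    (clear f d₁ d₂ a b t).mulVec φ = clear f e₁ e₂ α β τ • φ := by
  have hpow : ∀ {M : Matrix (Fin m) (Fin m) ℂ} {c : ℂ}, M.mulVec φ = c • φ →
      ∀ n, (M ^ n).mulVec φ = c ^ n • φ := by
    intro M c h n
    induction n with
    | zero => simp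
    | succ n ih => rw [pow_succ, ← Matrix.mulVec_mulVec, h, Matrix.mulVec_smul, ih, smul_smul,
        pow_succ, mul_comm]
  have hmul : ∀ {M N : Matrix (Fin m) (Fin m) ℂ} {c e : ℂ}, M.mulVec φ = c • φ →
      N.mulVec φ = e • φ → (M * N).mulVec φ = (c * e) • φ := by
    intro M N c e hM hN
    rw [← Matrix.mulVec_mulVec, hN, Matrix.mulVec_smul, hM, smul_smul, mul_comm]
  rw [clear, clear, Matrix.sum_mulVec, Finset.sum_smul]
  refine Finset.sum_congr rfl fun s _ => ?_
  rw [Matrix.smul_mulVec, smul_assoc]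
  congr 1
  exact hmul (hmul (hpow h₁ _) (hpow h₂ _)) (hmul (hmul (hpow ha _) (hpow hb _)) (hpow ht _))

/-! ### The ideal of the curve -/

/-- The coordinate functions `z`, `w`, `t` in terms of the eigenvalue of the numerator matrix. -/
def coordFun (F : RatMatrix m) (b : ℂ[X]) (Q : ℂ[X][X]) : Fin 3 → (RatFunc ℂ)[X] :=
  ![C (algebraMap ℂ[X] (RatFunc ℂ) (den F))⁻¹ * X,
    C (algebraMap ℂ[X] (RatFunc ℂ) (b * den' F))⁻¹ * overK Q, C RatFunc.X]

/-- The homomorphism from polynomials on `ℂ³` given by `coordFun`. -/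
def coordHom (F : RatMatrix m) (b : ℂ[X]) (Q : ℂ[X][X]) :
    MvPolynomial (Fin 3) ℂ →ₐ[ℂ] (RatFunc ℂ)[X] :=
  MvPolynomial.aeval (coordFun F b Q)

lemma IsAnalytic.den'_ne_zero {F : RatMatrix m} (hF : IsAnalytic F) : den' F ≠ 0 := by
  intro h
  have := hF.den'_eval_ne_zero (t := 1) (by simp)
  simp [h] at this

variable {F : RatMatrix m} {b : ℂ[X]} {Q : ℂ[X][X]}

lemma clear_coordHom (hF : IsAnalytic F) (hb : b ≠ 0) (f : MvPolynomial (Fin 3) ℂ) :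
    overK (clear f (C (den F)) (C (b * den' F)) X Q (C X)) =
      C (algebraMap ℂ[X] (RatFunc ℂ) ((den F * (b * den' F)) ^ f.totalDegree)) *
        coordHom F b Q f := by
  have hd : algebraMap ℂ[X] (RatFunc ℂ) (den F) ≠ 0 := by
    rw [ne_eq, FaithfulSMul.algebraMap_eq_zero_iff]; exact den_ne_zero F
  have hd' : algebraMap ℂ[X] (RatFunc ℂ) (b * den' F) ≠ 0 := by
    rw [ne_eq, FaithfulSMul.algebraMap_eq_zero_iff]; exact mul_ne_zero hb hF.den'_ne_zero
  have h1 := map_clear (mapAlgHom (IsScalarTower.toAlgHom ℂ ℂ[X] (RatFunc ℂ))) f (C (den F))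
    (C (b * den' F)) X Q (C X)
  have h2 : ∀ p : ℂ[X][X], mapAlgHom (IsScalarTower.toAlgHom ℂ ℂ[X] (RatFunc ℂ)) p = overK p :=
    fun p => rfl
  simp only [h2] at h1
  rw [h1]
  have h3 : overK (X : ℂ[X][X]) = C (algebraMap ℂ[X] (RatFunc ℂ) (den F)) *
      (C (algebraMap ℂ[X] (RatFunc ℂ) (den F))⁻¹ * X) := by
    rw [← mul_assoc, ← C_mul, mul_inv_cancel₀ hd, C_1, one_mul, overK, map_X]
  have h4 : overK Q = C (algebraMap ℂ[X] (RatFunc ℂ) (b * den' F)) *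
      (C (algebraMap ℂ[X] (RatFunc ℂ) (b * den' F))⁻¹ * overK Q) := by
    rw [← mul_assoc, ← C_mul, mul_inv_cancel₀ hd', C_1, one_mul]
  rw [h3]
  conv_lhs => rw [h4]
  simp only [overK, map_C]
  rw [clear_eq, coordHom, coordFun, RatFunc.algebraMap_X, ← C_mul, ← C_pow, ← map_mul, ← map_pow]

/-- Evaluation of a polynomial in two variables. -/
def evalAt (t y : ℂ) : ℂ[X][X] →ₐ[ℂ] ℂ :=
  (aeval (R := ℂ) t).comp ((aeval (R := ℂ[X]) (C y : ℂ[X])).restrictScalars ℂ)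

lemma evalAt_eq (t y : ℂ) (p : ℂ[X][X]) : evalAt t y p = (p.map (evalRingHom t)).eval y := by
  rw [map_evalRingHom_eval, evalEval]
  simp [evalAt, coe_aeval_eq_eval]

lemma aeval_mulVec {M : Matrix (Fin m) (Fin m) ℂ} {y : ℂ} {φ : Fin m → ℂ}
    (h : M.mulVec φ = y • φ) (p : ℂ[X]) : (aeval M p).mulVec φ = p.eval y • φ := by
  induction p using Polynomial.induction_on with
  | C a => simp [Algebra.algebraMap_eq_smul_one, Matrix.smul_mulVec]
  | add p q hp hq => rw [map_add, Matrix.add_mulVec, hp, hq, eval_add, add_smul]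
  | monomial n a ih =>
    rw [pow_succ, ← mul_assoc, map_mul, aeval_X, ← Matrix.mulVec_mulVec, h, Matrix.mulVec_smul, ih,
      smul_smul, eval_mul_X, mul_comm]

lemma exists_eigenvector_of_root {F : RatMatrix m} {t y : ℂ}
    (hy : evalAt t y (num F).charpoly = 0) :
    ∃ φ : Fin m → ℂ, φ ≠ 0 ∧ (evalMat t (num F)).mulVec φ = y • φ := by
  rw [evalAt_eq, ← Matrix.charpoly_map, Matrix.eval_charpoly,
    ← Matrix.exists_mulVec_eq_zero_iff] at hy
  obtain ⟨φ, hφ, h⟩ := hy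
  refine ⟨φ, hφ, ?_⟩
  rw [Matrix.sub_mulVec, sub_eq_zero, Matrix.scalar_apply, ← Matrix.smul_one_eq_diagonal,
    Matrix.smul_mulVec, Matrix.one_mulVec] at h
  exact h.symm

/-- Almost every point over which the adjoint matrix is a polynomial in the matrix gives points
of the curve. -/
lemma mem_curve0_of_root (hQ : b • num' F = aeval (num F) Q) {t y : ℂ} (ht : t ≠ 0)
    (hd : (den F).eval t ≠ 0) (hd' : (b * den' F).eval t ≠ 0)
    (hy : evalAt t y (num F).charpoly = 0) :
    ![y / (den F).eval t, evalAt t y Q / (b * den' F).eval t, t] ∈ curve0 F := by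
  obtain ⟨φ, hφ, h⟩ := exists_eigenvector_of_root hy
  rw [eval_mul] at hd'
  obtain ⟨hb, hd'⟩ := mul_ne_zero_iff.1 hd'
  rw [mem_curve0_iff]
  refine ⟨ht, hd, hd', φ, hφ, ?_, ?_⟩
  · simp only [Matrix.cons_val]
    rw [mul_div_cancel₀ _ hd]
    exact h
  · simp only [Matrix.cons_val]
    have h1 := congrArg (fun M => (evalMat t M).mulVec φ) hQ
    simp only [evalMat_aeval] at h1
    rw [aeval_mulVec h, ← evalAt_eq] at h1
    have h2 : evalMat t (b • num' F) = b.eval t • evalMat t (num' F) := by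
      ext i j; simp
    rw [h2, Matrix.smul_mulVec] at h1
    have h3 : (den' F).eval t * (evalAt t y Q / (b * den' F).eval t) =
        (b.eval t)⁻¹ * evalAt t y Q := by
      rw [eval_mul]
      field_simp
    rw [h3, ← smul_smul, ← h1, inv_smul_smul₀ hb]

/-- If `μ` did not divide, Bézout would exclude common zeros of `μ` and the cleared `f` over almost
every `t`. But over such a `t` a root of `μ` gives a point of `curve0`, where `f` vanishes. -/
lemma dvd_of_vanish (hF : IsAnalytic F) (hb : b ≠ 0) (hQ : b • num' F = aeval (num F) Q)
    {μ : ℂ[X][X]} (hμ : μ ∈ factors F) {f : MvPolynomial (Fin 3) ℂ}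
    (hf : ∀ x ∈ curve0 F, MvPolynomial.aeval x f = 0) : overK μ ∣ coordHom F b Q f := by
  set H : ℂ[X][X] := clear f (C (den F)) (C (b * den' F)) X Q (C X) with hH
  have hdd : den F * (b * den' F) ≠ 0 :=
    mul_ne_zero (den_ne_zero F) (mul_ne_zero hb hF.den'_ne_zero)
  have hH' := clear_coordHom hF hb (Q := Q) f
  rw [← hH] at hH'
  have hu : IsUnit (C (algebraMap ℂ[X] (RatFunc ℂ) ((den F * (b * den' F)) ^ f.totalDegree))) := by
    rw [isUnit_C, isUnit_iff_ne_zero, ne_eq, FaithfulSMul.algebraMap_eq_zero_iff]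
    exact pow_ne_zero _ hdd
  rw [← hu.dvd_mul_left, ← hH']
  by_contra hcon
  obtain ⟨u, v, g, hg, huv⟩ := exists_bezout ((irreducible_overK hμ).coprime_iff_not_dvd.2 hcon)
  obtain ⟨t, -, ht⟩ := (infinite_diff_roots (Set.infinite_univ (α := ℂ))
    (mul_ne_zero (mul_ne_zero hg hdd) X_ne_zero)).nonempty
  simp only [eval_mul, eval_X] at ht
  have hgt : g.eval t ≠ 0 := fun h => ht (by rw [h]; ring)
  have hdt : (den F).eval t ≠ 0 := fun h => ht (by rw [h]; ring)
  have hdt' : (b * den' F).eval t ≠ 0 := fun h => ht (by rw [eval_mul] at h; rw [h]; ring)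
  have ht0 : t ≠ 0 := fun h => ht (by rw [h]; ring)
  have hmon := (monic_of_mem hμ).map (evalRingHom t)
  obtain ⟨y, hy⟩ := IsAlgClosed.exists_root (μ.map (evalRingHom t)) (by
    rw [(monic_of_mem hμ).degree_map]
    refine ne_of_gt ?_
    have := (irreducible_overK hμ).degree_pos
    rwa [overK, (monic_of_mem hμ).degree_map] at this)
  have hyμ : evalAt t y μ = 0 := by rw [evalAt_eq]; exact hy
  have hyχ : evalAt t y (num F).charpoly = 0 := by
    obtain ⟨c, hc⟩ := dvd_charpoly_of_mem hμ
    rw [hc, map_mul, hyμ, zero_mul]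
  have hmem := hf _ (mem_curve0_of_root hQ ht0 hdt hdt' hyχ)
  have hC : ∀ p : ℂ[X], evalAt t y (C p) = p.eval t := fun p => by rw [evalAt_eq]; simp
  have hX : evalAt t y X = y := by rw [evalAt_eq]; simp
  have hHy : evalAt t y H = 0 := by
    have h1 := clear_eq f ((den F).eval t) ((b * den' F).eval t) (y / (den F).eval t)
      (evalAt t y Q / (b * den' F).eval t) t
    rw [mul_div_cancel₀ _ hdt, mul_div_cancel₀ _ hdt', hmem, mul_zero] at h1
    rw [hH, map_clear, hC, hC, hC, hX, eval_X]
    exact h1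
  have h2 := congrArg (evalAt t y) huv
  rw [map_add, map_mul, map_mul, hyμ, hHy, mul_zero, mul_zero, add_zero, hC] at h2
  exact hgt h2.symm

lemma charpoly_dvd_pow {p : (RatFunc ℂ)[X]} (h : ∀ μ ∈ factors F, overK μ ∣ p) :
    overK (num F).charpoly ∣ p ^ Multiset.card (factors F) := by
  have key : ∀ s : Multiset ℂ[X][X], (∀ μ ∈ s, overK μ ∣ p) →
      overK s.prod ∣ p ^ Multiset.card s := by
    intro s
    induction s using Multiset.induction_on with
    | empty => intro _; simp [overK]
    | cons a s ih =>
      intro hs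
      rw [Multiset.prod_cons, Multiset.card_cons, pow_succ', overK, Polynomial.map_mul]
      exact mul_dvd_mul (hs a (Multiset.mem_cons_self a s))
        (ih fun μ hμ => hs μ (Multiset.mem_cons_of_mem hμ))
  rw [← factors_prod]
  exact key _ h

/-- Over `ℂ(t)` this matrix is a polynomial in `numK F` divisible by every irreducible factor of the
characteristic polynomial. A power of it is divisible by the whole characteristic polynomial, and
Cayley–Hamilton applies. -/
lemma isNilpotent_clear (hF : IsAnalytic F) (hb : b ≠ 0) (hQ : b • num' F = aeval (num F) Q)
    {f : MvPolynomial (Fin 3) ℂ} (hf : ∀ μ ∈ factors F, overK μ ∣ coordHom F b Q f) :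
    IsNilpotent (clear f (den F • 1) (den' F • 1) (num F) (num' F)
      ((X : ℂ[X]) • (1 : Matrix (Fin m) (Fin m) ℂ[X]))) := by
  let i : ℂ[X] →+* RatFunc ℂ := algebraMap ℂ[X] (RatFunc ℂ)
  have hne : ∀ {p : ℂ[X]}, p ≠ 0 → i p ≠ 0 := by
    intro p hp
    rwa [ne_eq, FaithfulSMul.algebraMap_eq_zero_iff]
  have hd := hne (den_ne_zero F)
  have hd' := hne hF.den'_ne_zero
  have hb' := hne hb
  have hsm : ∀ p : ℂ[X], (p • (1 : Matrix (Fin m) (Fin m) ℂ[X])).map i = aeval (numK F) (C (i p)) := by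
    intro p
    rw [aeval_C]
    ext k l
    by_cases h : k = l <;> simp [h, Matrix.algebraMap_matrix_apply]
  have hq : numK' F = aeval (numK F) (C (i b)⁻¹ * overK Q) := by
    rw [map_mul, ← map_aeval_numK, ← hQ, aeval_C, ← Algebra.smul_def]
    ext k l
    simp [numK', i, hb']
  set c := Multiset.card (factors F)
  refine ⟨c, Matrix.map_injective (FaithfulSMul.algebraMap_injective ℂ[X] (RatFunc ℂ)) ?_⟩
  have h1 := map_clear (IsScalarTower.toAlgHom ℂ ℂ[X] (RatFunc ℂ)).mapMatrix f (den F • 1)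
    (den' F • 1) (num F) (num' F) ((X : ℂ[X]) • (1 : Matrix (Fin m) (Fin m) ℂ[X]))
  have h2 : ∀ M : Matrix (Fin m) (Fin m) ℂ[X],
      (IsScalarTower.toAlgHom ℂ ℂ[X] (RatFunc ℂ)).mapMatrix M = M.map i := fun M => rfl
  simp only [h2] at h1
  have h3 := map_clear ((aeval (R := RatFunc ℂ) (numK F)).restrictScalars ℂ) f (C (i (den F)))
    (C (i (den' F))) X (C (i b)⁻¹ * overK Q) (C (i X))
  simp only [AlgHom.restrictScalars_apply, aeval_X, ← hq, ← hsm] at h3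
  have h4 : clear f (C (i (den F))) (C (i (den' F))) X (C (i b)⁻¹ * overK Q) (C (i X)) =
      (C (i (den F)) * C (i (den' F))) ^ f.totalDegree * coordHom F b Q f := by
    have e1 : (X : (RatFunc ℂ)[X]) = C (i (den F)) * (C (i (den F))⁻¹ * X) := by
      rw [← mul_assoc, ← C_mul, mul_inv_cancel₀ hd, C_1, one_mul]
    have e2 : C (i b)⁻¹ * overK Q = C (i (den' F)) * (C (i (b * den' F))⁻¹ * overK Q) := by
      rw [← mul_assoc, ← C_mul, map_mul i, mul_inv, mul_left_comm, mul_inv_cancel₀ hd', mul_one]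
    conv_lhs => rw [e1, e2]
    rw [clear_eq, coordHom, coordFun]
    simp only [i, RatFunc.algebraMap_X]
  have h5 : (clear f (den F • 1) (den' F • 1) (num F) (num' F)
      ((X : ℂ[X]) • (1 : Matrix (Fin m) (Fin m) ℂ[X]))).map i =
      aeval (numK F) ((C (i (den F)) * C (i (den' F))) ^ f.totalDegree * coordHom F b Q f) := by
    rw [← h4, h3, h1]
    rfl
  have h6 : ∀ M : Matrix (Fin m) (Fin m) ℂ[X], (M ^ c).map i = (M.map i) ^ c := fun M =>
    map_pow i.mapMatrix M c
  refine (h6 _).trans ?_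
  rw [h5, ← map_pow]
  obtain ⟨r, hr⟩ : overK (num F).charpoly ∣
      ((C (i (den F)) * C (i (den' F))) ^ f.totalDegree * coordHom F b Q f) ^ c :=
    charpoly_dvd_pow fun μ hμ => (hf μ hμ).mul_left _
  rw [hr, map_mul, ← map_aeval_numK, Matrix.aeval_self_charpoly]
  simp

/-- On the common eigenvector at `x` the nilpotent matrix of `isNilpotent_clear` acts by `f(x)`
times a nonzero number, so `f(x) = 0`. This covers every point of `curve0`, including those over the
zeros of `b`, where `w` is not given by the formula with `Q`. -/
lemma vanish_of_dvd (hF : IsAnalytic F) (hb : b ≠ 0) (hQ : b • num' F = aeval (num F) Q)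
    {f : MvPolynomial (Fin 3) ℂ} (hf : ∀ μ ∈ factors F, overK μ ∣ coordHom F b Q f)
    {x : Fin 3 → ℂ} (hx : x ∈ curve0 F) : MvPolynomial.aeval x f = 0 := by
  set G : Matrix (Fin m) (Fin m) ℂ[X] :=
    clear f (den F • 1) (den' F • 1) (num F) (num' F)
      ((X : ℂ[X]) • (1 : Matrix (Fin m) (Fin m) ℂ[X])) with hG
  have hGnil : IsNilpotent G := isNilpotent_clear hF hb hQ hf
  rw [mem_curve0_iff] at hx
  obtain ⟨-, hd, hd', φ, hφ, h1, h2⟩ := hx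
  have hs : ∀ p : ℂ[X], (evalMat (x 2) (p • (1 : Matrix (Fin m) (Fin m) ℂ[X]))).mulVec φ =
      p.eval (x 2) • φ := by
    intro p
    have : evalMat (x 2) (p • (1 : Matrix (Fin m) (Fin m) ℂ[X])) = p.eval (x 2) • 1 := by
      ext i j
      by_cases h : i = j <;> simp [h]
    rw [this, Matrix.smul_mulVec, Matrix.one_mulVec]
  have hGφ : (evalMat (x 2) G).mulVec φ = clear f ((den F).eval (x 2)) ((den' F).eval (x 2))
      ((den F).eval (x 2) * x 0) ((den' F).eval (x 2) * x 1) (x 2) • φ := by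
    have h3 := map_clear (aeval (R := ℂ) (x 2)).mapMatrix f (den F • 1) (den' F • 1) (num F)
      (num' F) ((X : ℂ[X]) • (1 : Matrix (Fin m) (Fin m) ℂ[X]))
    have h4 : ∀ M : Matrix (Fin m) (Fin m) ℂ[X],
        (aeval (R := ℂ) (x 2)).mapMatrix M = evalMat (x 2) M := fun M => rfl
    simp only [h4] at h3
    rw [hG, h3]
    refine clear_mulVec f (hs _) (hs _) h1 h2 ?_
    rw [hs, eval_X]
  rw [clear_eq] at hGφ
  obtain ⟨n, hn⟩ := hGnil.map (evalMat (x 2))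
  have h5 : ∀ n : ℕ, ((evalMat (x 2) G) ^ n).mulVec φ =
      (((den F).eval (x 2) * (den' F).eval (x 2)) ^ f.totalDegree *
        MvPolynomial.aeval ![x 0, x 1, x 2] f) ^ n • φ := by
    intro n
    have := aeval_mulVec hGφ (X ^ n)
    simpa using this
  have h6 := h5 n
  rw [hn, Matrix.zero_mulVec] at h6
  have h7 := eq_zero_of_pow_eq_zero ((smul_eq_zero.1 h6.symm).resolve_right hφ)
  have h8 := (mul_eq_zero.1 h7).resolve_left (pow_ne_zero _ (mul_ne_zero hd hd'))
  rwa [show ![x 0, x 1, x 2] = x by ext i; fin_cases i <;> rfl] at h8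

/-! ### Irreducible pieces -/

/-- The ideal of the piece of the curve that belongs to an irreducible factor of the characteristic
polynomial. -/
def pieceIdeal (F : RatMatrix m) (b : ℂ[X]) (Q μ : ℂ[X][X]) : Ideal (MvPolynomial (Fin 3) ℂ) :=
  (Ideal.span {overK μ}).comap (coordHom F b Q)

lemma mem_pieceIdeal {μ : ℂ[X][X]} {f : MvPolynomial (Fin 3) ℂ} :
    f ∈ pieceIdeal F b Q μ ↔ overK μ ∣ coordHom F b Q f := by
  rw [pieceIdeal, Ideal.mem_comap, Ideal.mem_span_singleton]

lemma pieceIdeal_isPrime {μ : ℂ[X][X]} (hμ : μ ∈ factors F) : (pieceIdeal F b Q μ).IsPrime :=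
  have : (Ideal.span {overK μ}).IsPrime :=
    (Ideal.span_singleton_prime (irreducible_overK hμ).ne_zero).2 (irreducible_overK hμ).prime
  Ideal.IsPrime.comap _

/-- Vanishing passes to the closure by continuity, so the ideal of the curve is the intersection of
the `pieceIdeal`s. -/
lemma mem_vanishingIdeal_iff_forall_mem (hF : IsAnalytic F) (hb : b ≠ 0)
    (hQ : b • num' F = aeval (num F) Q) (f : MvPolynomial (Fin 3) ℂ) :
    f ∈ MvPolynomial.vanishingIdeal ℂ (curve3 F) ↔
      ∀ μ ∈ factors F, f ∈ pieceIdeal F b Q μ := by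
  have hcl : f ∈ MvPolynomial.vanishingIdeal ℂ (curve3 F) ↔
      ∀ x ∈ curve0 F, MvPolynomial.aeval x f = 0 := by
    rw [MvPolynomial.mem_vanishingIdeal_iff]
    refine ⟨fun h x hx => h x (subset_closure hx), fun h x hx => ?_⟩
    have hclosed : IsClosed {x : Fin 3 → ℂ | MvPolynomial.aeval x f = 0} := by
      refine isClosed_eq ?_ continuous_const
      simp only [MvPolynomial.aeval_eq_eval]
      exact MvPolynomial.continuous_eval f
    exact closure_minimal (fun x hx => h x hx) hclosed hx
  rw [hcl]
  simp only [mem_pieceIdeal]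
  exact ⟨fun h μ hμ => dvd_of_vanish hF hb hQ hμ h, fun h x hx => vanish_of_dvd hF hb hQ h hx⟩

/-- A two variable polynomial as a polynomial on `ℂ³`, the second variable being `d z`. -/
def liftPoly (F : RatMatrix m) : ℂ[X][X] →+* MvPolynomial (Fin 3) ℂ :=
  eval₂RingHom (aeval (R := ℂ) (MvPolynomial.X 2 : MvPolynomial (Fin 3) ℂ)).toRingHom
    (aeval (MvPolynomial.X 2 : MvPolynomial (Fin 3) ℂ) (den F) * MvPolynomial.X 0)

lemma coordHom_aeval_X (p : ℂ[X]) :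
    coordHom F b Q (aeval (MvPolynomial.X 2 : MvPolynomial (Fin 3) ℂ) p) =
      C (algebraMap ℂ[X] (RatFunc ℂ) p) := by
  rw [← aeval_algHom_apply, coordHom, MvPolynomial.aeval_X]
  simp only [coordFun, Matrix.cons_val]
  rw [← RatFunc.algebraMap_X, ← algebraMap_eq, aeval_algebraMap_apply, aeval_algebraMap_apply,
    aeval_X_left_apply]

lemma coordHom_liftPoly (p : ℂ[X][X]) : coordHom F b Q (liftPoly F p) = overK p := by
  have h : (coordHom F b Q).toRingHom.comp (liftPoly F) = mapRingHom (algebraMap ℂ[X] (RatFunc ℂ)) := by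
    refine ringHom_ext' (RingHom.ext fun r => ?_) ?_
    · change coordHom F b Q (liftPoly F (C r)) = _
      rw [liftPoly, coe_eval₂RingHom, eval₂_C]
      refine (coordHom_aeval_X r).trans ?_
      simp
    · change coordHom F b Q (liftPoly F X) = _
      rw [liftPoly, coe_eval₂RingHom, eval₂_X, map_mul, coordHom_aeval_X, coordHom,
        MvPolynomial.aeval_X]
      have hd : algebraMap ℂ[X] (RatFunc ℂ) (den F) ≠ 0 := by
        rw [ne_eq, FaithfulSMul.algebraMap_eq_zero_iff]; exact den_ne_zero F
      simp only [coordFun, Matrix.cons_val]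
      rw [← mul_assoc, ← C_mul, mul_inv_cancel₀ hd, C_1, one_mul, coe_mapRingHom, map_X]
  exact congrArg (fun g => g p) h

lemma eq_of_pieceIdeal_le {μ ν : ℂ[X][X]} (hμ : μ ∈ factors F) (hν : ν ∈ factors F)
    (h : pieceIdeal F b Q μ ≤ pieceIdeal F b Q ν) : μ = ν := by
  have h1 : liftPoly F μ ∈ pieceIdeal F b Q μ := by rw [mem_pieceIdeal, coordHom_liftPoly]
  have h2 := h h1
  rw [mem_pieceIdeal, coordHom_liftPoly] at h2
  exact (eq_of_overK_dvd hν hμ h2).symm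

/-- In a finite intersection of pairwise incomparable primes, these primes are the minimal ones. -/
lemma mem_minimalPrimes_iff (hF : IsAnalytic F) (hb : b ≠ 0)
    (hQ : b • num' F = aeval (num F) Q) (p : Ideal (MvPolynomial (Fin 3) ℂ)) :
    p ∈ (MvPolynomial.vanishingIdeal ℂ (curve3 F)).minimalPrimes ↔
      ∃ μ ∈ factors F, p = pieceIdeal F b Q μ := by
  classical
  have hle : ∀ μ ∈ factors F, MvPolynomial.vanishingIdeal ℂ (curve3 F) ≤ pieceIdeal F b Q μ :=
    fun μ hμ f hf => (mem_vanishingIdeal_iff_forall_mem hF hb hQ f).1 hf μ hμ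
  have hex : ∀ p : Ideal (MvPolynomial (Fin 3) ℂ), p.IsPrime →
      MvPolynomial.vanishingIdeal ℂ (curve3 F) ≤ p → ∃ μ ∈ factors F, pieceIdeal F b Q μ ≤ p := by
    intro p hp hIp
    have h1 : (factors F).toFinset.inf (pieceIdeal F b Q) ≤ p := by
      refine le_trans (fun f hf => ?_) hIp
      rw [mem_vanishingIdeal_iff_forall_mem hF hb hQ]
      intro μ hμ
      exact (Finset.inf_le (Multiset.mem_toFinset.2 hμ) : _ ≤ pieceIdeal F b Q μ) hf
    obtain ⟨μ, hμ, h⟩ := (Ideal.IsPrime.inf_le' hp).1 h1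
    exact ⟨μ, Multiset.mem_toFinset.1 hμ, h⟩
  constructor
  · rintro ⟨⟨hp, hIp⟩, hmin⟩
    obtain ⟨μ, hμ, h⟩ := hex p hp hIp
    exact ⟨μ, hμ, le_antisymm (hmin ⟨pieceIdeal_isPrime hμ, hle μ hμ⟩ h) h⟩
  · rintro ⟨μ, hμ, rfl⟩
    refine ⟨⟨pieceIdeal_isPrime hμ, hle μ hμ⟩, fun q hq hqμ => ?_⟩
    obtain ⟨ν, hν, h⟩ := hex q hq.1 hq.2
    rwa [eq_of_pieceIdeal_le hν hμ (h.trans hqμ)] at h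

end NormalSymbol

end

/-! ### Nondegeneracy, and the zeros of `z - λ` on a single piece. -/

noncomputable section

namespace NormalSymbol

open Polynomial

variable {m : ℕ} {F : RatMatrix m} {b : ℂ[X]} {Q μ : ℂ[X][X]}

lemma charpoly_eval_eq (F : RatMatrix m) (c : ℂ) :
    (num F).charpoly.eval (C c * den F) = (-1) ^ m * (shiftNum F c).det := by
  rw [Matrix.eval_charpoly, ← neg_sub, Matrix.det_neg, Fintype.card_fin, shiftNum,
    Matrix.scalar_apply, Matrix.smul_one_eq_diagonal]

lemma det_shiftNum_ne_zero (hF : IsNondegenerate F) (c : ℂ) : (shiftNum F c).det ≠ 0 := by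
  intro h
  obtain ⟨t, -, ht, hdet⟩ := hF c
  have hd : (den F).eval t ≠ 0 := by rwa [ne_eq, ← isPole_iff]
  have h1 := eval_det (shiftNum F c) t
  rw [h, eval_zero, evalMat_shiftNum_of_ne F c hd, Matrix.det_smul] at h1
  exact mul_ne_zero (pow_ne_zero _ hd) hdet h1.symm

lemma eval_factor_ne_zero (hF : IsNondegenerate F) (hμ : μ ∈ factors F) (c : ℂ) :
    μ.eval (C c * den F) ≠ 0 := by
  intro h
  obtain ⟨r, hr⟩ := dvd_charpoly_of_mem hμ
  have h1 := charpoly_eval_eq F c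
  rw [hr, eval_mul, h, zero_mul] at h1
  exact mul_ne_zero (pow_ne_zero _ (by norm_num)) (det_shiftNum_ne_zero hF c) h1.symm

/-! ### The function field of a piece -/

/-- The field generated by an eigenvalue of the numerator matrix. -/
abbrev EigField (μ : ℂ[X][X]) : Type := AdjoinRoot (overK μ)

/-- The homomorphism from polynomials on `ℂ³` to the functions on a piece. -/
def eigHom (F : RatMatrix m) (b : ℂ[X]) (Q μ : ℂ[X][X]) :
    MvPolynomial (Fin 3) ℂ →ₐ[ℂ] EigField μ :=
  ((AdjoinRoot.mkₐ (overK μ)).restrictScalars ℂ).comp (coordHom F b Q)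

lemma eigHom_apply (f : MvPolynomial (Fin 3) ℂ) :
    eigHom F b Q μ f = AdjoinRoot.mk (overK μ) (coordHom F b Q f) := rfl

lemma eigHom_eq_zero_iff (f : MvPolynomial (Fin 3) ℂ) :
    eigHom F b Q μ f = 0 ↔ f ∈ pieceIdeal F b Q μ := by
  rw [eigHom_apply, AdjoinRoot.mk_eq_zero, mem_pieceIdeal]

lemma eigHom_X_zero : algebraMap (RatFunc ℂ) (EigField μ) (algebraMap ℂ[X] (RatFunc ℂ) (den F)) *
    eigHom F b Q μ (MvPolynomial.X 0) = AdjoinRoot.root (overK μ) := by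
  have h := congrArg (AdjoinRoot.mk (overK μ)) (coordHom_liftPoly (F := F) (b := b) (Q := Q) X)
  have h1 : liftPoly F X =
      aeval (MvPolynomial.X 2 : MvPolynomial (Fin 3) ℂ) (den F) * MvPolynomial.X 0 := by
    rw [liftPoly, coe_eval₂RingHom, eval₂_X]
  rw [h1, map_mul, map_mul, coordHom_aeval_X,
    show overK X = X from map_X _, AdjoinRoot.mk_X] at h
  exact h

lemma eigHom_X_two : eigHom F b Q μ (MvPolynomial.X 2) =
    algebraMap (RatFunc ℂ) (EigField μ) RatFunc.X := by
  rw [eigHom_apply, coordHom, MvPolynomial.aeval_X]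
  rfl

/-- If `z` were algebraic over `ℂ` it would be a constant `c`. Then `y = c d`, so `μ` has the root
`c d`, which nondegeneracy forbids (`eval_factor_ne_zero`). -/
lemma transcendental_eigHom_X_zero (hF : IsNondegenerate F) (hμ : μ ∈ factors F) :
    Transcendental ℂ (eigHom F b Q μ (MvPolynomial.X 0)) := by
  have : Fact (Irreducible (overK μ)) := ⟨irreducible_overK hμ⟩
  intro halg
  obtain ⟨c, hc⟩ := minpoly.mem_range_of_degree_eq_one ℂ _
    (IsAlgClosed.degree_eq_one_of_irreducible ℂ (minpoly.irreducible halg.isIntegral))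
  have h1 := eigHom_X_zero (F := F) (b := b) (Q := Q) (μ := μ)
  rw [← hc, IsScalarTower.algebraMap_apply ℂ (RatFunc ℂ) (EigField μ), ← map_mul,
    IsScalarTower.algebraMap_apply ℂ ℂ[X] (RatFunc ℂ), ← map_mul, mul_comm, algebraMap_eq] at h1
  set a : ℂ[X] := C c * den F with ha
  have h2 : overK μ ∣ overK (X - C a) := by
    have h3 : overK (X - C a) = X - C (algebraMap ℂ[X] (RatFunc ℂ) a) := by
      rw [overK, Polynomial.map_sub, map_X, map_C]
    rw [← AdjoinRoot.mk_eq_zero, h3, map_sub, AdjoinRoot.mk_X, AdjoinRoot.mk_C, ← h1]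
    exact sub_self _
  have h3 : overK (X - C a) ∣ overK μ := by
    refine ((irreducible_overK hμ).associated_of_dvd ?_ h2).symm.dvd
    rw [overK, Polynomial.map_sub, map_X, map_C]
    exact irreducible_X_sub_C _
  obtain ⟨r, hr⟩ := h3
  apply eval_factor_ne_zero hF hμ c
  apply FaithfulSMul.algebraMap_injective ℂ[X] (RatFunc ℂ)
  have h4 := congrArg (eval (algebraMap ℂ[X] (RatFunc ℂ) a)) hr
  rw [overK, eval_map_algebraMap, aeval_algebraMap_apply] at h4
  rw [map_zero]
  refine h4.trans ?_
  simp [overK]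

/-- The coordinate ring embeds in `ℂ(t)[y]/(μ)` because `pieceIdeal` is the kernel of `eigHom`; the
fraction field is everything because `t` and `y = d z` generate. -/
lemma exists_functionField_equiv (hμ : μ ∈ factors F) (j : Piece (curve3 F))
    (hj : j.1 = pieceIdeal F b Q μ) :
    ∃ e : EigField μ ≃ₐ[ℂ] j.FunctionField, ∀ i,
      e (eigHom F b Q μ (MvPolynomial.X i)) = j.coord i := by
  have : Fact (Irreducible (overK μ)) := ⟨irreducible_overK hμ⟩
  let g : (MvPolynomial (Fin 3) ℂ ⧸ j.1) →ₐ[ℂ] EigField μ :=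
    Ideal.Quotient.liftₐ j.1 (eigHom F b Q μ) fun f hf => by
      rwa [eigHom_eq_zero_iff, ← hj]
  have hg : Function.Injective g := by
    rw [injective_iff_map_eq_zero]
    intro x
    obtain ⟨f, rfl⟩ := Ideal.Quotient.mk_surjective x
    intro h
    rw [Ideal.Quotient.eq_zero_iff_mem, hj, ← eigHom_eq_zero_iff]
    exact h
  let G : j.FunctionField →ₐ[ℂ] EigField μ := IsFractionRing.liftAlgHom hg
  have hG : ∀ f, G (algebraMap _ _ (Ideal.Quotient.mk j.1 f)) = eigHom F b Q μ f := by
    intro f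
    simp only [G, IsFractionRing.liftAlgHom_apply, IsFractionRing.lift_algebraMap]
    rfl
  have hsurj : Function.Surjective G := by
    intro x
    obtain ⟨u, rfl⟩ := AdjoinRoot.mk_surjective x
    obtain ⟨a, U, ha, hU⟩ := exists_overK_eq u
    have ha' : algebraMap ℂ[X] (RatFunc ℂ) a ≠ 0 := by
      rwa [ne_eq, FaithfulSMul.algebraMap_eq_zero_iff]
    refine ⟨algebraMap _ _ (Ideal.Quotient.mk j.1 (liftPoly F U)) /
      algebraMap _ _ (Ideal.Quotient.mk j.1 (aeval (MvPolynomial.X 2) a)), ?_⟩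
    rw [map_div₀, hG, hG, eigHom_apply, eigHom_apply, coordHom_liftPoly, coordHom_aeval_X, hU,
      map_mul, mul_div_cancel_left₀]
    rw [AdjoinRoot.mk_C]
    exact (_root_.map_ne_zero _).2 ha'
  let e := AlgEquiv.ofBijective G ⟨G.toRingHom.injective, hsurj⟩
  refine ⟨e.symm, fun i => ?_⟩
  rw [AlgEquiv.symm_apply_eq]
  exact (hG _).symm

/-- The zeros of `z - lam` on the `+` half of a piece, counted with their orders. -/
theorem tsum_zeroOrder_eq (hF : NDARN F) (hμ : μ ∈ factors F) (j : Piece (curve3 F))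
    (hj : j.1 = pieceIdeal F b Q μ) (lam : ℂ) :
    Finite {P : Place j // P.IsPlus ∧ P.HasValue (j.coord 0) lam} ∧
    ∑' P : {P : Place j // P.IsPlus ∧ P.HasValue (j.coord 0) lam},
      P.1.zeroOrder (j.coord 0 - algebraMap ℂ j.FunctionField lam) =
    (Multiset.card (discRoots (μ.eval (C lam * den F))) : ℕ∞) := by
  have : Fact (Irreducible (overK μ)) := ⟨irreducible_overK hμ⟩
  obtain ⟨e, he⟩ := exists_functionField_equiv hμ j hj
  let φ : RatFunc ℂ →ₐ[ℂ] j.FunctionField :=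
    e.toAlgHom.comp (IsScalarTower.toAlgHom ℂ (RatFunc ℂ) (EigField μ))
  let _ : Algebra (RatFunc ℂ) j.FunctionField := φ.toRingHom.toAlgebra
  let _ : Algebra ℂ[X] j.FunctionField :=
    (φ.toRingHom.comp (algebraMap ℂ[X] (RatFunc ℂ))).toAlgebra
  have : IsScalarTower ℂ[X] (RatFunc ℂ) j.FunctionField := IsScalarTower.of_algebraMap_eq fun _ => rfl
  have : IsScalarTower ℂ ℂ[X] j.FunctionField := IsScalarTower.of_algebraMap_eq fun c => by
    change _ = φ (algebraMap ℂ[X] (RatFunc ℂ) (algebraMap ℂ ℂ[X] c))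
    rw [← IsScalarTower.algebraMap_apply, AlgHom.commutes]
  let e' : EigField μ ≃ₐ[RatFunc ℂ] j.FunctionField :=
    AlgEquiv.ofRingEquiv (f := e.toRingEquiv) fun _ => rfl
  have hmon : (overK μ).Monic := (monic_of_mem hμ).map _
  let B : PowerBasis (RatFunc ℂ) j.FunctionField := (AdjoinRoot.powerBasis' hmon).map e'
  have hfin : FiniteDimensional (RatFunc ℂ) j.FunctionField := B.finite
  have hgen : B.gen = e (AdjoinRoot.root (overK μ)) := rfl
  have hB : minpoly (RatFunc ℂ) B.gen = μ.map (algebraMap ℂ[X] (RatFunc ℂ)) := by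
    have h1 : minpoly (RatFunc ℂ) B.gen = minpoly (RatFunc ℂ) (AdjoinRoot.root (overK μ)) :=
      minpoly.algEquiv_eq e' _
    rw [h1, AdjoinRoot.minpoly_root hmon.ne_zero, hmon.leadingCoeff, inv_one, C_1, mul_one]
  have hz : algebraMap ℂ[X] j.FunctionField (den F) * j.coord 0 = B.gen := by
    rw [hgen, ← eigHom_X_zero (F := F) (b := b) (Q := Q), map_mul, he]
    rfl
  have ht : j.coord 2 = algebraMap ℂ[X] j.FunctionField X := by
    rw [← he, eigHom_X_two, ← RatFunc.algebraMap_X]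
    rfl
  have hint : IsIntegral ℂ[X] (algebraMap ℂ[X] j.FunctionField (den F) * j.coord 0) := by
    refine ⟨μ, monic_of_mem hμ, ?_⟩
    have h := minpoly.aeval (RatFunc ℂ) B.gen
    rw [hB, aeval_map_algebraMap] at h
    rw [hz]
    exact h
  have htr : Transcendental ℂ (j.coord 0) := by
    rw [← he]
    exact (isAlgebraic_algHom_iff e.toAlgHom e.injective).not.2
      (transcendental_eigHom_X_zero hF.nondegenerate hμ)
  have hplace : ∀ (P : Place j) (c : ℂ), P.HasValue (j.coord 2) c → IsPlaceAt P.ring c :=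
    fun P c h => ⟨P.const_mem, P.dvr, by rw [← ht]; exact h⟩
  have hplace' : ∀ (V : ValuationSubring j.FunctionField) (c : ℂ) (h : IsPlaceAt V c),
      (⟨V, h.const_mem, h.dvr⟩ : Place j).HasValue (j.coord 2) c := by
    intro V c h
    have h1 := h.value
    rw [← ht] at h1
    exact h1
  have hreg : ∀ (P : Place j) (c : ℂ), ‖c‖ ≤ 1 → P.HasValue (j.coord 2) c →
      P.Regular (j.coord 0) := fun P c hc h =>
    (hplace P c h).mem_of_mul_isIntegral (hF.analytic.den_eval_ne_zero hc) hint
  -- `z` is regular wherever `|t| ≤ 1`, so the inner half qualifies. Being transcendental, `z` has a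
  -- pole; it lies where `|t| > 1` or `t = ∞`, so the outer half does not qualify.
  have hplus : ∀ P : Place j, P.IsPlus ↔ P.IsInner := by
    intro P
    refine ⟨fun h => h.elim (fun h => h.1) fun h => ?_, fun h => Or.inl ⟨h, ?_⟩⟩
    · exfalso
      obtain ⟨V, hV, hdvr, hzV⟩ := exists_isDiscreteValuationRing_notMem φ hfin htr
      refine hzV (h.2 ⟨V, hV, hdvr⟩ ?_)
      by_cases htV : j.coord 2 ∈ V
      · right
        obtain ⟨c, hc⟩ := exists_isPlaceAt hV hdvr (by rwa [← ht])
        have hc2 := hplace' V c hc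
        refine ⟨c, ?_, hc2⟩
        by_contra! hle
        exact hzV (hreg ⟨V, hV, hdvr⟩ c hle hc2)
      · exact Or.inl htV
    · rintro R ⟨c, hc, hR⟩
      exact hreg R c hc.le hR
  let E : {P : Place j // P.IsPlus ∧ P.HasValue (j.coord 0) lam} ≃
      {V : ValuationSubring j.FunctionField // (∃ c : ℂ, ‖c‖ < 1 ∧ IsPlaceAt V c) ∧
        V.valuation (j.coord 0 - algebraMap ℂ j.FunctionField lam) < 1} :=
    { toFun := fun P => ⟨P.1.ring, by
        obtain ⟨c, hc, h⟩ := (hplus P.1).1 P.2.1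
        exact ⟨c, hc, hplace P.1 c h⟩, P.2.2⟩
      invFun := fun V => ⟨⟨V.1, V.2.1.choose_spec.2.const_mem, V.2.1.choose_spec.2.dvr⟩,
        (hplus _).2 ⟨_, V.2.1.choose_spec.1, hplace' _ _ V.2.1.choose_spec.2⟩, V.2.2⟩
      left_inv := fun P => rfl
      right_inv := fun V => rfl }
  obtain ⟨hfinite, hsum⟩ := tsum_ringOrder_eq B (monic_of_mem hμ) hB
    (fun c hc => hF.analytic.den_eval_ne_zero hc.le) hz
    (eval_factor_ne_zero hF.nondegenerate hμ lam)
  refine ⟨Finite.of_equiv _ E.symm, Eq.trans ?_ hsum⟩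
  exact Eq.trans (tsum_congr fun P => rfl) (E.tsum_eq fun V =>
    ringOrder V.1 V.2.1.choose_spec.2.dvr (j.coord 0 - algebraMap ℂ j.FunctionField lam))

end NormalSymbol

end

noncomputable section

namespace NormalSymbol

open Polynomial

variable {m : ℕ} {F : RatMatrix m} {b : ℂ[X]} {Q μ : ℂ[X][X]}

/-! ### Points of a piece -/

/-- A two variable polynomial as a polynomial on `ℂ³`, in `t` and another coordinate. -/
def substCoord (i : Fin 3) : ℂ[X][X] →+* MvPolynomial (Fin 3) ℂ :=
  eval₂RingHom (aeval (R := ℂ) (MvPolynomial.X 2 : MvPolynomial (Fin 3) ℂ)).toRingHom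
    (MvPolynomial.X i)

lemma aeval_substCoord (i : Fin 3) (g : ℂ[X][X]) (x : Fin 3 → ℂ) :
    MvPolynomial.aeval x (substCoord i g) = evalAt (x 2) (x i) g := by
  have h : (MvPolynomial.aeval (R := ℂ) x).toRingHom.comp (substCoord i) =
      (evalAt (x 2) (x i)).toRingHom := by
    refine ringHom_ext' (RingHom.ext fun r => ?_) ?_
    · change MvPolynomial.aeval x (substCoord i (C r)) = evalAt (x 2) (x i) (C r)
      rw [substCoord, coe_eval₂RingHom, eval₂_C, evalAt_eq, map_C, eval_C]
      refine (aeval_algHom_apply (MvPolynomial.aeval (R := ℂ) x) _ r).symm.trans ?_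
      rw [MvPolynomial.aeval_X, coe_aeval_eq_eval, coe_evalRingHom]
    · change MvPolynomial.aeval x (substCoord i X) = evalAt (x 2) (x i) X
      rw [substCoord, coe_eval₂RingHom, eval₂_X, evalAt_eq, map_X, eval_X, MvPolynomial.aeval_X]
  exact congrArg (fun f => f g) h

lemma aeval_liftPoly (g : ℂ[X][X]) (x : Fin 3 → ℂ) :
    MvPolynomial.aeval x (liftPoly F g) = evalAt (x 2) ((den F).eval (x 2) * x 0) g := by
  have h : (MvPolynomial.aeval (R := ℂ) x).toRingHom.comp (liftPoly F) =
      (evalAt (x 2) ((den F).eval (x 2) * x 0)).toRingHom := by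
    have h1 : ∀ r : ℂ[X], MvPolynomial.aeval x
        (aeval (MvPolynomial.X 2 : MvPolynomial (Fin 3) ℂ) r) = r.eval (x 2) := by
      intro r
      rw [← aeval_algHom_apply, MvPolynomial.aeval_X, coe_aeval_eq_eval]
    refine ringHom_ext' (RingHom.ext fun r => ?_) ?_
    · change MvPolynomial.aeval x (liftPoly F (C r)) = evalAt (x 2) _ (C r)
      rw [liftPoly, coe_eval₂RingHom, eval₂_C, evalAt_eq, map_C, eval_C]
      exact h1 r
    · change MvPolynomial.aeval x (liftPoly F X) = evalAt (x 2) _ X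
      rw [liftPoly, coe_eval₂RingHom, eval₂_X, evalAt_eq, map_X, eval_X, map_mul, h1,
        MvPolynomial.aeval_X]
  exact congrArg (fun f => f g) h

lemma eigHom_substCoord (i : Fin 3) (g : ℂ[X][X]) :
    eigHom F b Q μ (substCoord i g) = aeval (eigHom F b Q μ (MvPolynomial.X i)) g := by
  have h : (eigHom F b Q μ).toRingHom.comp (substCoord i) =
      (aeval (R := ℂ[X]) (eigHom F b Q μ (MvPolynomial.X i))).toRingHom := by
    refine ringHom_ext' (RingHom.ext fun r => ?_) ?_
    · change eigHom F b Q μ (substCoord i (C r)) = aeval _ (C r)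
      rw [substCoord, coe_eval₂RingHom, eval₂_C, aeval_C]
      refine (congrArg (AdjoinRoot.mk (overK μ)) (coordHom_aeval_X r)).trans ?_
      rfl
    · change eigHom F b Q μ (substCoord i X) = aeval _ X
      rw [substCoord, coe_eval₂RingHom, eval₂_X, aeval_X]
  exact congrArg (fun f => f g) h

/-- Each coordinate is algebraic over `ℂ(t)`. Dividing its equation by the highest possible power of
`X - C t` keeps it nontrivial on the given fibre, which makes fibres finite. -/
lemma exists_relation (hμ : μ ∈ factors F) (i : Fin 3) (t : ℂ) :
    ∃ g : ℂ[X][X], substCoord i g ∈ pieceIdeal F b Q μ ∧ g.map (evalRingHom t) ≠ 0 := by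
  have : Fact (Irreducible (overK μ)) := ⟨irreducible_overK hμ⟩
  have hfin : FiniteDimensional (RatFunc ℂ) (EigField μ) :=
    (AdjoinRoot.powerBasis (irreducible_overK hμ).ne_zero).finite
  set a := eigHom F b Q μ (MvPolynomial.X i) with ha
  have halg : IsAlgebraic ℂ[X] a :=
    (IsFractionRing.isAlgebraic_iff ℂ[X] (RatFunc ℂ) (EigField μ)).2
      (Algebra.IsAlgebraic.isAlgebraic a)
  obtain ⟨g, hg0, hg⟩ := halg
  have hmul : FiniteMultiplicity (C (X - C t)) g := by
    refine FiniteMultiplicity.of_not_isUnit ?_ hg0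
    rw [isUnit_C]
    exact not_isUnit_X_sub_C t
  obtain ⟨g', hg', hnd⟩ := hmul.exists_eq_pow_mul_and_not_dvd
  refine ⟨g', ?_, fun h0 => hnd ?_⟩
  · rw [← eigHom_eq_zero_iff, eigHom_substCoord]
    rw [hg', map_mul, map_pow, aeval_C] at hg
    refine (mul_eq_zero.1 hg).resolve_left (pow_ne_zero _ ?_)
    rw [IsScalarTower.algebraMap_apply ℂ[X] (RatFunc ℂ) (EigField μ)]
    refine (_root_.map_ne_zero _).2 ?_
    rw [ne_eq, FaithfulSMul.algebraMap_eq_zero_iff]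
    exact X_sub_C_ne_zero t
  · rw [C_dvd_iff_dvd_coeff]
    intro n
    rw [dvd_iff_isRoot]
    have := congrArg (fun p => coeff p n) h0
    simpa using this

lemma finite_fibre (hμ : μ ∈ factors F) (t : ℂ) :
    {x ∈ MvPolynomial.zeroLocus ℂ (pieceIdeal F b Q μ) | x 2 = t}.Finite := by
  choose g hg hg0 using fun i => exists_relation (b := b) (Q := Q) hμ i t
  refine Set.Finite.subset (Set.Finite.pi' fun i =>
    ((g i).map (evalRingHom t)).roots.toFinset.finite_toSet) fun x hx i => ?_
  obtain ⟨hx, rfl⟩ := hx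
  have h1 := hx _ (hg i)
  rw [aeval_substCoord, evalAt_eq] at h1
  simpa [hg0 i] using h1

/-- On a finite piece the Nullstellensatz and primality would put some `t - c` into the ideal; but
`t - c` is a unit over `ℂ(t)`. -/
lemma infinite_points (hμ : μ ∈ factors F) :
    (MvPolynomial.zeroLocus ℂ (pieceIdeal F b Q μ)).Infinite := by
  intro hfin
  have hp := pieceIdeal_isPrime (b := b) (Q := Q) hμ
  have h1 : ∏ x ∈ hfin.toFinset, (MvPolynomial.X 2 - MvPolynomial.C (x 2)) ∈
      pieceIdeal F b Q μ := by
    have hrad := MvPolynomial.vanishingIdeal_zeroLocus_eq_radical (K := ℂ) (pieceIdeal F b Q μ)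
    rw [hp.radical] at hrad
    refine hrad.le ?_
    rw [MvPolynomial.mem_vanishingIdeal_iff]
    intro x hx
    rw [map_prod]
    exact Finset.prod_eq_zero (hfin.mem_toFinset.2 hx) (by simp)
  obtain ⟨x, -, hx⟩ := (Ideal.IsPrime.prod_mem_iff (hp := hp)).1 h1
  have h2 := coordHom_aeval_X (F := F) (b := b) (Q := Q) (X - C (x 2))
  rw [map_sub, aeval_X, aeval_C] at h2
  rw [mem_pieceIdeal, ← MvPolynomial.algebraMap_eq, h2] at hx
  refine (irreducible_overK hμ).not_isUnit (isUnit_of_dvd_unit hx ?_)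
  rw [isUnit_C, isUnit_iff_ne_zero, ne_eq, FaithfulSMul.algebraMap_eq_zero_iff]
  exact X_sub_C_ne_zero _

/-! ### Multiplicities -/

/-- The product of the distinct irreducible factors of the characteristic polynomial. -/
def radicalPoly (F : RatMatrix m) : ℂ[X][X] :=
  open Classical in ∏ ν ∈ (factors F).toFinset, ν

lemma dvd_radicalPoly {ν : ℂ[X][X]} (hν : ν ∈ factors F) : ν ∣ radicalPoly F := by
  classical
  exact Finset.dvd_prod_of_mem _ (Multiset.mem_toFinset.2 hν)

/-- A power of the radical is divisible by the characteristic polynomial, so the value is nilpotent,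
hence zero by normality. With `exists_separable` this makes the matrix diagonalizable at almost
every point. -/
lemma aeval_radicalPoly (hF : IsAnalytic F) (hN : IsNormal F) :
    aeval (num F) (radicalPoly F) = 0 := by
  refine aeval_num_eq_zero hF hN _ ⟨Multiset.card (factors F),
    Matrix.map_injective (FaithfulSMul.algebraMap_injective ℂ[X] (RatFunc ℂ)) ?_⟩
  obtain ⟨r, hr⟩ := charpoly_dvd_pow (F := F) (p := overK (radicalPoly F)) fun ν hν =>
    map_dvd (mapRingHom (algebraMap ℂ[X] (RatFunc ℂ))) (dvd_radicalPoly hν)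
  dsimp only
  rw [← map_pow, map_aeval_numK, overK, Polynomial.map_pow, hr, map_mul, ← map_aeval_numK,
    Matrix.aeval_self_charpoly]
  simp

lemma separable_radicalPoly (F : RatMatrix m) : (overK (radicalPoly F)).Separable := by
  classical
  rw [radicalPoly, overK, Polynomial.map_prod]
  refine separable_prod' (fun μ hμ ν hν h => ?_) fun μ hμ => ?_
  · exact isCoprime_overK (Multiset.mem_toFinset.1 hμ) (Multiset.mem_toFinset.1 hν) h
  · exact (irreducible_overK (Multiset.mem_toFinset.1 hμ)).separable

/-- Over almost every point, the distinct eigenvalues are distinct simple roots. -/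
lemma exists_separable (F : RatMatrix m) :
    ∃ g : ℂ[X], g ≠ 0 ∧ ∀ t, g.eval t ≠ 0 →
      ((radicalPoly F).map (evalRingHom t)).Separable := by
  have h := separable_radicalPoly F
  rw [Separable, overK, derivative_map] at h
  obtain ⟨u, v, g, hg, huv⟩ := exists_bezout h
  refine ⟨g, hg, fun t ht => ?_⟩
  rw [Separable, derivative_map]
  have h1 := congrArg (map (evalRingHom t)) huv
  rw [Polynomial.map_add, Polynomial.map_mul, Polynomial.map_mul, map_C, coe_evalRingHom] at h1
  refine ⟨C (g.eval t)⁻¹ * u.map (evalRingHom t), C (g.eval t)⁻¹ * v.map (evalRingHom t), ?_⟩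
  rw [mul_assoc, mul_assoc, ← mul_add, h1, ← C_mul, inv_mul_cancel₀ ht, C_1]

/-- The dimension of an eigenspace of a matrix annihilated by a separable polynomial. -/
lemma finrank_eigenspace_eq (A : Matrix (Fin m) (Fin m) ℂ) {p : ℂ[X]} (hp : p.Separable)
    (hA : aeval A p = 0) (y : ℂ) :
    Module.finrank ℂ (Module.End.eigenspace (Matrix.toLin' A) y) = A.charpoly.rootMultiplicity y := by
  have h0 : aeval (Matrix.toLin' A) p = 0 := by
    have := aeval_algHom_apply (Matrix.toLinAlgEquiv' (R := ℂ) (n := Fin m)).toAlgHom A p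
    rw [hA, map_zero] at this
    exact this
  have hss : Module.End.IsSemisimple (Matrix.toLin' A) :=
    Module.End.isSemisimple_of_squarefree_aeval_eq_zero hp.squarefree h0
  have h1 := hss.isFinitelySemisimple.maxGenEigenspace_eq_eigenspace y
  rw [← h1, LinearMap.finrank_maxGenEigenspace_eq, ← LinearMap.charpoly_toMatrix _ (Pi.basisFun ℂ (Fin m)),
    ← Matrix.toLin_eq_toLin', LinearMap.toMatrix_toLin]

lemma nu_eq {x : Fin 3 → ℂ} (hd : (den F).eval (x 2) ≠ 0) :
    nu F x = Module.finrank ℂ (Module.End.eigenspace (Matrix.toLin' (evalMat (x 2) (num F)))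
      ((den F).eval (x 2) * x 0)) := by
  have : Module.End.eigenspace (Matrix.toLin' (value F (x 2))) (x 0) =
      Module.End.eigenspace (Matrix.toLin' (evalMat (x 2) (num F)))
        ((den F).eval (x 2) * x 0) := by
    ext v
    rw [Module.End.mem_eigenspace_iff, Module.End.mem_eigenspace_iff, evalMat_num F hd,
      map_smul, LinearMap.smul_apply, mul_smul]
    exact (smul_right_injective _ hd).eq_iff.symm
  rw [nu, this]

/-- Separability of the specialized radical makes `y` a simple root of `μ` and of no other factor,
so only the copies of `μ` contribute, one each. -/
lemma rootMultiplicity_charpoly_eq (hμ : μ ∈ factors F) {t y : ℂ}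
    (hsep : ((radicalPoly F).map (evalRingHom t)).Separable) (hy : evalAt t y μ = 0) :
    (evalMat t (num F)).charpoly.rootMultiplicity y = open Classical in (factors F).count μ := by
  classical
  rw [evalAt_eq] at hy
  have hmon : ∀ ν ∈ factors F, (ν.map (evalRingHom t)).Monic := fun ν hν =>
    (monic_of_mem hν).map _
  have h1 : (evalMat t (num F)).charpoly =
      ((factors F).map (map (evalRingHom t))).prod := by
    rw [← Polynomial.coe_mapRingHom, Multiset.prod_hom, factors_prod]
    exact Matrix.charpoly_map _ _
  have h0 : (0 : ℂ[X]) ∉ (factors F).map (map (evalRingHom t)) := by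
    intro h
    obtain ⟨ν, hν, h⟩ := Multiset.mem_map.1 h
    exact (hmon ν hν).ne_zero h
  have hmult : ∀ ν ∈ factors F, (ν.map (evalRingHom t)).roots.count y = if μ = ν then 1 else 0 := by
    intro ν hν
    split_ifs with h
    · subst h
      have hs : (μ.map (evalRingHom t)).Separable :=
        hsep.of_dvd (map_dvd (mapRingHom (evalRingHom t)) (dvd_radicalPoly hν))
      rw [count_roots]
      refine le_antisymm (rootMultiplicity_le_one_of_separable hs y) ?_
      exact (rootMultiplicity_pos (hmon μ hμ).ne_zero).2 hy
    · rw [Multiset.count_eq_zero, mem_roots (hmon ν hν).ne_zero]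
      intro hνy
      have hdvd : μ * ν ∣ radicalPoly F := by
        rw [radicalPoly, ← Finset.mul_prod_erase _ _ (Multiset.mem_toFinset.2 hμ)]
        exact mul_dvd_mul_left _ (Finset.dvd_prod_of_mem _
          (Finset.mem_erase.2 ⟨fun e => h e.symm, Multiset.mem_toFinset.2 hν⟩))
      have hs : ((μ * ν).map (evalRingHom t)).Separable :=
        hsep.of_dvd (map_dvd (mapRingHom (evalRingHom t)) hdvd)
      rw [Polynomial.map_mul] at hs
      obtain ⟨u, v, huv⟩ := hs.isCoprime
      have := congrArg (eval y) huv
      rw [eval_add, eval_mul, eval_mul, hy, hνy.eq_zero, mul_zero, mul_zero, eval_one] at this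
      norm_num at this
  rw [← count_roots, h1, roots_multiset_prod _ h0, Multiset.count_bind, Multiset.map_map]
  have h2 : (factors F).map ((fun p : ℂ[X] => p.roots.count y) ∘ map (evalRingHom t)) =
      (factors F).map fun ν => if μ = ν then 1 else 0 := Multiset.map_congr rfl hmult
  rw [h2]
  generalize factors F = s
  induction s using Multiset.induction_on with
  | empty => simp
  | cons a s ih => rw [Multiset.map_cons, Multiset.sum_cons, ih, Multiset.count_cons, add_comm]

/-- Outside finitely many fibres the geometric and algebraic multiplicities agree and equal the
exponent of `μ`. Fibres are finite and the piece is infinite, so exactly one number satisfies the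
condition in `pieceMult`. -/
theorem pieceMult_eq (hF : NDARN F) (hμ : μ ∈ factors F) (j : Piece (curve3 F))
    (hj : j.1 = pieceIdeal F b Q μ) :
    pieceMult F j = open Classical in (factors F).count μ := by
  classical
  obtain ⟨g, hg, hsep⟩ := exists_separable F
  have hpts : j.points = MvPolynomial.zeroLocus ℂ (pieceIdeal F b Q μ) := by rw [Piece.points, hj]
  have hnu : ∀ x ∈ j.points, (g * den F).eval (x 2) ≠ 0 → nu F x = (factors F).count μ := by
    intro x hx hne
    rw [eval_mul] at hne
    obtain ⟨hgx, hd⟩ := mul_ne_zero_iff.1 hne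
    have hmem : liftPoly F μ ∈ pieceIdeal F b Q μ := by rw [mem_pieceIdeal, coordHom_liftPoly]
    rw [hpts] at hx
    have hroot := hx _ hmem
    rw [aeval_liftPoly] at hroot
    rw [nu_eq hd, finrank_eigenspace_eq _ (hsep _ hgx), rootMultiplicity_charpoly_eq hμ (hsep _ hgx)
      hroot]
    rw [← evalMat_aeval, aeval_radicalPoly hF.analytic hF.normal, map_zero]
  have hbad : {x ∈ j.points | nu F x ≠ (factors F).count μ}.Finite := by
    have hfin : (⋃ t ∈ (g * den F).roots.toFinset,
        {x ∈ MvPolynomial.zeroLocus ℂ (pieceIdeal F b Q μ) | x 2 = t}).Finite :=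
      Set.Finite.biUnion (Finset.finite_toSet _) fun t _ => finite_fibre hμ t
    refine hfin.subset fun x hx => ?_
    have h0 : (g * den F).eval (x 2) = 0 := by
      by_contra h
      exact hx.2 (hnu x hx.1 h)
    refine Set.mem_iUnion₂.2 ⟨x 2, ?_, hpts ▸ hx.1, rfl⟩
    rw [Multiset.mem_toFinset, mem_roots (mul_ne_zero hg (den_ne_zero F))]
    exact h0
  have hset : {n : ℕ | {x ∈ j.points | nu F x ≠ n}.Finite} = {(factors F).count μ} := by
    ext n
    refine ⟨fun hn => ?_, fun hn => ?_⟩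
    · by_contra hne
      refine infinite_points (b := b) (Q := Q) hμ ((hbad.union hn).subset fun x hx => ?_)
      rw [← hpts] at hx
      by_cases h : nu F x = (factors F).count μ
      · exact Or.inr ⟨hx, fun h' => hne (h'.symm.trans h)⟩
      · exact Or.inl ⟨hx, h⟩
    · rw [hn]
      exact hbad
  rw [pieceMult, hset, csInf_singleton]

end NormalSymbol

end

/-! ### Summation over the pieces. -/

noncomputable section

namespace NormalSymbol

open Polynomial

variable {m : ℕ} {F : RatMatrix m}

lemma discRoots_C_mul {c : ℂ} (hc : c ≠ 0) (p : ℂ[X]) : discRoots (C c * p) = discRoots p := by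
  rw [discRoots, discRoots, roots_C_mul p hc]

lemma card_discRoots_prod (s : Multiset ℂ[X]) (hs : (0 : ℂ[X]) ∉ s) :
    Multiset.card (discRoots s.prod) = (s.map fun p => Multiset.card (discRoots p)).sum := by
  classical
  induction s using Multiset.induction_on with
  | empty => simp [discRoots]
  | cons a s ih =>
    have ha : a ≠ 0 := fun h => hs (h ▸ Multiset.mem_cons_self a s)
    have hs' : (0 : ℂ[X]) ∉ s := fun h => hs (Multiset.mem_cons_of_mem h)
    rw [Multiset.prod_cons, Multiset.map_cons, Multiset.sum_cons, ← ih hs', discRoots, discRoots,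
      discRoots, roots_mul (mul_ne_zero ha (Multiset.prod_ne_zero hs')), Multiset.filter_add,
      Multiset.card_add]

/-- Up to sign, the determinant is the characteristic polynomial of `num F` at `lam * den F`, so it
factors as the product of the values of the `μ`. -/
lemma card_discRoots_shiftNum (hF : IsNondegenerate F) (lam : ℂ) :
    Multiset.card (discRoots (shiftNum F lam).det) = open Classical in
      ∑ μ ∈ (factors F).toFinset,
        (factors F).count μ * Multiset.card (discRoots (μ.eval (C lam * den F))) := by
  classical
  have h1 := charpoly_eval_eq F lam
  have h2 : ((-1 : ℂ[X]) ^ m) = C ((-1 : ℂ) ^ m) := by simp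
  rw [h2] at h1
  rw [← discRoots_C_mul (pow_ne_zero m (neg_ne_zero.2 one_ne_zero) : ((-1 : ℂ) ^ m) ≠ 0), ← h1,
    ← factors_prod, eval_multiset_prod, card_discRoots_prod, Multiset.map_map,
    Finset.sum_multiset_map_count]
  · rfl
  · intro h
    obtain ⟨μ, hμ, h0⟩ := Multiset.mem_map.1 h
    exact eval_factor_ne_zero hF hμ lam h0

/-- Pieces correspond to distinct factors `μ`; each contributes its exponent (`pieceMult_eq`) times
the number of disc zeros of `μ(λ d)` (`tsum_zeroOrder_eq`). Finiteness of pieces and of zeros turns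
the infinite sum into a finite double sum. -/
theorem plusIndex_eq (hF : NDARN F) (lam : ℂ) :
    plusIndex F lam = (Multiset.card (discRoots (shiftNum F lam).det) : ℕ) := by
  classical
  obtain ⟨b, Q, hb, hQ⟩ := exists_smul_num'_eq_aeval hF.analytic hF.normal
  have hmin := mem_minimalPrimes_iff hF.analytic hb hQ
  let e : (factors F).toFinset → Piece (curve3 F) := fun μ =>
    ⟨pieceIdeal F b Q μ, (hmin _).2 ⟨μ, Multiset.mem_toFinset.1 μ.2, rfl⟩⟩
  have he : Function.Bijective e := by
    constructor
    · intro μ ν h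
      exact Subtype.ext (eq_of_pieceIdeal_le (Multiset.mem_toFinset.1 μ.2)
        (Multiset.mem_toFinset.1 ν.2) (congrArg Subtype.val h).le)
    · rintro ⟨p, hp⟩
      obtain ⟨μ, hμ, rfl⟩ := (hmin p).1 hp
      exact ⟨⟨μ, Multiset.mem_toFinset.2 hμ⟩, rfl⟩
  have hplace := fun μ : (factors F).toFinset =>
    tsum_zeroOrder_eq hF (Multiset.mem_toFinset.1 μ.2) (e μ) rfl lam
  have hfinP : Finite (Piece (curve3 F)) := Finite.of_surjective e he.2
  have hfin : ∀ j : Piece (curve3 F),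
      Finite {P : Place j // P.IsPlus ∧ P.HasValue (j.coord 0) lam} := by
    intro j
    obtain ⟨μ, rfl⟩ := he.2 j
    exact (hplace μ).1
  have := Fintype.ofFinite (Piece (curve3 F))
  have := fun j : Piece (curve3 F) =>
    Fintype.ofFinite {P : Place j // P.IsPlus ∧ P.HasValue (j.coord 0) lam}
  rw [plusIndex, tsum_fintype, Fintype.sum_sigma, ← (Equiv.ofBijective e he).sum_comp,
    card_discRoots_shiftNum hF.nondegenerate, Nat.cast_sum,
    ← Finset.sum_coe_sort (factors F).toFinset fun μ =>
      (((factors F).count μ * Multiset.card (discRoots (μ.eval (C lam * den F))) : ℕ) : ℕ∞)]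
  refine Finset.sum_congr rfl fun μ _ => ?_
  have h1 := (hplace μ).2
  rw [tsum_fintype] at h1
  rw [Equiv.ofBijective_apply, Nat.cast_mul, ← h1,
    ← pieceMult_eq hF (Multiset.mem_toFinset.1 μ.2) (e μ) rfl]
  exact (Finset.mul_sum Finset.univ
    (fun P : {P : Place (e μ) // P.IsPlus ∧ P.HasValue ((e μ).coord 0) lam} =>
      P.1.zeroOrder ((e μ).coord 0 - algebraMap ℂ (e μ).FunctionField lam))
    (pieceMult F (e μ) : ℕ∞)).symm

end NormalSymbol

end

theorem lemma3 (m : ℕ) (hm : 1 ≤ m) (F : NormalSymbol.RatMatrix m)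
    (hF : NormalSymbol.NDARN F) (lam : ℂ) (hlam : lam ∉ NormalSymbol.gammaSet F) :
    ∃ n : ℕ,
      (∀ x : ℝ, NormalSymbol.IsWindingNumber F lam x ↔ x = n) ∧
      Module.rank ℂ (NormalSymbol.mulRange F lam)ᗮ = n ∧
      NormalSymbol.plusIndex F lam = n :=
  ⟨Multiset.card (NormalSymbol.discRoots (NormalSymbol.shiftNum F lam).det),
    NormalSymbol.isWindingNumber_iff hF.analytic hlam,
    NormalSymbol.rank_mulRange_orthogonal hF.analytic hlam, NormalSymbol.plusIndex_eq hF lam⟩
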